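/- Let $q\ge 6$ be a prime power. Definitions. An $r$-dim nrc in $\mathrm{PG}(6,q)$ is a normal rational curve generating an $r$-space, that is, a set $\{\,[\sum_{j=0}^{r}s^{r-j}t^{j}e_j] : (s,t)\in\mathbb F_q^2\setminus\{0\}\,\}$ with $e_0,\dots,e_r$ linearly independent; a 2-dim nrc is a non-degenerate conic and a 3-dim nrc is a twisted cubic. A ruled quintic surface $\mathcal V$ in $\mathrm{PG}(6,q)$ is the set of points on the $q+1$ lines (the generators of $\mathcal V$) that join the points of a non-degenerate conic $\mathcal C$, lying in a plane $\alpha$, to the corresponding points, under a projectivity of $\mathrm{PGL}(2,q)$ between the parameters, of a twisted cubic lying in a 3-space disjoint from $\alpha$. Let $\mathcal S$ be a regular 2-spread in a hyperplane $\Sigma_\infty$ of $\mathrm{PG}(6,q)$: a set of planes partitioning the points of $\Sigma_\infty$ that contains the 2-regulus through any three of its planes, where a 2-regulus is a set of $q+1$ mutually disjoint planes of $\Sigma_\infty$ such that each line meeting three of them meets all of them. In the Bruck--Bose representation of $\mathrm{PG}(2,q^3)$ in $\mathrm{PG}(6,q)$ the affine points of $\mathrm{PG}(2,q^3)$ are the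 points of $\mathrm{PG}(6,q)\setminus\Sigma_\infty$, the points of the line $\ell_\infty$ at infinity are the planes of $\mathcal S$, and the lines other than $\ell_\infty$ are the 3-spaces that contain a plane of $\mathcal S$ and do not lie in $\Sigma_\infty$. Let $\mathcal B$ be an $\mathbb F_q$-subplane of $\mathrm{PG}(2,q^3)$ that is tangent to $\ell_\infty$ (it meets $\ell_\infty$ in exactly one point), and let $\mathcal V$ be a ruled quintic surface that corresponds to $\mathcal B$, that is, the points of $\mathcal V$ outside $\Sigma_\infty$ are exactly the affine points of $\mathcal B$; then $\mathcal C$ lies in a plane $\alpha\in\mathcal S$. The splash $\mathbb S\subset\mathcal S$ of $\mathcal V$ is the set of planes of $\mathcal S$ that correspond to the points of $\ell_\infty$ lying on an extended line of $\mathcal B$ (a line of $\mathrm{PG}(2,q^3)$ containing at least two points of $\mathcal B$). Theorem. Let $\ell$ be a line of $\alpha$ with $|\ell\cap\mathcal C|=i$ and let $\pi\in\mathcal S$, $\pi\ne\alpha$. Then there are exactly $q$ 5-spaces that contain $\pi$ and $\ell$ and are distinct from $\Sigma_\infty$, and they meet $\mathcal V$ as follows. 1. If $\pi\in\mathbb S\setminus\{\alpha\}$,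 then exactly $q-1$ of them meet $\mathcal V$ in precisely a 5-dim nrc, and exactly $1$ meets $\mathcal V$ in precisely a twisted cubic and $i$ generators. 2. If $\pi\in\mathcal S\setminus\mathbb S$, then exactly $q-i$ of them meet $\mathcal V$ in precisely a 5-dim nrc, and exactly $i$ meet $\mathcal V$ in precisely a 4-dim nrc and $1$ generator. -/

import Mathlib

open scoped LinearAlgebra.Projectivization

namespace RuledQuintic

/-! Projective subspaces of the projective space `ℙ F W` are given by submodules of `W`:
a projective `r`-space is a submodule of dimension `r + 1`. -/

section Projective

variable {F W : Type*} [Field F] [AddCommGroup W] [Module F W]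

/-- The set of projective points lying in the projective subspace given by `X`. -/
def pts (X : Submodule F W) : Set (ℙ F W) := {P | P.submodule ≤ X}

/-- The set of points `L` is a line of the projective space `ℙ F W`. -/
def IsLine (L : Set (ℙ F W)) : Prop :=
  ∃ X : Submodule F W, Module.finrank F X = 2 ∧ L = pts X

/-- `s ^ r • e₀ + s ^ (r - 1) t • e₁ + ⋯ + t ^ r • e_r`, where `u = (s, t)`. -/
def nrcVec {r : ℕ} (e : Fin (r + 1) → W) (u : Fin 2 → F) : W :=
  ∑ j : Fin (r + 1), (u 0 ^ (r - (j : ℕ)) * u 1 ^ (j : ℕ)) • e j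

/-- The rational curve `{(1, θ, …, θ ^ r) | θ ∈ F ∪ {∞}}` in the coordinates given by `e`. -/
def nrcCurve {r : ℕ} (e : Fin (r + 1) → W) : Set (ℙ F W) :=
  {P | ∃ u : Fin 2 → F, u ≠ 0 ∧ P.submodule = Submodule.span F {nrcVec e u}}

/-- `N` is an `r`-dim nrc, that is, a normal rational curve generating a projective `r`-space.
A non-degenerate conic is a 2-dim nrc, a twisted cubic is a 3-dim nrc. -/
def IsNRC (r : ℕ) (N : Set (ℙ F W)) : Prop :=
  ∃ e : Fin (r + 1) → W, LinearIndependent F e ∧ N = nrcCurve (F := F) e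

end Projective

section Scroll

/-- The data defining a scroll that rules a non-degenerate conic and a twisted cubic, lying in
disjoint projective subspaces, by a projectivity of their parameters. -/
structure Scroll (F W : Type*) [Field F] [AddCommGroup W] [Module F W] where
  /-- coordinates of the plane of the conic directrix -/
  a : Fin 3 → W
  /-- coordinates of the 3-space of the twisted cubic directrix -/
  b : Fin 4 → W
  /-- the projectivity, as an element of `GL(2, F)` acting on homogeneous parameters -/
  φ : (Fin 2 → F) ≃ₗ[F] (Fin 2 → F)
  indep_a : LinearIndependent F a
  indep_b : LinearIndependent F b
  disjoint_span : Disjoint (Submodule.span F (Set.range a)) (Submodule.span F (Set.range b))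

variable {F W : Type*} [Field F] [AddCommGroup W] [Module F W]

/-- The conic directrix. -/
def Scroll.conic (V : Scroll F W) : Set (ℙ F W) := nrcCurve V.a

/-- The plane containing the conic directrix. -/
def Scroll.plane (V : Scroll F W) : Submodule F W := Submodule.span F (Set.range V.a)

/-- The line joining the point of the conic with parameter `u` to the corresponding point of the
twisted cubic. -/
def Scroll.generator (V : Scroll F W) (u : Fin 2 → F) : Submodule F W :=
  Submodule.span F {nrcVec V.a u, nrcVec V.b (V.φ u)}

/-- The set of generators. -/
def Scroll.generators (V : Scroll F W) : Set (Submodule F W) :=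
  {g | ∃ u : Fin 2 → F, u ≠ 0 ∧ g = V.generator u}

/-- The points of the ruled surface. -/
def Scroll.points (V : Scroll F W) : Set (ℙ F W) := {P | ∃ g ∈ V.generators, P ∈ pts g}

/-- The projective subspace `X` meets the surface in exactly an `r`-dim nrc and `k` generators. -/
def Scroll.MeetsIn (V : Scroll F W) (X : Submodule F W) (r k : ℕ) : Prop :=
  ∃ (N : Set (ℙ F W)) (G : Finset (Submodule F W)),
    IsNRC r N ∧ (G : Set (Submodule F W)) ⊆ V.generators ∧ G.card = k ∧
      pts X ∩ V.points = N ∪ ⋃ g ∈ G, pts g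

end Scroll

section Spread

variable {F W : Type*} [Field F] [AddCommGroup W] [Module F W]

/-- `S` is a 2-spread of the projective 5-space `H`: a set of planes partitioning its points. -/
def IsSpread (H : Submodule F W) (S : Set (Submodule F W)) : Prop :=
  (∀ X ∈ S, X ≤ H ∧ Module.finrank F X = 3) ∧ ∀ P ∈ pts H, ∃! X, X ∈ S ∧ P ∈ pts X

/-- `R` is a 2-regulus of the projective 5-space `H`: a set of `q + 1` mutually disjoint planes
such that a line meeting three of them meets all of them. -/
def IsRegulus (H : Submodule F W) (R : Set (Submodule F W)) : Prop :=
  (∀ X ∈ R, X ≤ H ∧ Module.finrank F X = 3) ∧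
  R.PairwiseDisjoint id ∧
  R.ncard = Nat.card F + 1 ∧
  ∀ m : Submodule F W, Module.finrank F m = 2 →
    (∃ X ∈ R, ∃ Y ∈ R, ∃ Z ∈ R, X ≠ Y ∧ X ≠ Z ∧ Y ≠ Z ∧
      ¬ Disjoint m X ∧ ¬ Disjoint m Y ∧ ¬ Disjoint m Z) →
    ∀ X ∈ R, ¬ Disjoint m X

/-- `S` is a regular 2-spread of `H`: it contains the 2-regulus through any three of its planes. -/
def IsRegularSpread (H : Submodule F W) (S : Set (Submodule F W)) : Prop :=
  IsSpread H S ∧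
  ∀ X ∈ S, ∀ Y ∈ S, ∀ Z ∈ S, X ≠ Y → X ≠ Z → Y ≠ Z →
    ∀ R, IsRegulus H R → X ∈ R → Y ∈ R → Z ∈ R → R ⊆ S

/-- The points of the completed Bruck-Bose plane: the points not in `H`, and the spread planes,
which are the points at infinity. -/
abbrev BBPoint (H : Submodule F W) (S : Set (Submodule F W)) : Type _ :=
  {P : ℙ F W // P ∉ pts H} ⊕ {X : Submodule F W // X ∈ S}

/-- The points of the Bruck-Bose plane on the line given by the projective 3-space `X`. -/
def bbLine (H : Submodule F W) (S : Set (Submodule F W)) (X : Submodule F W) :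
    Set (BBPoint H S) :=
  {p | p.elim (fun P => P.1 ∈ pts X) (fun Y => Y.1 ≤ X)}

/-- `L` is a line of the Bruck-Bose plane: either the line at infinity, or given by a projective
3-space that contains a spread plane and does not lie in `H`. -/
def IsBBLine {H : Submodule F W} {S : Set (Submodule F W)} (L : Set (BBPoint H S)) : Prop :=
  L = Set.range Sum.inr ∨
  ∃ X : Submodule F W, Module.finrank F X = 4 ∧ ¬ X ≤ H ∧ (∃ Y ∈ S, Y ≤ X) ∧ L = bbLine H S X

end Spread

section BruckBose

variable {F W K : Type*} [Field F] [AddCommGroup W] [Module F W] [Field K]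

/-- `σ` is a Bruck-Bose representation of the projective plane over `K`: an isomorphism onto the
Bruck-Bose plane of the spread `S` of `H`. -/
def IsBruckBose {H : Submodule F W} {S : Set (Submodule F W)}
    (σ : ℙ K (Fin 3 → K) ≃ BBPoint H S) : Prop :=
  ∀ L : Set (ℙ K (Fin 3 → K)), IsLine L ↔ IsBBLine (σ '' L)

/-- `B` is an `F`-subplane of the projective plane over `K`: the points with coordinates in `F`
with respect to some basis. -/
def IsSubplane (F : Type*) {K : Type*} [Field F] [Field K] [Algebra F K]
    (B : Set (ℙ K (Fin 3 → K))) : Prop :=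
  ∃ e : Module.Basis (Fin 3) K (Fin 3 → K),
    B = {p | ∃ w : Fin 3 → F, w ≠ 0 ∧
      p.submodule = Submodule.span K {∑ j, algebraMap F K (w j) • e j}}

/-- `B` is tangent to the line at infinity: it has exactly one point on it. -/
def IsTangent {H : Submodule F W} {S : Set (Submodule F W)}
    (σ : ℙ K (Fin 3 → K) ≃ BBPoint H S) (B : Set (ℙ K (Fin 3 → K))) : Prop :=
  ∃! p, p ∈ B ∧ σ p ∈ Set.range Sum.inr

/-- The ruled surface `V` corresponds to `B`: the points of `V` not in `H` are the
affine points of `B`. -/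
def Corresponds {H : Submodule F W} {S : Set (Submodule F W)}
    (σ : ℙ K (Fin 3 → K) ≃ BBPoint H S) (B : Set (ℙ K (Fin 3 → K))) (V : Scroll F W) : Prop :=
  ∀ P : {P : ℙ F W // P ∉ pts H}, P.1 ∈ V.points ↔ σ.symm (Sum.inl P) ∈ B

/-- The splash of `B`: the spread planes whose points at infinity lie on an extended line of `B`,
that is, on a line that contains two distinct points of `B`. -/
def splash {H : Submodule F W} {S : Set (Submodule F W)}
    (σ : ℙ K (Fin 3 → K) ≃ BBPoint H S) (B : Set (ℙ K (Fin 3 → K))) : Set (Submodule F W) :=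
  {X | ∃ hX : X ∈ S, ∃ L, IsLine L ∧ (∃ p ∈ B ∩ L, ∃ p' ∈ B ∩ L, p ≠ p') ∧
    σ.symm (Sum.inr ⟨X, hX⟩) ∈ L}

end BruckBose

/-- The projective 5-spaces that contain `π` and `ℓ` and are distinct from `H`. -/
def fiveSpaces {F W : Type*} [Field F] [AddCommGroup W] [Module F W]
    (H π ℓ : Submodule F W) : Set (Submodule F W) :=
  {X | Module.finrank F X = 6 ∧ π ≤ X ∧ ℓ ≤ X ∧ X ≠ H}

end RuledQuintic

/-! The proof reduces the surface to one explicit scroll and then counts with binary forms.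

Coordinates. A Bruck-Bose isomorphism sends parallel classes of affine lines to spread planes, so
after a choice of origin it is additive, and semilinear for some embedding of `F` in `K`
(`exists_semilinear_coordinates`). As `F` is finite, all embeddings have the same image, so `K` may
be regarded as an `F`-algebra through this one. A tangent subplane has a basis whose first vector is
its point at infinity, while the linear form `L` of the line at infinity takes the values `1` and `θ
∉ F` on the other two (`exists_adapted_basis`). Then `W` becomes `K × K × F` with `H` given by `z =
0`. An affine point with subplane coordinates `(k, s, t)` has `L`-value `λ = s + tθ`; dividing by
`λ` and multiplying by its norm `N` gives the vector `(k adj, t adj, N)`, where `adj = N / λ = (s +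
tθ')(s + tθ'')` is quadratic in `(s, t)`. For fixed `(s, t)` these points lie on the line joining
`(adj, 0, 0)` on a conic to `(0, t adj, N)` on a twisted cubic: this is `modelScroll`. A line with
three points on a ruled quintic surface is a generator, so the given surface has the same generators
as the model, and the generators determine the conic and its plane.

Counting. The spread plane is `x = m y, z = 0`, and the 5-spaces are the kernels of `A (x - m y) + c
z` for `c` in `F`, where `A` cuts out the line `ℓ` in the conic plane. Such a form restricts to the
quadratic form `A (adj)` on the conic, which does not depend on `c` and has `i` zeros, and to the
cubic form `c N - t A (m adj)` on the twisted cubic. A generator lies in the 5-space when both forms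
vanish, and otherwise meets it in one point. With `h` the common factor and `f`, `g` the cofactors,
these points run over the curve `f b - g a`, which is normal rational of degree `5 - deg h`
(`linearIndependent_sectionCoord`, `meetsIn_ker`).

So only the common factor matters. The quadratic form divides the cubic one exactly when `m = α +
βθ` and `c = β A(1)` (`hyperplaneForm_dvd_iff`), and this condition on `m` describes the splash
(`mem_extended_line_iff`). In the splash, every other `c` gives forms without common zero, because
at a zero of the quadratic form the cubic one equals `(c - β A(1)) N` and the norm has no zeros.
Outside the splash each zero of the quadratic form is a zero of the cubic one for exactly one `c`,
and different zeros have different `c`, since two common zeros would force divisibility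
(`ncard_common_zeros`). -/

namespace RuledQuintic

/-! ### Binary forms and independence of points on a rational normal curve. -/

section Forms

open Polynomial

variable {F : Type*} [Field F]

/-- The value at `u = (s, t)` of the binary form of degree `n` with dehomogenization `f`. -/
def formEval (n : ℕ) (f : F[X]) (u : Fin 2 → F) : F :=
  ∑ j ∈ Finset.range (n + 1), f.coeff j * (u 0 ^ (n - j) * u 1 ^ j)

/-- The determinant of two vectors of the plane. -/
def det₂ (u v : Fin 2 → F) : F := u 0 * v 1 - u 1 * v 0

lemma formEval_of_ne {n : ℕ} {f : F[X]} (hf : f.natDegree ≤ n) {u : Fin 2 → F} (hu : u 0 ≠ 0) :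
    formEval n f u = u 0 ^ n * f.eval (u 1 / u 0) := by
  rw [eval_eq_sum_range' (Nat.lt_succ_of_le hf), Finset.mul_sum]
  refine Finset.sum_congr rfl fun j hj => ?_
  have hj' : j ≤ n := Nat.lt_succ_iff.mp (Finset.mem_range.mp hj)
  have : u 0 ^ n = u 0 ^ (n - j) * u 0 ^ j := by rw [← pow_add, Nat.sub_add_cancel hj']
  rw [this, div_pow]
  field_simp

lemma formEval_of_eq (n : ℕ) (f : F[X]) {u : Fin 2 → F} (hu : u 0 = 0) :
    formEval n f u = f.coeff n * u 1 ^ n := by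
  unfold formEval
  rw [Finset.sum_range_succ, Finset.sum_eq_zero]
  · simp
  · intro j hj
    have : n - j ≠ 0 := by have := Finset.mem_range.mp hj; omega
    simp [hu, this]

lemma formEval_mul {n m : ℕ} {f g : F[X]} (hf : f.natDegree ≤ n) (hg : g.natDegree ≤ m)
    (u : Fin 2 → F) : formEval (n + m) (f * g) u = formEval n f u * formEval m g u := by
  by_cases hu : u 0 = 0
  · rw [formEval_of_eq _ _ hu, formEval_of_eq _ _ hu, formEval_of_eq _ _ hu,
      coeff_mul_add_eq_of_natDegree_le hf hg]
    ring
  · rw [formEval_of_ne (natDegree_mul_le_of_le hf hg) hu, formEval_of_ne hf hu,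
      formEval_of_ne hg hu, eval_mul]
    ring

lemma formEval_sub (n : ℕ) (f g : F[X]) (u : Fin 2 → F) :
    formEval n (f - g) u = formEval n f u - formEval n g u := by
  simp [formEval, sub_mul, Finset.sum_sub_distrib]

lemma formEval_one_zero (u : Fin 2 → F) : formEval 0 (1 : F[X]) u = 1 := by
  simp [formEval]

/-- The linear form vanishing at `u`. -/
noncomputable def linForm (u : Fin 2 → F) : F[X] := C (u 0) * X - C (u 1)

lemma natDegree_linForm_le (u : Fin 2 → F) : (linForm u).natDegree ≤ 1 := by
  unfold linForm; compute_degree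

lemma formEval_linForm (u v : Fin 2 → F) : formEval 1 (linForm u) v = det₂ u v := by
  simp [formEval, linForm, det₂, Finset.sum_range_succ, coeff_X, coeff_C]
  ring

lemma exists_eq_smul_of_det₂_eq_zero {u v : Fin 2 → F} (hu : u ≠ 0) (h : det₂ u v = 0) :
    ∃ c : F, v = c • u := by
  unfold det₂ at h
  by_cases h0 : u 0 = 0
  · have h1 : u 1 ≠ 0 := fun h1 => hu (by ext i; fin_cases i <;> simp [h0, h1])
    refine ⟨v 1 / u 1, ?_⟩
    have : v 0 = 0 := by
      rw [h0, zero_mul, zero_sub, neg_eq_zero] at h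
      exact (mul_eq_zero.mp h).resolve_left h1
    ext i; fin_cases i
    · simp [h0, this]
    · simp [h1]
  · refine ⟨v 0 / u 0, ?_⟩
    ext i; fin_cases i
    · simp [h0]
    · simp; field_simp; linear_combination h

lemma det₂_smul (c : F) (u : Fin 2 → F) : det₂ u (c • u) = 0 := by
  simp [det₂]; ring

/-- The factor theorem for forms. When `u 0 = 0` the polynomial `linForm u` is a nonzero constant,
and vanishing at `u` means that the top coefficient is zero, which is what lowers the degree bound.
-/
lemma exists_eq_linForm_mul {n : ℕ} {f : F[X]} (hf : f.natDegree ≤ n + 1) {u : Fin 2 → F}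
    (hu : u ≠ 0) (h : formEval (n + 1) f u = 0) :
    ∃ g : F[X], g.natDegree ≤ n ∧ f = linForm u * g := by
  by_cases h0 : u 0 = 0
  · have h1 : u 1 ≠ 0 := fun h1 => hu (by ext i; fin_cases i <;> simp [h0, h1])
    rw [formEval_of_eq _ _ h0] at h
    have hc : f.coeff (n + 1) = 0 := (mul_eq_zero.mp h).resolve_right (pow_ne_zero _ h1)
    refine ⟨C (-(u 1)⁻¹) * f, ?_, ?_⟩
    · refine (natDegree_C_mul_le _ _).trans ?_
      rw [natDegree_le_iff_coeff_eq_zero]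
      intro N hN
      rcases Nat.lt_or_ge (n + 1) N with h' | h'
      · exact coeff_eq_zero_of_natDegree_lt (hf.trans_lt h')
      · obtain rfl : N = n + 1 := by omega
        exact hc
    · rw [linForm, h0, ← mul_assoc]
      have : (C 0 * X - C (u 1)) * C (-(u 1)⁻¹) = (1 : F[X]) := by
        rw [C_0, zero_mul, zero_sub, ← C_neg, ← C_mul]
        simp [h1]
      rw [this, one_mul]
  · rw [formEval_of_ne hf h0] at h
    have hr : f.eval (u 1 / u 0) = 0 := (mul_eq_zero.mp h).resolve_left (pow_ne_zero _ h0)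
    obtain ⟨g, hg⟩ := dvd_iff_isRoot.mpr hr
    refine ⟨C (u 0)⁻¹ * g, ?_, ?_⟩
    · refine (natDegree_C_mul_le _ _).trans ?_
      by_cases hg0 : g = 0
      · simp [hg0]
      · rw [hg, natDegree_mul (X_sub_C_ne_zero _) hg0, natDegree_X_sub_C] at hf
        omega
    · rw [hg, linForm, ← mul_assoc]
      congr 1
      have : C (u 1) = C (u 0) * C (u 1 / u 0) := by rw [← C_mul]; congr 1; field_simp
      rw [this, ← mul_sub, mul_comm (C (u 0)), mul_assoc, ← C_mul, mul_inv_cancel₀ h0, C_1, mul_one]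

/-- The polynomial with given coefficients. -/
noncomputable def ofCoeffs {n : ℕ} (c : Fin (n + 1) → F) : F[X] := ∑ j : Fin (n + 1), monomial (j : ℕ) (c j)

lemma coeff_ofCoeffs {n : ℕ} (c : Fin (n + 1) → F) (j : Fin (n + 1)) :
    (ofCoeffs c).coeff j = c j := by
  simp only [ofCoeffs, finsetSum_coeff, coeff_monomial]
  rw [Finset.sum_eq_single j]
  · simp
  · intro b _ hb
    rw [if_neg (fun h => hb (Fin.ext h))]
  · simp

lemma natDegree_ofCoeffs_le {n : ℕ} (c : Fin (n + 1) → F) : (ofCoeffs c).natDegree ≤ n := by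
  refine natDegree_sum_le_of_forall_le _ _ fun j _ => ?_
  exact (natDegree_monomial_le _).trans (Nat.lt_succ_iff.mp j.2)

lemma formEval_eq_sum_fin (n : ℕ) (f : F[X]) (u : Fin 2 → F) :
    formEval n f u = ∑ j : Fin (n + 1), f.coeff j * (u 0 ^ (n - (j : ℕ)) * u 1 ^ (j : ℕ)) :=
  (Fin.sum_univ_eq_sum_range (fun j => f.coeff j * (u 0 ^ (n - j) * u 1 ^ j)) (n + 1)).symm

variable {W : Type*} [AddCommGroup W] [Module F W]

lemma apply_nrcVec {r : ℕ} (f : W →ₗ[F] F) (e : Fin (r + 1) → W) (u : Fin 2 → F) :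
    f (nrcVec e u) = formEval r (ofCoeffs (f ∘ e)) u := by
  simp only [formEval_eq_sum_fin, coeff_ofCoeffs, nrcVec, map_sum, map_smul, smul_eq_mul,
    Function.comp]
  exact Finset.sum_congr rfl fun j _ => mul_comm _ _

lemma nrcVec_smul {r : ℕ} (e : Fin (r + 1) → W) (c : F) (u : Fin 2 → F) :
    nrcVec e (c • u) = c ^ r • nrcVec e u := by
  simp only [nrcVec, Finset.smul_sum, smul_smul, Pi.smul_apply, smul_eq_mul]
  refine Finset.sum_congr rfl fun j _ => ?_
  have : c ^ r = c ^ (r - (j : ℕ)) * c ^ (j : ℕ) := by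
    rw [← pow_add, Nat.sub_add_cancel (Nat.lt_succ_iff.mp j.2)]
  rw [this]
  congr 1; ring

lemma exists_form_eq_prod {ι : Type*} (u : ι → Fin 2 → F) (s : Finset ι) :
    ∃ f : F[X], f.natDegree ≤ s.card ∧ ∀ v, formEval s.card f v = ∏ i ∈ s, det₂ (u i) v := by
  classical
  induction s using Finset.induction_on with
  | empty => exact ⟨1, by simp, fun v => by simp [formEval]⟩
  | insert a s ha ih =>
    obtain ⟨f, hf, hv⟩ := ih
    refine ⟨f * linForm (u a), ?_, fun v => ?_⟩
    · rw [Finset.card_insert_of_notMem ha]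
      exact natDegree_mul_le_of_le hf (natDegree_linForm_le _)
    · rw [Finset.card_insert_of_notMem ha, formEval_mul hf (natDegree_linForm_le _), hv,
        formEval_linForm, Finset.prod_insert ha, mul_comm]

lemma exists_form_ne_zero (n : ℕ) {u : Fin 2 → F} (hu : u ≠ 0) :
    ∃ f : F[X], f.natDegree ≤ n ∧ formEval n f u ≠ 0 := by
  by_cases h0 : u 0 = 0
  · have h1 : u 1 ≠ 0 := fun h1 => hu (by ext i; fin_cases i <;> simp [h0, h1])
    refine ⟨X ^ n, by simp, ?_⟩
    rw [formEval_of_eq _ _ h0]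
    simp [h1]
  · refine ⟨1, by simp, ?_⟩
    rw [formEval_of_ne (by simp) h0]
    simp [h0]

/-- At most `r + 1` distinct points of a rational normal curve of degree `r` are independent. -/
theorem linearIndependent_nrcVec {r : ℕ} {e : Fin (r + 1) → W} (he : LinearIndependent F e)
    {ι : Type*} [Fintype ι] (hι : Fintype.card ι ≤ r + 1) (u : ι → Fin 2 → F)
    (hu : ∀ i, u i ≠ 0) (hd : ∀ i j, i ≠ j → det₂ (u i) (u j) ≠ 0) :
    LinearIndependent F fun i => nrcVec e (u i) := by
  classical
  rw [Fintype.linearIndependent_iff]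
  intro g hg
  -- A relation between points of the curve is a relation between the values of every form of degree
  -- `r` at their parameters.
  have key : ∀ f : F[X], ∑ i, g i * formEval r f (u i) = 0 := by
    intro f
    have h1 : ∀ j : Fin (r + 1),
        ∑ i, g i * (u i 0 ^ (r - (j : ℕ)) * u i 1 ^ (j : ℕ)) = 0 := by
      refine Fintype.linearIndependent_iff.mp he _ ?_
      rw [← hg]
      simp only [nrcVec, Finset.smul_sum, Finset.sum_smul, smul_smul]
      exact Finset.sum_comm
    simp only [formEval_eq_sum_fin, Finset.mul_sum]
    rw [Finset.sum_comm]
    refine Finset.sum_eq_zero fun j _ => ?_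
    have := congrArg (fun x => f.coeff j * x) (h1 j)
    simp only [Finset.mul_sum, mul_zero] at this
    rw [← this]
    exact Finset.sum_congr rfl fun i _ => by ring
  intro i
  -- The test form is the product of the linear forms vanishing at the other parameters. The factor
  -- `k`, nonzero at `u i`, raises its degree to `r`.
  obtain ⟨f, hf, hfv⟩ := exists_form_eq_prod u (Finset.univ.erase i)
  have hc : (Finset.univ.erase i).card ≤ r := by
    rw [Finset.card_erase_of_mem (Finset.mem_univ _), Finset.card_univ]; omega
  obtain ⟨k, hk, hki⟩ := exists_form_ne_zero (r - (Finset.univ.erase i).card) (hu i)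
  have hmul : ∀ v, formEval r (f * k) v =
      (∏ j ∈ Finset.univ.erase i, det₂ (u j) v) *
        formEval (r - (Finset.univ.erase i).card) k v := by
    intro v
    rw [← hfv, ← formEval_mul hf hk, Nat.add_sub_cancel' hc]
  have := key (f * k)
  rw [Finset.sum_eq_single i] at this
  · refine (mul_eq_zero.mp this).resolve_right ?_
    rw [hmul]
    refine mul_ne_zero (Finset.prod_ne_zero_iff.mpr fun j hj => ?_) hki
    exact hd _ _ (Finset.ne_of_mem_erase hj)
  · intro j _ hj
    rw [hmul, Finset.prod_eq_zero (Finset.mem_erase.mpr ⟨hj, Finset.mem_univ _⟩), zero_mul,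
      mul_zero]
    simp [det₂]; ring
  · simp

lemma nrcVec_ne_zero {r : ℕ} {e : Fin (r + 1) → W} (he : LinearIndependent F e)
    {u : Fin 2 → F} (hu : u ≠ 0) : nrcVec e u ≠ 0 := by
  have := linearIndependent_nrcVec he (ι := Unit) (by simp) (fun _ => u) (fun _ => hu)
    (fun i j h => absurd (Subsingleton.elim i j) h)
  exact this.ne_zero ()

lemma nrcVec_mem_span {r : ℕ} (e : Fin (r + 1) → W) (u : Fin 2 → F) :
    nrcVec e u ∈ Submodule.span F (Set.range e) :=
  Submodule.sum_mem _ fun j _ =>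
    Submodule.smul_mem _ _ (Submodule.subset_span (Set.mem_range_self j))

end Forms

/-! ### Parameters on the projective line. -/

section Parameters

variable {F W : Type*} [Field F] [AddCommGroup W] [Module F W]

lemma det₂_rep_ne_zero {p p' : ℙ F (Fin 2 → F)} (h : p ≠ p') : det₂ p.rep p'.rep ≠ 0 := by
  intro h0
  obtain ⟨c, hc⟩ := exists_eq_smul_of_det₂_eq_zero p.rep_nonzero h0
  apply h
  rw [← p.mk_rep, ← p'.mk_rep, eq_comm, Projectivization.mk_eq_mk_iff']
  exact ⟨c, hc.symm⟩

lemma exists_rep_smul {u : Fin 2 → F} (hu : u ≠ 0) :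
    ∃ c : F, c ≠ 0 ∧ (Projectivization.mk F u hu).rep = c • u := by
  obtain ⟨c, hc⟩ := Projectivization.exists_smul_eq_mk_rep F u hu
  exact ⟨c, c.ne_zero, hc.symm⟩

lemma span_smul_singleton {c : F} (hc : c ≠ 0) (x : W) :
    Submodule.span F {c • x} = Submodule.span F {x} :=
  Submodule.span_singleton_smul_eq (IsUnit.mk0 c hc) x

lemma span_nrcVec_rep {r : ℕ} (e : Fin (r + 1) → W) {u : Fin 2 → F} (hu : u ≠ 0) :
    Submodule.span F {nrcVec e (Projectivization.mk F u hu).rep} =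
      Submodule.span F {nrcVec e u} := by
  obtain ⟨c, hc, h⟩ := exists_rep_smul hu
  rw [h, nrcVec_smul, span_smul_singleton (pow_ne_zero _ hc)]

lemma mem_nrcCurve_iff {r : ℕ} (e : Fin (r + 1) → W) (P : ℙ F W) :
    P ∈ nrcCurve e ↔
      ∃ p : ℙ F (Fin 2 → F), P.submodule = Submodule.span F {nrcVec e p.rep} := by
  constructor
  · rintro ⟨u, hu, h⟩
    exact ⟨Projectivization.mk F u hu, by rw [h, span_nrcVec_rep]⟩
  · rintro ⟨p, h⟩
    exact ⟨p.rep, p.rep_nonzero, h⟩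

lemma finrank_span_pair {x y : W} (h : LinearIndependent F ![x, y]) :
    Module.finrank F (Submodule.span F {x, y}) = 2 := by
  have := finrank_span_eq_card h
  rwa [Matrix.range_cons_cons_empty, Fintype.card_fin] at this

lemma mem_pts_mk {X : Submodule F W} {x : W} (hx : x ≠ 0) :
    Projectivization.mk F x hx ∈ pts X ↔ x ∈ X := by
  simp [pts, Submodule.span_singleton_le_iff_mem]

lemma mem_pts_iff_rep {X : Submodule F W} {P : ℙ F W} : P ∈ pts X ↔ P.rep ∈ X := by
  simp [pts, P.submodule_eq, Submodule.span_singleton_le_iff_mem]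

lemma exists_params [Finite F] {n : ℕ} (hn : n ≤ Nat.card F) (p : ℙ F (Fin 2 → F)) :
    ∃ f : Fin (n + 1) → ℙ F (Fin 2 → F), Function.Injective f ∧ f 0 = p := by
  classical
  have hfin : Finite (ℙ F (Fin 2 → F)) :=
    (Projectivization.finite_iff_of_finite F (Fin 2 → F)).mpr inferInstance
  have hcard : Nat.card (ℙ F (Fin 2 → F)) = Nat.card F + 1 :=
    Projectivization.card_of_finrank_two F (Fin 2 → F) (by simp)
  have : Fintype (ℙ F (Fin 2 → F)) := Fintype.ofFinite _
  have h1 : Fintype.card (Fin n) ≤ Fintype.card {x : ℙ F (Fin 2 → F) // x ≠ p} := by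
    rw [Fintype.card_subtype_compl, Fintype.card_subtype_eq, ← Nat.card_eq_fintype_card (α := ℙ F (Fin 2 → F)), hcard]
    simpa using hn
  obtain ⟨g⟩ := Function.Embedding.nonempty_of_card_le h1
  refine ⟨Fin.cons p fun i => (g i).1, ?_, rfl⟩
  rw [Fin.cons_injective_iff]
  refine ⟨?_, Subtype.val_injective.comp g.injective⟩
  rintro ⟨i, hi⟩
  exact (g i).2 hi

lemma linearIndependent_nrcVec_rep {r : ℕ} {e : Fin (r + 1) → W} (he : LinearIndependent F e)
    {ι : Type*} [Fintype ι] (hι : Fintype.card ι ≤ r + 1) {p : ι → ℙ F (Fin 2 → F)}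
    (hp : Function.Injective p) : LinearIndependent F fun i => nrcVec e (p i).rep :=
  linearIndependent_nrcVec he hι (fun i => (p i).rep) (fun i => (p i).rep_nonzero)
    fun _ _ hij => det₂_rep_ne_zero (hp.ne hij)

/-- A rational normal curve of degree `r ≤ q` spans its projective `r`-space. -/
lemma span_range_le_of_nrcCurve [Finite F] {r : ℕ} (hr : r ≤ Nat.card F) {e : Fin (r + 1) → W}
    (he : LinearIndependent F e) {X : Submodule F W} (h : ∀ p : ℙ F (Fin 2 → F),
      nrcVec e p.rep ∈ X) : Submodule.span F (Set.range e) ≤ X := by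
  have hne : ∃ u : Fin 2 → F, u ≠ 0 := exists_ne 0
  obtain ⟨u, hu⟩ := hne
  -- There are `q + 1 ≥ r + 1` parameters, so the curve contains a basis of its space.
  obtain ⟨f, hf, -⟩ := exists_params hr (Projectivization.mk F u hu)
  have hi := linearIndependent_nrcVec_rep he (by simp) hf
  have hle : Submodule.span F (Set.range fun i => nrcVec e (f i).rep) ≤
      Submodule.span F (Set.range e) := by
    rw [Submodule.span_le]
    rintro _ ⟨i, rfl⟩
    exact nrcVec_mem_span _ _
  have hfd : FiniteDimensional F (Submodule.span F (Set.range e)) :=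
    FiniteDimensional.span_of_finite F (Set.finite_range e)
  have := Submodule.eq_of_le_of_finrank_eq hle (by
    rw [finrank_span_eq_card hi, finrank_span_eq_card he])
  rw [← this, Submodule.span_le]
  rintro _ ⟨i, rfl⟩
  exact h _

end Parameters

/-! ### Generators determine the scroll, its conic and its plane. -/

section ScrollGeometry

variable {F W : Type*} [Field F] [AddCommGroup W] [Module F W] (V : Scroll F W)

lemma Scroll.generator_rep {u : Fin 2 → F} (hu : u ≠ 0) :
    V.generator (Projectivization.mk F u hu).rep = V.generator u := by
  obtain ⟨c, hc, h⟩ := exists_rep_smul hu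
  unfold Scroll.generator
  rw [h, map_smul, nrcVec_smul, nrcVec_smul, Submodule.span_insert, Submodule.span_insert,
    span_smul_singleton (pow_ne_zero _ hc), span_smul_singleton (pow_ne_zero _ hc)]

lemma Scroll.mem_generators_iff (g : Submodule F W) :
    g ∈ V.generators ↔ ∃ p : ℙ F (Fin 2 → F), g = V.generator p.rep := by
  constructor
  · rintro ⟨u, hu, rfl⟩
    exact ⟨Projectivization.mk F u hu, (V.generator_rep hu).symm⟩
  · rintro ⟨p, rfl⟩
    exact ⟨p.rep, p.rep_nonzero, rfl⟩

lemma Scroll.mem_points_iff (P : ℙ F W) :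
    P ∈ V.points ↔ ∃ p : ℙ F (Fin 2 → F), P.rep ∈ V.generator p.rep := by
  simp only [Scroll.points, Set.mem_ofPred_eq, mem_pts_iff_rep]
  constructor
  · rintro ⟨g, hg, h⟩
    obtain ⟨p, rfl⟩ := (V.mem_generators_iff g).mp hg
    exact ⟨p, h⟩
  · rintro ⟨p, h⟩
    exact ⟨_, (V.mem_generators_iff _).mpr ⟨p, rfl⟩, h⟩

lemma Scroll.det₂_φ_ne_zero {p p' : ℙ F (Fin 2 → F)} (h : p ≠ p') :
    det₂ (V.φ p.rep) (V.φ p'.rep) ≠ 0 := by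
  intro h0
  obtain ⟨c, hc⟩ := exists_eq_smul_of_det₂_eq_zero (V.φ.map_ne_zero_iff.mpr p.rep_nonzero) h0
  rw [← map_smul] at hc
  have := V.φ.injective hc
  apply det₂_rep_ne_zero h
  rw [this, det₂_smul]

lemma Scroll.eq_zero_of_add_eq_zero {x y : W} (hx : x ∈ V.plane)
    (hy : y ∈ Submodule.span F (Set.range V.b)) (h : x + y = 0) : x = 0 ∧ y = 0 := by
  have hxy : x = -y := eq_neg_of_add_eq_zero_left h
  have hx0 : x = 0 :=
    Submodule.disjoint_def.mp V.disjoint_span x hx (hxy ▸ Submodule.neg_mem _ hy)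
  exact ⟨hx0, by simpa [hx0] using h⟩

/-- A linear relation between vectors on at most four generators involves only the conic. -/
lemma Scroll.exists_of_sum_eq_zero {ι : Type*} [Fintype ι] (hι : Fintype.card ι ≤ 4)
    {p : ι → ℙ F (Fin 2 → F)} (hp : Function.Injective p) {x : ι → W}
    (hx : ∀ i, x i ∈ V.generator (p i).rep) (h : ∑ i, x i = 0) :
    ∃ c : ι → F, (∀ i, x i = c i • nrcVec V.a (p i).rep) ∧
      ∑ i, c i • nrcVec V.a (p i).rep = 0 := by
  have h1 : ∀ i, ∃ c d : F, c • nrcVec V.a (p i).rep + d • nrcVec V.b (V.φ (p i).rep) = x i :=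
    fun i => Submodule.mem_span_pair.mp (hx i)
  choose c d hcd using h1
  have hsum : ∑ i, c i • nrcVec V.a (p i).rep + ∑ i, d i • nrcVec V.b (V.φ (p i).rep) = 0 := by
    rw [← Finset.sum_add_distrib, ← h]
    exact Finset.sum_congr rfl fun i _ => hcd i
  obtain ⟨ha, hb⟩ := V.eq_zero_of_add_eq_zero
    (Submodule.sum_mem _ fun i _ => Submodule.smul_mem _ _ (nrcVec_mem_span _ _))
    (Submodule.sum_mem _ fun i _ => Submodule.smul_mem _ _ (nrcVec_mem_span _ _)) hsum
  -- Four points of a twisted cubic are independent, so the cubic components all vanish.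
  have hi := linearIndependent_nrcVec V.indep_b hι (fun i => V.φ (p i).rep)
    (fun i => V.φ.map_ne_zero_iff.mpr (p i).rep_nonzero)
    (fun i j hij => V.det₂_φ_ne_zero (hp.ne hij))
  have hd := Fintype.linearIndependent_iff.mp hi d hb
  exact ⟨c, fun i => by rw [← hcd, hd, zero_smul, add_zero], ha⟩

/-- Three points of the conic are independent too, so nothing is left of the relation: any three
generators are independent. -/
lemma Scroll.eq_zero_of_sum_eq_zero {ι : Type*} [Fintype ι] (hι : Fintype.card ι ≤ 3)
    {p : ι → ℙ F (Fin 2 → F)} (hp : Function.Injective p) {x : ι → W}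
    (hx : ∀ i, x i ∈ V.generator (p i).rep) (h : ∑ i, x i = 0) (i : ι) : x i = 0 := by
  obtain ⟨c, hc, hs⟩ := V.exists_of_sum_eq_zero (hι.trans (by norm_num)) hp hx h
  have hi := linearIndependent_nrcVec_rep V.indep_a hι hp
  rw [hc, Fintype.linearIndependent_iff.mp hi c hs i, zero_smul]

lemma Scroll.linearIndependent_generator {u : Fin 2 → F} (hu : u ≠ 0) :
    LinearIndependent F ![nrcVec V.a u, nrcVec V.b (V.φ u)] := by
  rw [LinearIndependent.pair_iff]
  intro s t h
  obtain ⟨h1, h2⟩ := V.eq_zero_of_add_eq_zero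
    (Submodule.smul_mem _ _ (nrcVec_mem_span _ _)) (Submodule.smul_mem _ _ (nrcVec_mem_span _ _)) h
  exact ⟨(smul_eq_zero.mp h1).resolve_right (nrcVec_ne_zero V.indep_a hu),
    (smul_eq_zero.mp h2).resolve_right
      (nrcVec_ne_zero V.indep_b (V.φ.map_ne_zero_iff.mpr hu))⟩

lemma Scroll.finrank_generator {u : Fin 2 → F} (hu : u ≠ 0) :
    Module.finrank F (V.generator u) = 2 := by
  exact finrank_span_pair (V.linearIndependent_generator hu)

lemma Scroll.finrank_plane : Module.finrank F V.plane = 3 := by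
  rw [Scroll.plane, finrank_span_eq_card V.indep_a, Fintype.card_fin]

lemma Scroll.disjoint_generator {p p' : ℙ F (Fin 2 → F)} (h : p ≠ p') {x : W}
    (hx : x ∈ V.generator p.rep) (hx' : x ∈ V.generator p'.rep) : x = 0 := by
  refine V.eq_zero_of_sum_eq_zero (ι := Fin 2) (by simp) (p := ![p, p']) (x := ![x, -x]) ?_ ?_ ?_ 0
  · intro i j hij
    fin_cases i <;> fin_cases j <;> simp_all
  · intro i
    fin_cases i
    · simpa using hx
    · simpa using hx'
  · simp

lemma Scroll.generator_rep_injective :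
    Function.Injective fun p : ℙ F (Fin 2 → F) => V.generator p.rep := by
  intro p p' h
  by_contra hne
  have hm : nrcVec V.a p.rep ∈ V.generator p.rep := Submodule.subset_span (by simp)
  have hm' : nrcVec V.a p.rep ∈ V.generator p'.rep := by
    have h : V.generator p.rep = V.generator p'.rep := h
    rwa [← h]
  exact nrcVec_ne_zero V.indep_a p.rep_nonzero (V.disjoint_generator hne hm hm')

/-- A line with three points on the scroll is a generator. -/
lemma Scroll.mem_generators_of_collinear {g : Submodule F W} (hg : Module.finrank F g = 2)
    {P : Fin 3 → ℙ F W} (hP : Function.Injective P) (hPg : ∀ i, P i ∈ pts g)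
    (hPV : ∀ i, P i ∈ V.points) : g ∈ V.generators := by
  have hfd : FiniteDimensional F g := FiniteDimensional.of_finrank_pos (by omega)
  have h1 : ∀ i, ∃ p : ℙ F (Fin 2 → F), (P i).rep ∈ V.generator p.rep :=
    fun i => (V.mem_points_iff _).mp (hPV i)
  choose p hp using h1
  -- Points on three different generators are independent, which is impossible in a line. Hence two
  -- of the points share a generator, and that generator is `g`.
  have hninj : ¬ Function.Injective p := by
    intro hinj
    have hdep : LinearIndependent F fun i => (P i).rep := by
      rw [Fintype.linearIndependent_iff]
      intro c hc i
      have := V.eq_zero_of_sum_eq_zero (by simp) hinj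
        (fun i => Submodule.smul_mem _ (c i) (hp i)) hc i
      exact (smul_eq_zero.mp this).resolve_right (P i).rep_nonzero
    have hle : Submodule.span F (Set.range fun i => (P i).rep) ≤ g := by
      rw [Submodule.span_le]
      rintro _ ⟨i, rfl⟩
      exact mem_pts_iff_rep.mp (hPg i)
    have := Submodule.finrank_mono hle
    rw [finrank_span_eq_card hdep, hg] at this
    simp at this
  simp only [Function.Injective, not_forall] at hninj
  obtain ⟨i, j, hij, hne⟩ := hninj
  have hli : LinearIndependent F ![(P i).rep, (P j).rep] := by
    have := Projectivization.linearIndependent_pair_iff_ne.mpr (hP.ne hne)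
    exact this
  have hspan : Module.finrank F (Submodule.span F {(P i).rep, (P j).rep}) = 2 :=
    finrank_span_pair hli
  have e1 : Submodule.span F {(P i).rep, (P j).rep} = g := by
    refine Submodule.eq_of_le_of_finrank_eq ?_ (by rw [hspan, hg])
    rw [Submodule.span_le, Set.pair_subset_iff]
    exact ⟨mem_pts_iff_rep.mp (hPg i), mem_pts_iff_rep.mp (hPg j)⟩
  have hfd' : FiniteDimensional F (V.generator (p i).rep) :=
    FiniteDimensional.of_finrank_pos (by rw [V.finrank_generator (p i).rep_nonzero]; omega)
  have e2 : Submodule.span F {(P i).rep, (P j).rep} = V.generator (p i).rep := by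
    refine Submodule.eq_of_le_of_finrank_eq ?_
      (by rw [hspan, V.finrank_generator (p i).rep_nonzero])
    rw [Submodule.span_le, Set.pair_subset_iff]
    exact ⟨hp i, hij ▸ hp j⟩
  rw [← e1, e2]
  exact (V.mem_generators_iff _).mpr ⟨_, rfl⟩

/-- Expresses the conic through the point set and the plane, both of which depend only on the
generators. -/
lemma Scroll.mem_conic_iff (P : ℙ F W) : P ∈ V.conic ↔ P ∈ V.points ∧ P ∈ pts V.plane := by
  rw [Scroll.conic, mem_nrcCurve_iff, Scroll.mem_points_iff]
  constructor
  · rintro ⟨p, hp⟩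
    refine ⟨⟨p, ?_⟩, ?_⟩
    · have : P.submodule ≤ V.generator p.rep := by
        rw [hp]; exact Submodule.span_mono (by simp)
      exact mem_pts_iff_rep.mp this
    · show P.submodule ≤ _
      rw [hp, Submodule.span_singleton_le_iff_mem]
      exact nrcVec_mem_span _ _
  · rintro ⟨⟨p, hp⟩, hpl⟩
    obtain ⟨c, d, hcd⟩ := Submodule.mem_span_pair.mp hp
    have hpl' := mem_pts_iff_rep.mp hpl
    have hd : d • nrcVec V.b (V.φ p.rep) = 0 := by
      refine (V.eq_zero_of_add_eq_zero (x := c • nrcVec V.a p.rep - P.rep) (Submodule.sub_mem _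
        (Submodule.smul_mem _ _ (nrcVec_mem_span _ _)) hpl')
        (Submodule.smul_mem _ _ (nrcVec_mem_span _ _)) ?_).2
      rw [← hcd]; abel
    rw [hd, add_zero] at hcd
    refine ⟨p, ?_⟩
    have hc : c ≠ 0 := by
      rintro rfl
      exact P.rep_nonzero (by rw [← hcd, zero_smul])
    rw [P.submodule_eq, ← hcd, span_smul_singleton hc]

variable {V}

/-- Four points of a conic are dependent while three are not, so every coefficient of the relation
is nonzero. Read in `V'`, it is a relation between vectors on four generators, and
`Scroll.exists_of_sum_eq_zero` puts those vectors into `V'.plane`. Four parameters exist because `q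
≥ 3`. -/
lemma Scroll.plane_le_of_generators_eq [Finite F] (hF : 3 ≤ Nat.card F) {V' : Scroll F W}
    (h : V.generators = V'.generators) : V.plane ≤ V'.plane := by
  refine span_range_le_of_nrcCurve (by omega) V.indep_a fun p => ?_
  obtain ⟨f, hf, hf0⟩ := exists_params hF p
  have h1 : ∀ i, ∃ p' : ℙ F (Fin 2 → F), V.generator (f i).rep = V'.generator p'.rep := fun i =>
    (V'.mem_generators_iff _).mp (h ▸ (V.mem_generators_iff _).mpr ⟨_, rfl⟩)
  choose f' hf' using h1
  have hinj : Function.Injective f' := by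
    intro i j hij
    apply hf
    apply V.generator_rep_injective
    show V.generator _ = V.generator _
    rw [hf', hf', hij]
  have hdep : ¬ LinearIndependent F fun i => nrcVec V.a (f i).rep := by
    intro hli
    have hle : Submodule.span F (Set.range fun i => nrcVec V.a (f i).rep) ≤ V.plane := by
      rw [Submodule.span_le]
      rintro _ ⟨i, rfl⟩
      exact nrcVec_mem_span _ _
    have hfd : FiniteDimensional F V.plane :=
      FiniteDimensional.of_finrank_pos (by rw [V.finrank_plane]; omega)
    have := Submodule.finrank_mono hle
    rw [finrank_span_eq_card hli, V.finrank_plane] at this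
    simp at this
  rw [Fintype.not_linearIndependent_iff] at hdep
  obtain ⟨c, hc, i, hi⟩ := hdep
  have hc0 : c 0 ≠ 0 := by
    intro h0
    have hli := linearIndependent_nrcVec_rep (p := fun i : Fin 3 => f i.succ) V.indep_a (by simp)
      (hf.comp (Fin.succ_injective _))
    rw [Fin.sum_univ_succ, h0, zero_smul, zero_add] at hc
    have hz := Fintype.linearIndependent_iff.mp hli (fun i => c i.succ) hc
    refine Fin.cases (motive := fun i => c i ≠ 0 → False) (fun h => h h0) (fun j h => h (hz j)) i hi
  obtain ⟨d, hd, -⟩ := V'.exists_of_sum_eq_zero (by simp) hinj (x := fun i => c i • nrcVec V.a (f i).rep)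
    (fun i => Submodule.smul_mem _ _ (by rw [← hf']; exact Submodule.subset_span (by simp))) hc
  have h2 : c 0 • nrcVec V.a (f 0).rep ∈ V'.plane := by
    rw [hd 0]
    exact Submodule.smul_mem _ _ (nrcVec_mem_span _ _)
  rw [hf0] at h2
  exact (Submodule.smul_mem_iff _ hc0).mp h2

lemma Scroll.points_eq_of_generators_eq {V' : Scroll F W} (h : V.generators = V'.generators) :
    V.points = V'.points := by
  simp only [Scroll.points, h]

lemma Scroll.plane_eq_of_generators_eq [Finite F] (hF : 3 ≤ Nat.card F) {V' : Scroll F W}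
    (h : V.generators = V'.generators) : V.plane = V'.plane :=
  le_antisymm (plane_le_of_generators_eq hF h) (plane_le_of_generators_eq hF h.symm)

lemma Scroll.conic_eq_of_generators_eq [Finite F] (hF : 3 ≤ Nat.card F) {V' : Scroll F W}
    (h : V.generators = V'.generators) : V.conic = V'.conic := by
  ext P
  rw [V.mem_conic_iff, V'.mem_conic_iff, points_eq_of_generators_eq h,
    plane_eq_of_generators_eq hF h]

/-- Both scrolls have as many generators as there are parameters. -/
lemma Scroll.generators_eq_of_subset [Finite F] {V' : Scroll F W}
    (h : V'.generators ⊆ V.generators) : V'.generators = V.generators := by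
  have hfin : Finite (ℙ F (Fin 2 → F)) :=
    (Projectivization.finite_iff_of_finite F (Fin 2 → F)).mpr inferInstance
  have hr : ∀ U : Scroll F W,
      U.generators = Set.range fun p : ℙ F (Fin 2 → F) => U.generator p.rep := by
    intro U; ext g; rw [U.mem_generators_iff]
    exact ⟨fun ⟨p, hp⟩ => ⟨p, hp.symm⟩, fun ⟨p, hp⟩ => ⟨p, hp.symm⟩⟩
  have hc : ∀ U : Scroll F W, U.generators.ncard = Nat.card (ℙ F (Fin 2 → F)) := by
    intro U
    rw [hr, ← Set.image_univ, Set.ncard_image_of_injective _ U.generator_rep_injective,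
      Set.ncard_univ]
  refine Set.eq_of_subset_of_ncard_le h (by rw [hc, hc]) ?_
  rw [hr]
  exact Set.finite_range _

end ScrollGeometry

/-! ### Coprimality of two binary forms. -/

section CoprimeForms

open Polynomial

variable {F : Type*} [Field F]

/-- The binary forms of degrees `d` and `d + 1` with dehomogenizations `f` and `g` have no common
factor. -/
def FormCoprime (d : ℕ) (f g : F[X]) : Prop :=
  IsCoprime f g ∧ (f.coeff d ≠ 0 ∨ g.coeff (d + 1) ≠ 0)

lemma FormCoprime.eval_ne_zero {d : ℕ} {f g : F[X]} (h : FormCoprime d f g)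
    (hf : f.natDegree ≤ d) (hg : g.natDegree ≤ d + 1) {u : Fin 2 → F} (hu : u ≠ 0)
    (hfu : formEval d f u = 0) : formEval (d + 1) g u ≠ 0 := by
  intro hgu
  by_cases h0 : u 0 = 0
  · have h1 : u 1 ≠ 0 := fun h1 => hu (by ext i; fin_cases i <;> simp [h0, h1])
    rw [formEval_of_eq _ _ h0] at hfu hgu
    rcases h.2 with h2 | h2
    · exact h2 ((mul_eq_zero.mp hfu).resolve_right (pow_ne_zero _ h1))
    · exact h2 ((mul_eq_zero.mp hgu).resolve_right (pow_ne_zero _ h1))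
  · rw [formEval_of_ne hf h0] at hfu
    rw [formEval_of_ne hg h0] at hgu
    obtain ⟨a, b, hab⟩ := h.1
    have := congrArg (eval (u 1 / u 0)) hab
    rw [eval_add, eval_mul, eval_mul,
      (mul_eq_zero.mp hfu).resolve_left (pow_ne_zero _ h0),
      (mul_eq_zero.mp hgu).resolve_left (pow_ne_zero _ h0)] at this
    simp at this

/-- Since `d ≤ 2`, a common irreducible factor is linear or quadratic. A linear one gives a common
zero; a quadratic one is `f` up to a constant, so `f` would divide `g`. The zero `![0, 1]` at
infinity is invisible to `IsCoprime` and accounts for the second half of `FormCoprime`. -/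
lemma formCoprime_of_no_common_zero {d : ℕ} (hd : d ≤ 2) {f g : F[X]} (hf0 : f ≠ 0)
    (hf : f.natDegree ≤ d) (hg : g.natDegree ≤ d + 1)
    (hz : ∀ u : Fin 2 → F, u ≠ 0 → formEval d f u = 0 → formEval (d + 1) g u ≠ 0)
    (hdvd : ∀ l : F[X], l.natDegree ≤ 1 → g ≠ f * l) : FormCoprime d f g := by
  constructor
  · refine isCoprime_of_irreducible_dvd (fun h => hf0 h.1) fun p hp hpf hpg => ?_
    have hle : p.natDegree ≤ 2 := (natDegree_le_of_dvd hpf hf0).trans (hf.trans hd)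
    have hpos := hp.natDegree_pos
    rcases (show p.natDegree = 1 ∨ p.natDegree = 2 by omega) with h1 | h2
    · obtain ⟨x, hx⟩ := exists_root_of_degree_eq_one (degree_eq_iff_natDegree_eq_of_pos
        (by norm_num) |>.mpr h1)
      have hx1 : (![1, x] : Fin 2 → F) 0 ≠ 0 := by simp
      refine hz ![1, x] (fun h => by simpa using congrFun h 0) ?_ ?_
      · rw [formEval_of_ne hf hx1]
        have : f.eval x = 0 := eval_eq_zero_of_dvd_of_eval_eq_zero hpf hx
        simp [this]
      · rw [formEval_of_ne hg hx1]
        have : g.eval x = 0 := eval_eq_zero_of_dvd_of_eval_eq_zero hpg hx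
        simp [this]
    · have hfd : f.natDegree = 2 :=
        le_antisymm (hf.trans hd) (h2 ▸ natDegree_le_of_dvd hpf hf0)
      obtain ⟨c, hc⟩ := hpf
      have hc0 : c ≠ 0 := by rintro rfl; exact hf0 (by rw [hc, mul_zero])
      have hcd : c.natDegree = 0 := by
        have := congrArg natDegree hc
        rw [natDegree_mul hp.ne_zero hc0] at this
        omega
      obtain ⟨k, rfl⟩ := natDegree_eq_zero.mp hcd
      have hk : k ≠ 0 := by rintro rfl; simp at hc0
      obtain ⟨l, hl⟩ := hpg
      have hgl : g = f * (C k⁻¹ * l) := by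
        rw [hc, hl, mul_assoc, ← mul_assoc (C k), ← C_mul, mul_inv_cancel₀ hk, C_1, one_mul]
      refine hdvd _ ?_ hgl
      by_cases hl0 : l = 0
      · simp [hl0]
      · have := hg
        rw [hl, natDegree_mul hp.ne_zero hl0] at this
        refine (natDegree_C_mul_le _ _).trans ?_
        omega
  · by_contra! h
    refine hz ![0, 1] (fun h => by simpa using congrFun h 1) ?_ ?_
    · rw [formEval_of_eq _ _ (by simp), h.1, zero_mul]
    · rw [formEval_of_eq _ _ (by simp), h.2, zero_mul]

end CoprimeForms

/-! ### Hyperplane sections of a scroll. -/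

section Sections

open Polynomial

variable {F W : Type*} [Field F] [AddCommGroup W] [Module F W] (V : Scroll F W)

lemma Scroll.span_sup_eq_top (hW : Module.finrank F W = 7) :
    V.plane ⊔ Submodule.span F (Set.range V.b) = ⊤ := by
  have hfd : FiniteDimensional F W := FiniteDimensional.of_finrank_pos (by omega)
  refine Submodule.eq_top_of_disjoint _ _ ?_ V.disjoint_span
  rw [V.finrank_plane, finrank_span_eq_card V.indep_b, hW, Fintype.card_fin]

lemma Scroll.dual_eq_zero (hW : Module.finrank F W = 7) {φ : Module.Dual F W}
    (ha : ∀ j, φ (V.a j) = 0) (hb : ∀ j, φ (V.b j) = 0) : φ = 0 := by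
  rw [← LinearMap.ker_eq_top, eq_top_iff, ← V.span_sup_eq_top hW, sup_le_iff, Scroll.plane,
    Submodule.span_le, Submodule.span_le]
  constructor
  · rintro _ ⟨j, rfl⟩; exact ha j
  · rintro _ ⟨j, rfl⟩; exact hb j

/-- The pairs of forms cut out on the two directrices by linear forms. -/
noncomputable def Scroll.restrict : Module.Dual F W →ₗ[F] F[X] × F[X] where
  toFun φ := (ofCoeffs (φ ∘ V.a), ofCoeffs (φ ∘ V.b))
  map_add' φ ψ := by
    simp [ofCoeffs, Finset.sum_add_distrib]
  map_smul' c φ := by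
    simp [ofCoeffs, Finset.smul_sum, smul_monomial]

lemma Scroll.restrict_injective (hW : Module.finrank F W = 7) :
    Function.Injective V.restrict := by
  rw [injective_iff_map_eq_zero]
  intro φ hφ
  have h1 : ofCoeffs (φ ∘ V.a) = 0 := congrArg Prod.fst hφ
  have h2 : ofCoeffs (φ ∘ V.b) = 0 := congrArg Prod.snd hφ
  refine V.dual_eq_zero hW (fun j => ?_) fun j => ?_
  · have := coeff_ofCoeffs (φ ∘ V.a) j
    rw [h1] at this
    simpa using this.symm
  · have := coeff_ofCoeffs (φ ∘ V.b) j
    rw [h2] at this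
    simpa using this.symm

/-- The coordinates of the curve `f(u) b(u) - g(u) a(u)`. -/
noncomputable def Scroll.sectionCoord (f g : F[X]) (n : ℕ) (j : Fin (n + 1)) : W :=
  ∑ k, (f * X ^ (k : ℕ)).coeff j • V.b k - ∑ k, (g * X ^ (k : ℕ)).coeff j • V.a k

lemma mul_ofCoeffs_coeff {n : ℕ} (f : F[X]) (c : Fin (n + 1) → F) (j : ℕ) :
    (f * ofCoeffs c).coeff j = ∑ k : Fin (n + 1), (f * X ^ (k : ℕ)).coeff j * c k := by
  simp only [ofCoeffs, Finset.mul_sum, finsetSum_coeff]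
  refine Finset.sum_congr rfl fun k _ => ?_
  rw [← C_mul_X_pow_eq_monomial, mul_comm (C (c k)), ← mul_assoc, coeff_mul_C]

lemma Scroll.apply_sectionCoord (f g : F[X]) {n : ℕ} (j : Fin (n + 1)) (φ : Module.Dual F W) :
    φ (V.sectionCoord f g n j) = (f * ofCoeffs (φ ∘ V.b) - g * ofCoeffs (φ ∘ V.a)).coeff j := by
  simp [Scroll.sectionCoord, mul_ofCoeffs_coeff]

lemma ofCoeffs_eq {n : ℕ} {c : Fin (n + 1) → F} {p : F[X]} (hp : p.natDegree ≤ n)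
    (h : ∀ j, c j = p.coeff j) : ofCoeffs c = p := by
  ext j
  by_cases hj : j < n + 1
  · rw [← h ⟨j, hj⟩]
    exact coeff_ofCoeffs c ⟨j, hj⟩
  · rw [coeff_eq_zero_of_natDegree_lt (lt_of_le_of_lt (natDegree_ofCoeffs_le c) (by omega)),
      coeff_eq_zero_of_natDegree_lt (lt_of_le_of_lt hp (by omega))]

variable {d : ℕ} {f g : F[X]}

lemma Scroll.natDegree_section_le (hf : f.natDegree ≤ d)
    (hg : g.natDegree ≤ d + 1) (φ : Module.Dual F W) :
    (f * ofCoeffs (φ ∘ V.b) - g * ofCoeffs (φ ∘ V.a)).natDegree ≤ 3 + d := by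
  refine (natDegree_sub_le _ _).trans (max_le ?_ ?_)
  · exact (natDegree_mul_le_of_le hf (natDegree_ofCoeffs_le _)).trans (by omega)
  · exact (natDegree_mul_le_of_le hg (natDegree_ofCoeffs_le _)).trans (by omega)

/-- Tested against all linear forms, where it reduces to the multiplicativity of `formEval`. -/
lemma Scroll.nrcVec_sectionCoord (hf : f.natDegree ≤ d) (hg : g.natDegree ≤ d + 1)
    (u : Fin 2 → F) :
    nrcVec (V.sectionCoord f g (3 + d)) u =
      formEval d f u • nrcVec V.b u - formEval (d + 1) g u • nrcVec V.a u := by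
  rw [← sub_eq_zero, ← Module.forall_dual_apply_eq_zero_iff F]
  intro φ
  rw [map_sub, map_sub, map_smul, map_smul, apply_nrcVec, apply_nrcVec, apply_nrcVec,
    ofCoeffs_eq (c := φ ∘ V.sectionCoord f g (3 + d)) (V.natDegree_section_le hf hg φ)
      (fun j => V.apply_sectionCoord f g j φ),
    formEval_sub, smul_eq_mul, smul_eq_mul, ← formEval_mul hf (natDegree_ofCoeffs_le _),
    ← formEval_mul hg (natDegree_ofCoeffs_le _), show d + 3 = 3 + d by omega, sub_self]

/-- By duality: a linear form killing all the coordinate vectors restricts to a pair of polynomials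
`(a', b')` with `f b' = g a'`, hence `a' = f k` and `b' = g k` by coprimality, with `deg k ≤ 2 - d`.
The annihilator therefore has rank at most `3 - d`, and the `4 + d` vectors span a space of rank at
least `7 - (3 - d) = 4 + d`. -/
lemma Scroll.linearIndependent_sectionCoord (hW : Module.finrank F W = 7) (hd : d ≤ 2)
    (hf0 : f ≠ 0) (hf : f.natDegree ≤ d) (hg : g.natDegree ≤ d + 1) (hfg : FormCoprime d f g) :
    LinearIndependent F (V.sectionCoord f g (3 + d)) := by
  have hfd : FiniteDimensional F W := FiniteDimensional.of_finrank_pos (by omega)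
  set U := Submodule.span F (Set.range (V.sectionCoord f g (3 + d))) with hU
  let T : F[X] →ₗ[F] F[X] × F[X] := (LinearMap.mulLeft F f).prod (LinearMap.mulLeft F g)
  have hle : U.dualAnnihilator.map V.restrict ≤ (degreeLT F (3 - d)).map T := by
    rintro _ ⟨φ, hφ, rfl⟩
    have hφ' : ∀ w ∈ U, φ w = 0 := (Submodule.mem_dualAnnihilator φ).mp hφ
    have h0 : f * ofCoeffs (φ ∘ V.b) - g * ofCoeffs (φ ∘ V.a) = 0 := by
      rw [← ofCoeffs_eq (c := φ ∘ V.sectionCoord f g (3 + d)) (V.natDegree_section_le hf hg φ)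
        (fun j => V.apply_sectionCoord f g j φ)]
      have : ∀ j, φ (V.sectionCoord f g (3 + d) j) = 0 :=
        fun j => hφ' _ (Submodule.subset_span ⟨j, rfl⟩)
      simp [ofCoeffs, this]
    rw [sub_eq_zero] at h0
    obtain ⟨k, hk⟩ : f ∣ ofCoeffs (φ ∘ V.a) := hfg.1.dvd_of_dvd_mul_left ⟨_, h0.symm⟩
    have hk' : ofCoeffs (φ ∘ V.b) = g * k := by
      apply mul_left_cancel₀ hf0
      rw [h0, hk]; ring
    refine ⟨k, ?_, Prod.ext hk.symm hk'.symm⟩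
    rw [SetLike.mem_coe, mem_degreeLT]
    by_cases hk0 : k = 0
    · rw [hk0, degree_zero]; exact WithBot.bot_lt_coe _
    · rw [← natDegree_lt_iff_degree_lt hk0]
      -- The bound on `deg k` comes from whichever of `f` and `g` attains its formal degree, that
      -- is, does not vanish at infinity.
      rcases hfg.2 with h1 | h1
      · have hfd' : f.natDegree = d := le_antisymm hf (le_natDegree_of_ne_zero h1)
        have := natDegree_ofCoeffs_le (φ ∘ V.a)
        rw [hk, natDegree_mul hf0 hk0] at this
        omega
      · have hgd' : g.natDegree = d + 1 := le_antisymm hg (le_natDegree_of_ne_zero h1)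
        have hg0 : g ≠ 0 := by rintro rfl; simp at h1
        have := natDegree_ofCoeffs_le (φ ∘ V.b)
        rw [hk', natDegree_mul hg0 hk0] at this
        omega
  have hfin : FiniteDimensional F (degreeLT F (3 - d)) :=
    (degreeLTEquiv F (3 - d)).symm.finiteDimensional
  have h1 : Module.finrank F U.dualAnnihilator ≤ 3 - d := by
    rw [(Submodule.equivMapOfInjective V.restrict (V.restrict_injective hW) _).finrank_eq]
    refine (Submodule.finrank_mono hle).trans ((Submodule.finrank_map_le _ _).trans ?_)
    rw [(degreeLTEquiv F (3 - d)).finrank_eq]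
    simp
  have h2 := Subspace.finrank_add_finrank_dualAnnihilator_eq U
  rw [linearIndependent_iff_card_le_finrank_span, Fintype.card_fin]
  show _ ≤ Module.finrank F U
  omega

/-- On the generator with parameter `u`, the point `s a(u) + t b(u)` lies in the hyperplane when
`h(u) (s f(u) + t g(u)) = 0`. If `h(u) = 0` this is the whole generator; otherwise it is the single
point `f(u) b(u) - g(u) a(u)`. -/
lemma Scroll.meetsIn_ker (hW : Module.finrank F W = 7) [Finite F]
    (hV : V.φ = LinearEquiv.refl F _) {m : ℕ} (hdm : m + d = 2) {h : F[X]}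
    (hh : h.natDegree ≤ m) (hf0 : f ≠ 0) (hf : f.natDegree ≤ d) (hg : g.natDegree ≤ d + 1)
    (hfg : FormCoprime d f g) {φ : Module.Dual F W} (ha : ofCoeffs (φ ∘ V.a) = h * f)
    (hb : ofCoeffs (φ ∘ V.b) = h * g) :
    V.MeetsIn (LinearMap.ker φ) (3 + d)
      {p : ℙ F (Fin 2 → F) | formEval m h p.rep = 0}.ncard := by
  classical
  have hfin : Finite (ℙ F (Fin 2 → F)) :=
    (Projectivization.finite_iff_of_finite F (Fin 2 → F)).mpr inferInstance
  set Z : Set (ℙ F (Fin 2 → F)) := {p | formEval m h p.rep = 0} with hZ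
  have hZfin : ((fun p : ℙ F (Fin 2 → F) => V.generator p.rep) '' Z).Finite := Set.toFinite _
  have hφa : ∀ u, φ (nrcVec V.a u) = formEval m h u * formEval d f u := fun u => by
    rw [apply_nrcVec, ha, ← formEval_mul hh hf, hdm]
  have hφb : ∀ u, φ (nrcVec V.b u) = formEval m h u * formEval (d + 1) g u := fun u => by
    rw [apply_nrcVec, hb, ← formEval_mul hh hg, ← add_assoc, hdm]
  refine ⟨nrcCurve (V.sectionCoord f g (3 + d)), hZfin.toFinset,
    ⟨_, V.linearIndependent_sectionCoord hW (by omega) hf0 hf hg hfg, rfl⟩, ?_, ?_, ?_⟩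
  · intro x hx
    rw [Set.Finite.coe_toFinset] at hx
    obtain ⟨p, -, rfl⟩ := hx
    exact ⟨p.rep, p.rep_nonzero, rfl⟩
  · rw [← Set.ncard_eq_toFinset_card _ hZfin, Set.ncard_image_of_injective _
      V.generator_rep_injective]
  · ext P
    simp only [Set.mem_inter_iff, Set.mem_union, Set.mem_iUnion, Set.Finite.mem_toFinset,
      mem_nrcCurve_iff, V.mem_points_iff, V.nrcVec_sectionCoord hf hg, exists_prop]
    have hgen : ∀ u, V.generator u = Submodule.span F {nrcVec V.a u, nrcVec V.b u} := by
      intro u; rw [Scroll.generator, hV]; rfl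
    constructor
    · rintro ⟨hP, p, hp⟩
      rw [mem_pts_iff_rep, LinearMap.mem_ker] at hP
      obtain ⟨s, t, hst⟩ := Submodule.mem_span_pair.mp (hgen _ ▸ hp)
      rw [← hst, map_add, map_smul, map_smul, hφa, hφb, smul_eq_mul, smul_eq_mul] at hP
      by_cases hz : formEval m h p.rep = 0
      · exact Or.inr ⟨_, ⟨p, hz, rfl⟩, mem_pts_iff_rep.mpr hp⟩
      · left
        have h0 : s * formEval d f p.rep + t * formEval (d + 1) g p.rep = 0 := by
          apply mul_left_cancel₀ hz
          linear_combination hP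
        refine ⟨p, ?_⟩
        -- As `f` and `g` have no common zero, the solution `(s, t)` is unique up to the scalar `κ`.
        obtain ⟨κ, hs, ht⟩ : ∃ κ, s = -κ * formEval (d + 1) g p.rep ∧
            t = κ * formEval d f p.rep := by
          by_cases hf1 : formEval d f p.rep = 0
          · have hg1 := hfg.eval_ne_zero hf hg p.rep_nonzero hf1
            refine ⟨-s / formEval (d + 1) g p.rep, by field_simp, ?_⟩
            rw [hf1, mul_zero] at h0 ⊢
            exact (mul_eq_zero.mp (by simpa using h0)).resolve_right hg1
          · refine ⟨t / formEval d f p.rep, ?_, by field_simp⟩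
            field_simp
            linear_combination h0
        have hrep : P.rep = κ • (formEval d f p.rep • nrcVec V.b p.rep -
            formEval (d + 1) g p.rep • nrcVec V.a p.rep) := by
          rw [← hst, hs, ht]; module
        have hκ : κ ≠ 0 := by
          rintro rfl
          exact P.rep_nonzero (by rw [hrep, zero_smul])
        rw [P.submodule_eq, hrep, span_smul_singleton hκ]
    · rintro (⟨p, hp⟩ | ⟨g', ⟨p, hz, rfl⟩, hp⟩)
      · have hle : P.submodule ≤ V.generator p.rep := by
          rw [hp, Submodule.span_singleton_le_iff_mem, hgen]
          exact Submodule.sub_mem _ (Submodule.smul_mem _ _ (Submodule.subset_span (by simp)))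
            (Submodule.smul_mem _ _ (Submodule.subset_span (by simp)))
        refine ⟨?_, p, mem_pts_iff_rep.mp hle⟩
        show P.submodule ≤ _
        rw [hp, Submodule.span_singleton_le_iff_mem, LinearMap.mem_ker, map_sub, map_smul,
          map_smul, hφa, hφb, smul_eq_mul, smul_eq_mul]
        ring
      · refine ⟨?_, p, mem_pts_iff_rep.mp hp⟩
        have hz' : formEval m h p.rep = 0 := hz
        have hk : V.generator p.rep ≤ LinearMap.ker φ := by
          rw [hgen, Submodule.span_le, Set.pair_subset_iff]
          simp [hφa, hφb, hz']
        exact le_trans hp hk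

lemma injective_triple {α : Type*} {x y z : α} (h1 : x ≠ y) (h2 : x ≠ z) (h3 : y ≠ z) :
    Function.Injective ![x, y, z] := by
  intro i j
  fin_cases i <;> fin_cases j <;> simp [h1, h2, h3, h1.symm, h2.symm, h3.symm]

/-- A rational normal curve of degree at least two contains no line. -/
lemma not_nrcCurve_of_line {r : ℕ} (hr : 2 ≤ r) {e : Fin (r + 1) → W}
    (he : LinearIndependent F e) {x₁ x₂ : W} (hli : LinearIndependent F ![x₁, x₂])
    (h : ∀ (y : W) (hy : y ≠ 0), y ∈ Submodule.span F {x₁, x₂} →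
      Projectivization.mk F y hy ∈ nrcCurve (F := F) e) : False := by
  have hmem : ∀ y : W, y ≠ 0 → y ∈ Submodule.span F {x₁, x₂} →
      ∃ (p : ℙ F (Fin 2 → F)) (c : F), c ≠ 0 ∧ y = c • nrcVec e p.rep := by
    intro y hy hyu
    obtain ⟨p, hp⟩ := (mem_nrcCurve_iff _ _).mp (h y hy hyu)
    rw [Projectivization.submodule_mk] at hp
    obtain ⟨c, hc⟩ := Submodule.mem_span_singleton.mp
      (hp ▸ Submodule.mem_span_singleton_self y)
    refine ⟨p, c, ?_, hc.symm⟩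
    rintro rfl
    exact hy (by rw [← hc, zero_smul])
  rw [LinearIndependent.pair_iff] at hli
  have hm1 : x₁ ∈ Submodule.span F {x₁, x₂} := Submodule.subset_span (Set.mem_insert _ _)
  have hm2 : x₂ ∈ Submodule.span F {x₁, x₂} :=
    Submodule.subset_span (Set.mem_insert_of_mem _ rfl)
  have hx1 : x₁ ≠ 0 := fun h => one_ne_zero (hli 1 0 (by rw [h]; module)).1
  have hx2 : x₂ ≠ 0 := fun h => one_ne_zero (hli 0 1 (by rw [h]; module)).2
  have hx3 : x₁ + x₂ ≠ 0 := fun h => one_ne_zero (hli 1 1 (by rw [← h]; module)).1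
  obtain ⟨p₁, c₁, hc1, h1⟩ := hmem x₁ hx1 hm1
  obtain ⟨p₂, c₂, hc2, h2⟩ := hmem x₂ hx2 hm2
  obtain ⟨p₃, c₃, hc3, h3⟩ := hmem _ hx3 (Submodule.add_mem _ hm1 hm2)
  have h12 : p₁ ≠ p₂ := by
    rintro rfl
    refine hc2 (hli c₂ (-c₁) ?_).1
    rw [h1, h2]; module
  have h13 : p₁ ≠ p₃ := by
    rintro rfl
    refine hc1 (neg_eq_zero.mp (hli (c₃ - c₁) (-c₁) ?_).2)
    have : c₁ • (x₁ + x₂) = c₃ • x₁ := by rw [h3, h1]; module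
    rw [sub_smul, ← this]; module
  have h23 : p₂ ≠ p₃ := by
    rintro rfl
    refine hc2 (neg_eq_zero.mp (hli (-c₂) (c₃ - c₂) ?_).1)
    have : c₂ • (x₁ + x₂) = c₃ • x₂ := by rw [h3, h2]; module
    rw [sub_smul, ← this]; module
  -- Three points of a curve of degree at least two are independent, but `x₁`, `x₂` and `x₁ + x₂`
  -- are not.
  have hli3 := linearIndependent_nrcVec_rep he (by simpa using hr) (injective_triple h12 h13 h23)
  have := Fintype.linearIndependent_iff.mp hli3 ![c₁, c₂, -c₃] (by
    rw [Fin.sum_univ_three]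
    show c₁ • nrcVec e p₁.rep + c₂ • nrcVec e p₂.rep + (-c₃) • nrcVec e p₃.rep = 0
    rw [neg_smul, ← h3, ← h1, ← h2]; abel) 0
  exact hc1 this

variable [Finite F] {φ : Module.Dual F W}

/-- The common factor is the whole quadratic form, with cofactors `1` and `l`. -/
lemma Scroll.meetsIn_three (hW : Module.finrank F W = 7) (hV : V.φ = LinearEquiv.refl F _)
    {l : F[X]} (hl : l.natDegree ≤ 1) (hdvd : ofCoeffs (φ ∘ V.b) = ofCoeffs (φ ∘ V.a) * l) :
    V.MeetsIn (LinearMap.ker φ) 3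
      {p : ℙ F (Fin 2 → F) | formEval 2 (ofCoeffs (φ ∘ V.a)) p.rep = 0}.ncard :=
  V.meetsIn_ker hW hV (d := 0) (m := 2) (f := 1) (g := l) rfl (natDegree_ofCoeffs_le _)
    one_ne_zero (by simp) (by simpa using hl) ⟨isCoprime_one_left, Or.inl (by simp)⟩
    (by rw [mul_one]) hdvd

lemma Scroll.meetsIn_five (hW : Module.finrank F W = 7) (hV : V.φ = LinearEquiv.refl F _)
    (hφ : ofCoeffs (φ ∘ V.a) ≠ 0)
    (hz : ∀ u : Fin 2 → F, u ≠ 0 → φ (nrcVec V.a u) = 0 → φ (nrcVec V.b u) ≠ 0)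
    (hdvd : ∀ l : F[X], l.natDegree ≤ 1 → ofCoeffs (φ ∘ V.b) ≠ ofCoeffs (φ ∘ V.a) * l) :
    V.MeetsIn (LinearMap.ker φ) 5 0 := by
  have := V.meetsIn_ker hW hV (d := 2) (m := 0) (h := 1) rfl (by simp) hφ
    (natDegree_ofCoeffs_le _) (natDegree_ofCoeffs_le (φ ∘ V.b))
    (formCoprime_of_no_common_zero le_rfl hφ (natDegree_ofCoeffs_le _) (natDegree_ofCoeffs_le _)
      (fun u hu => by simpa only [← apply_nrcVec] using hz u hu) hdvd)
    (one_mul _).symm (one_mul _).symm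
  simpa [formEval_one_zero] using this

/-- The common factor is the linear form vanishing at `u`. If the cofactors, of degrees one and two,
had another common zero, the linear cofactor would divide the quadratic one, contrary to `hdvd`. -/
lemma Scroll.meetsIn_four (hW : Module.finrank F W = 7) (hV : V.φ = LinearEquiv.refl F _)
    (hφ : ofCoeffs (φ ∘ V.a) ≠ 0) {u : Fin 2 → F} (hu : u ≠ 0) (hua : φ (nrcVec V.a u) = 0)
    (hub : φ (nrcVec V.b u) = 0)
    (hdvd : ∀ l : F[X], l.natDegree ≤ 1 → ofCoeffs (φ ∘ V.b) ≠ ofCoeffs (φ ∘ V.a) * l) :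
    V.MeetsIn (LinearMap.ker φ) 4 1 := by
  rw [apply_nrcVec] at hua hub
  obtain ⟨f, hf, hfa⟩ := exists_eq_linForm_mul (n := 1) (natDegree_ofCoeffs_le _) hu hua
  obtain ⟨g, hg, hgb⟩ := exists_eq_linForm_mul (n := 2) (natDegree_ofCoeffs_le _) hu hub
  have hf0 : f ≠ 0 := by rintro rfl; exact hφ (by rw [hfa, mul_zero])
  have hcop : FormCoprime 1 f g := by
    refine formCoprime_of_no_common_zero (by norm_num) hf0 hf hg (fun v hv hvf hvg => ?_)
      fun l hl h => ?_
    · obtain ⟨k, hk, hfk⟩ := exists_eq_linForm_mul (n := 0) hf hv hvf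
      obtain ⟨l, hl, hgl⟩ := exists_eq_linForm_mul (n := 1) hg hv hvg
      obtain ⟨c, rfl⟩ := natDegree_eq_zero.mp (Nat.le_zero.mp hk)
      have hc : c ≠ 0 := by rintro rfl; exact hf0 (by rw [hfk, C_0, mul_zero])
      refine hdvd (C c⁻¹ * l) ((natDegree_C_mul_le _ _).trans hl) ?_
      rw [hgb, hfa, hfk, hgl, mul_assoc, mul_assoc, ← mul_assoc (C c), ← C_mul,
        mul_inv_cancel₀ hc, C_1, one_mul]
    · exact hdvd l hl (by rw [hgb, hfa, h, mul_assoc])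
  have := V.meetsIn_ker hW hV (d := 1) (m := 1) rfl (natDegree_linForm_le u) hf0 hf hg hcop hfa hgb
  have hZ : {p : ℙ F (Fin 2 → F) | formEval 1 (linForm u) p.rep = 0} =
      {Projectivization.mk F u hu} := by
    ext p
    rw [Set.mem_ofPred_eq, formEval_linForm, Set.mem_singleton_iff]
    constructor
    · intro h
      obtain ⟨c, hc⟩ := exists_eq_smul_of_det₂_eq_zero hu h
      rw [← p.mk_rep, Projectivization.mk_eq_mk_iff']
      exact ⟨c, hc.symm⟩
    · rintro rfl
      obtain ⟨c, -, hc⟩ := exists_rep_smul hu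
      rw [hc, det₂_smul]
  rwa [hZ, Set.ncard_singleton] at this

variable {V}

/-- Makes the kinds of section mutually exclusive, so that the counts are exact. A 5-dim nrc spans
rank six because `q ≥ 5`, so it is not a curve of lower degree; and it contains no line, so no
generator can occur in the other description. -/
lemma Scroll.MeetsIn.not_of_five (hF : 5 ≤ Nat.card F) {X : Submodule F W} (h : V.MeetsIn X 5 0)
    {r k : ℕ} (hr : r < 5) : ¬ V.MeetsIn X r k := by
  rintro ⟨N', G', ⟨e', he', rfl⟩, hG', -, hX'⟩
  obtain ⟨N, G, ⟨e, he, rfl⟩, -, hG0, hX⟩ := h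
  rw [Finset.card_eq_zero] at hG0
  subst hG0
  simp only [Finset.notMem_empty, Set.iUnion_of_empty, Set.iUnion_empty, Set.union_empty] at hX
  rw [hX] at hX'
  rcases G'.eq_empty_or_nonempty with rfl | ⟨x, hx⟩
  · simp only [Finset.notMem_empty, Set.iUnion_of_empty, Set.iUnion_empty, Set.union_empty] at hX'
    have hle : Submodule.span F (Set.range e) ≤ Submodule.span F (Set.range e') := by
      refine span_range_le_of_nrcCurve hF he fun p => ?_
      have hm : Projectivization.mk F _ (nrcVec_ne_zero he p.rep_nonzero) ∈ nrcCurve (F := F) e :=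
        (mem_nrcCurve_iff _ _).mpr ⟨p, Projectivization.submodule_mk _ _⟩
      rw [hX', mem_nrcCurve_iff] at hm
      obtain ⟨p', hp'⟩ := hm
      rw [Projectivization.submodule_mk] at hp'
      have h1 : nrcVec e p.rep ∈ Submodule.span F {nrcVec e' p'.rep} :=
        hp' ▸ Submodule.mem_span_singleton_self _
      exact (Submodule.span_singleton_le_iff_mem _ _).mpr (nrcVec_mem_span _ _) h1
    have hfd : FiniteDimensional F (Submodule.span F (Set.range e')) :=
      FiniteDimensional.span_of_finite F (Set.finite_range e')
    have := Submodule.finrank_mono hle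
    rw [finrank_span_eq_card he, finrank_span_eq_card he', Fintype.card_fin,
      Fintype.card_fin] at this
    omega
  · obtain ⟨u, hu, hxu⟩ := hG' hx
    refine not_nrcCurve_of_line (r := 5) (by norm_num) he (V.linearIndependent_generator hu)
      fun y hy hyu => ?_
    rw [hX']
    right
    simp only [Set.mem_iUnion]
    exact ⟨x, hx, (mem_pts_mk hy).mpr (hxu ▸ hyu)⟩

end Sections

/-! ### Maps preserving parallelism are additive and semilinear. -/

section LineMaps

variable {F K M W : Type*} [Field F] [Field K] [AddCommGroup M] [Module K M] [AddCommGroup W]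
  [Module F W]

lemma exists_ker_eq {V : Type*} [AddCommGroup V] [Module F V] (X : Submodule F V)
    [FiniteDimensional F V] (h : Module.finrank F X + 1 = Module.finrank F V) :
    ∃ f : V →ₗ[F] F, LinearMap.ker f = X ∧ ∃ v, f v = 1 := by
  have h1 : Module.finrank F (V ⧸ X) = Module.finrank F F := by
    have := X.finrank_quotient_add_finrank
    rw [Module.finrank_self]; omega
  let e := LinearEquiv.ofFinrankEq _ _ h1
  refine ⟨e.toLinearMap ∘ₗ X.mkQ, ?_, ?_⟩
  · rw [LinearEquiv.ker_comp, Submodule.ker_mkQ]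
  · obtain ⟨v, hv⟩ := X.mkQ_surjective (e.symm 1)
    exact ⟨v, by simp [hv]⟩

/-- A bijection mapping parallel classes of lines to parallel classes is additive. -/
lemma additive_of_parallel (Θ : M → W) (Y : M → Submodule F W)
    (hY : ∀ d, d ≠ 0 → ∀ a m, m - a ∈ Submodule.span K {d} → Θ m - Θ a ∈ Y d)
    (hdisj : ∀ d d', d ≠ 0 → d' ∉ Submodule.span K {d} → Disjoint (Y d) (Y d'))
    (hM : ∀ a : M, ∃ c, c ∉ Submodule.span K {a}) (a b : M) :
    Θ (a + b) - Θ 0 = (Θ a - Θ 0) + (Θ b - Θ 0) := by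
  have hind : ∀ a b, b ∉ Submodule.span K {a} →
      Θ (a + b) - Θ 0 = (Θ a - Θ 0) + (Θ b - Θ 0) := by
    intro a b hb
    have hb0 : b ≠ 0 := by rintro rfl; exact hb (Submodule.zero_mem _)
    by_cases ha0 : a = 0
    · simp [ha0]
    have h1 : Θ (a + b) - Θ a ∈ Y b := hY b hb0 _ _ (by simp [Submodule.mem_span_singleton_self])
    have h2 : Θ b - Θ 0 ∈ Y b := hY b hb0 _ _ (by simp [Submodule.mem_span_singleton_self])
    have h3 : Θ (a + b) - Θ b ∈ Y a := hY a ha0 _ _ (by simp [Submodule.mem_span_singleton_self])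
    have h4 : Θ a - Θ 0 ∈ Y a := hY a ha0 _ _ (by simp [Submodule.mem_span_singleton_self])
    -- Parallelogram argument: the deviation from additivity lies in `Y a` by `h3` and `h4`, and in
    -- `Y b` by `h1` and `h2`.
    have h5 := Submodule.disjoint_def.mp (hdisj a b ha0 hb) _ (Submodule.sub_mem _ h3 h4) (by
      have := Submodule.sub_mem _ h1 h2
      convert this using 1
      abel)
    rw [← sub_eq_zero, ← h5]
    abel
  by_cases hb : b ∈ Submodule.span K {a}
  -- For `b` on the line of `a` there is no parallelogram; a vector `c` off that line serves as a
  -- detour.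
  · obtain ⟨c, hc⟩ := hM a
    have h1 := hind (a + b) c (fun h => hc ((Submodule.span_singleton_le_iff_mem _ _).mpr
      (Submodule.add_mem _ (Submodule.mem_span_singleton_self a) hb) h))
    have h2 := hind a (b + c) (fun h => hc ((Submodule.add_mem_iff_right _ hb).mp h))
    have h3 := hind b c (fun h => hc ((Submodule.span_singleton_le_iff_mem _ _).mpr hb h))
    rw [h3, ← add_assoc, h1, ← add_assoc] at h2
    exact add_right_cancel h2
  · exact hind a b hb

/-- An additive map fixing all lines through the origin is a homothety. -/
lemma exists_eq_smul_of_map_mem_span (T : M →+ M) (hT : ∀ d, T d ∈ Submodule.span K {d})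
    (hM : ∀ a : M, ∃ c, c ∉ Submodule.span K {a}) : ∃ k : K, ∀ m, T m = k • m := by
  have key : ∀ (x y : M) (k : K), x ≠ 0 → y ∉ Submodule.span K {x} → T x = k • x →
      T y = k • y := by
    intro x y k hx hy hk
    obtain ⟨j, hj⟩ := Submodule.mem_span_singleton.mp (hT y)
    obtain ⟨i, hi⟩ := Submodule.mem_span_singleton.mp (hT (x + y))
    rw [map_add, hk, ← hj] at hi
    have h1 : (j - i) • y = (i - k) • x := by
      rw [sub_smul, sub_smul, sub_eq_sub_iff_add_eq_add, add_comm, ← hi, smul_add, add_comm]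
    have h2 : j = i := by
      by_contra hne
      refine hy (Submodule.mem_span_singleton.mpr ⟨(j - i)⁻¹ * (i - k), ?_⟩)
      rw [mul_smul, ← h1, inv_smul_smul₀ (sub_ne_zero.mpr hne)]
    have h3 : i = k := by
      rw [h2, sub_self, zero_smul] at h1
      exact sub_eq_zero.mp ((smul_eq_zero.mp h1.symm).resolve_right hx)
    rw [← hj, h2, h3]
  obtain ⟨a, ha⟩ := hM 0
  have ha0 : a ≠ 0 := by rintro rfl; exact ha (Submodule.zero_mem _)
  obtain ⟨b, hb⟩ := hM a
  have hb0 : b ≠ 0 := by rintro rfl; exact hb (Submodule.zero_mem _)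
  obtain ⟨k, hk⟩ := Submodule.mem_span_singleton.mp (hT a)
  refine ⟨k, fun m => ?_⟩
  by_cases hm : m ∈ Submodule.span K {a}
  · by_cases hm0 : m = 0
    · simp [hm0]
    refine key b m k hb0 (fun h => ?_) (key a b k ha0 hb hk.symm)
    obtain ⟨s, rfl⟩ := Submodule.mem_span_singleton.mp h
    have hs : s ≠ 0 := by rintro rfl; simp at hm0
    exact hb ((Submodule.smul_mem_iff _ hs).mp hm)
  · exact key a m k ha0 hm hk.symm

/-- An additive bijection onto a subspace, mapping lines onto subspaces, is semilinear. -/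
lemma exists_ringHom_of_lines (Ψ : M →+ W) (hΨ : Function.Injective Ψ)
    (hrange : ∀ (c : F) (m : M), ∃ m', Ψ m' = c • Ψ m) (Y : M → Submodule F W)
    (hY : ∀ d, d ≠ 0 → ∀ m, Ψ m ∈ Y d ↔ m ∈ Submodule.span K {d})
    (hM : ∀ a : M, ∃ c, c ∉ Submodule.span K {a}) :
    ∃ ψ : F →+* K, ∀ (c : F) m, Ψ (ψ c • m) = c • Ψ m := by
  choose T hT using hrange
  have hk : ∀ c : F, ∃ k : K, ∀ m, Ψ (k • m) = c • Ψ m := by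
    intro c
    -- Multiplication by `c` on `W`, pulled back along `Ψ`, preserves every line through the origin
    -- of `M`, so it is a homothety; its ratio is the value of the embedding at `c`.
    let T' : M →+ M :=
      { toFun := T c
        map_zero' := hΨ (by rw [hT, map_zero, smul_zero])
        map_add' := fun x y => hΨ (by rw [hT, map_add, map_add, smul_add, hT, hT]) }
    obtain ⟨k, hk⟩ := exists_eq_smul_of_map_mem_span (K := K) T' (fun d => by
      by_cases hd : d = 0
      · rw [hd, map_zero]; exact Submodule.zero_mem _
      · refine (hY d hd _).mp ?_
        show Ψ (T c d) ∈ _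
        rw [hT]
        exact Submodule.smul_mem _ _ ((hY d hd d).mpr (Submodule.mem_span_singleton_self d))) hM
    exact ⟨k, fun m => by rw [← hk]; exact hT c m⟩
  choose ψ hψ using hk
  obtain ⟨a, ha⟩ := hM 0
  have ha0 : a ≠ 0 := by rintro rfl; exact ha (Submodule.zero_mem _)
  have huniq : ∀ k k' : K, Ψ (k • a) = Ψ (k' • a) → k = k' := fun k k' h =>
    smul_left_injective K ha0 (hΨ h)
  refine ⟨⟨⟨⟨ψ, huniq _ _ ?_⟩, fun x y => huniq _ _ ?_⟩, huniq _ _ ?_, fun x y => huniq _ _ ?_⟩, hψ⟩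
  · rw [hψ, one_smul, one_smul]
  · show Ψ (ψ (x * y) • a) = Ψ ((ψ x * ψ y) • a)
    rw [hψ, mul_smul, mul_smul, hψ, hψ]
  · rw [hψ, zero_smul, zero_smul, map_zero]
  · show Ψ (ψ (x + y) • a) = Ψ ((ψ x + ψ y) • a)
    rw [hψ, add_smul, add_smul, map_add, hψ, hψ]

end LineMaps

/-! ### Semilinear coordinates for a Bruck-Bose representation. -/

section Coordinates

variable {F W K : Type*} [Field F] [AddCommGroup W] [Module F W] [Field K]
  {H : Submodule F W} {S : Set (Submodule F W)}

/-- `σ` maps the point with coordinates `v` to the affine point with coordinates `x`. -/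
def IsAffineImage (σ : ℙ K (Fin 3 → K) ≃ BBPoint H S) (v : Fin 3 → K) (x : W) : Prop :=
  ∃ (hv : v ≠ 0) (hx : x ≠ 0) (hP : Projectivization.mk F x hx ∉ pts H),
    σ (Projectivization.mk K v hv) = Sum.inl ⟨Projectivization.mk F x hx, hP⟩

/-- `σ` maps the point with coordinates `v` to the point at infinity given by `Y`. -/
def IsInfiniteImage (σ : ℙ K (Fin 3 → K) ≃ BBPoint H S) (v : Fin 3 → K) (Y : Submodule F W) :
    Prop :=
  ∃ (hv : v ≠ 0) (hY : Y ∈ S), σ (Projectivization.mk K v hv) = Sum.inr ⟨Y, hY⟩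

variable {σ : ℙ K (Fin 3 → K) ≃ BBPoint H S}

lemma IsAffineImage.eq_smul_left {v v' : Fin 3 → K} {x : W} (h : IsAffineImage σ v x)
    (h' : IsAffineImage σ v' x) : ∃ c : K, c • v = v' := by
  obtain ⟨hv, hx, hP, hσ⟩ := h
  obtain ⟨hv', hx', hP', hσ'⟩ := h'
  exact (Projectivization.mk_eq_mk_iff' K _ _ hv' hv).mp (σ.injective (hσ'.trans hσ.symm))

lemma IsAffineImage.eq_smul_right {v : Fin 3 → K} {x x' : W} (h : IsAffineImage σ v x)
    (h' : IsAffineImage σ v x') : ∃ c : F, c • x = x' := by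
  obtain ⟨hv, hx, hP, hσ⟩ := h
  obtain ⟨hv', hx', hP', hσ'⟩ := h'
  have := Sum.inl_injective (hσ'.symm.trans hσ)
  exact (Projectivization.mk_eq_mk_iff' F _ _ hx' hx).mp (congrArg Subtype.val this)

lemma IsAffineImage.smul_left {v : Fin 3 → K} {x : W} (h : IsAffineImage σ v x) {c : K}
    (hc : c ≠ 0) : IsAffineImage σ (c • v) x := by
  obtain ⟨hv, hx, hP, hσ⟩ := h
  refine ⟨smul_ne_zero hc hv, hx, hP, ?_⟩
  rw [← hσ]
  congr 1
  exact (Projectivization.mk_eq_mk_iff' K _ _ _ _).mpr ⟨c, rfl⟩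

lemma IsAffineImage.smul_right {v : Fin 3 → K} {x : W} (h : IsAffineImage σ v x) {c : F}
    (hc : c ≠ 0) : IsAffineImage σ v (c • x) := by
  obtain ⟨hv, hx, hP, hσ⟩ := h
  have he : Projectivization.mk F (c • x) (smul_ne_zero hc hx) = Projectivization.mk F x hx :=
    (Projectivization.mk_eq_mk_iff' F _ _ _ _).mpr ⟨c, rfl⟩
  refine ⟨hv, smul_ne_zero hc hx, by rwa [he], ?_⟩
  rw [hσ]
  congr 2
  exact he.symm

lemma IsSpread.disjoint (hS : IsSpread H S) {Y Y' : Submodule F W} (hY : Y ∈ S) (hY' : Y' ∈ S)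
    (h : Y ≠ Y') : Disjoint Y Y' := by
  rw [Submodule.disjoint_def]
  intro x hx hx'
  by_contra hx0
  have hH : Projectivization.mk F x hx0 ∈ pts H := (mem_pts_mk hx0).mpr ((hS.1 Y hY).1 hx)
  exact h ((hS.2 _ hH).unique ⟨hY, (mem_pts_mk hx0).mpr hx⟩ ⟨hY', (mem_pts_mk hx0).mpr hx'⟩)

lemma inf_eq_of_le_of_not_le (hW : Module.finrank F W = 7) (hH : Module.finrank F H = 6)
    {X Y : Submodule F W} (hX : Module.finrank F X = 4) (hXH : ¬ X ≤ H) (hYX : Y ≤ X)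
    (hYH : Y ≤ H) (hY : Module.finrank F Y = 3) : X ⊓ H = Y := by
  have hfd : FiniteDimensional F W := FiniteDimensional.of_finrank_pos (by omega)
  have hlt : H < X ⊔ H := lt_of_le_of_ne le_sup_right fun h => hXH (h ▸ le_sup_left)
  have h1 := Submodule.finrank_lt_finrank_of_lt hlt
  have h2 := (X ⊔ H).finrank_le
  have h3 := Submodule.finrank_sup_add_finrank_inf_eq X H
  exact (Submodule.eq_of_le_of_finrank_eq (le_inf hYX hYH) (by omega)).symm

/-- Representing vectors are normalised by `L = 1` and `h = 1`, so each affine point has exactly one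
vector on either side. -/
lemma exists_affine_bijection (hσ : IsBruckBose σ) {h : W →ₗ[F] F} (hh : LinearMap.ker h = H) :
    ∃ (L : (Fin 3 → K) →ₗ[K] K) (o : Fin 3 → K) (Θ : LinearMap.ker L → W), L o = 1 ∧
      (∀ m : LinearMap.ker L, m ≠ 0 → ∃ Y, IsInfiniteImage σ m Y) ∧
      (∀ m, h (Θ m) = 1) ∧ (∀ x, h x = 1 → ∃ m, Θ m = x) ∧
      ∀ m : LinearMap.ker L, IsAffineImage σ (o + m) (Θ m) := by
  obtain ⟨M₀, hM₀, hM⟩ : IsLine (σ ⁻¹' Set.range Sum.inr) :=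
    (hσ _).mpr (Or.inl (σ.image_preimage _))
  obtain ⟨L, hL, o, ho⟩ := exists_ker_eq M₀ (by rw [hM₀]; simp)
  have hinf : ∀ v (hv : v ≠ 0), L v = 0 ↔ σ (Projectivization.mk K v hv) ∈ Set.range Sum.inr := by
    intro v hv
    rw [← Set.mem_preimage, hM, mem_pts_mk, ← hL, LinearMap.mem_ker]
  have hHx : ∀ x (hx : x ≠ 0), Projectivization.mk F x hx ∈ pts H ↔ h x = 0 := by
    intro x hx
    rw [mem_pts_mk, ← hh, LinearMap.mem_ker]
  have hom : ∀ m : LinearMap.ker L, L (o + m) = 1 := fun m => by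
    rw [map_add, ho, LinearMap.mem_ker.mp m.2, add_zero]
  have hne : ∀ m : LinearMap.ker L, o + m ≠ 0 := fun m h0 => by
    have := hom m
    rw [h0, map_zero] at this
    exact zero_ne_one this
  have hΘ : ∀ m : LinearMap.ker L, ∃ x, h x = 1 ∧ IsAffineImage σ (o + m) x := by
    intro m
    rcases hP : σ (Projectivization.mk K _ (hne m)) with P | Y
    · have hr : h P.1.rep ≠ 0 := by
        have h1 := (hHx _ P.1.rep_nonzero).not.mp (by rw [P.1.mk_rep]; exact P.2)
        exact h1
      have haff : IsAffineImage σ (o + m) P.1.rep :=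
        ⟨hne m, P.1.rep_nonzero, by rw [P.1.mk_rep]; exact P.2, by simp [hP]⟩
      exact ⟨(h P.1.rep)⁻¹ • P.1.rep, by simp [hr], haff.smul_right (inv_ne_zero hr)⟩
    · have := (hinf _ (hne m)).mpr ⟨Y, hP.symm⟩
      rw [hom] at this
      exact absurd this one_ne_zero
  choose Θ hΘ1 hΘ2 using hΘ
  refine ⟨L, o, Θ, ho, fun m hm => ?_, hΘ1, fun x hx => ?_, hΘ2⟩
  · have hm' : (m : Fin 3 → K) ≠ 0 := fun h => hm (Subtype.ext h)
    obtain ⟨Y, hY⟩ := (hinf _ hm').mp m.2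
    exact ⟨Y.1, hm', Y.2, hY.symm⟩
  · have hx0 : x ≠ 0 := by rintro rfl; simp at hx
    have hxP : Projectivization.mk F x hx0 ∉ pts H := by rw [hHx, hx]; exact one_ne_zero
    obtain ⟨v, hv, hvx⟩ : ∃ v, ∃ hv : v ≠ 0, Projectivization.mk K v hv =
        σ.symm (Sum.inl ⟨_, hxP⟩) := ⟨_, Projectivization.rep_nonzero _, Projectivization.mk_rep _⟩
    rw [Equiv.eq_symm_apply] at hvx
    have hLv : L v ≠ 0 := by
      intro h0
      obtain ⟨Y, hY⟩ := (hinf v hv).mp h0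
      rw [hvx] at hY
      simp at hY
    have haff : IsAffineImage σ ((L v)⁻¹ • v) x :=
      IsAffineImage.smul_left ⟨hv, hx0, hxP, hvx⟩ (inv_ne_zero hLv)
    let m : LinearMap.ker L := ⟨(L v)⁻¹ • v - o, by simp [ho, hLv]⟩
    have hm : o + (m : Fin 3 → K) = (L v)⁻¹ • v := by simp [m]
    refine ⟨m, ?_⟩
    rw [← hm] at haff
    obtain ⟨c, hc⟩ := haff.eq_smul_right (hΘ2 m)
    have := hΘ1 m
    rw [← hc, map_smul, hx, smul_eq_mul, mul_one] at this
    rw [← hc, this, one_smul]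

/-- The line through `o + a` in the direction `d` is a 3-space `X` with `X ⊓ H = Y`; a difference of
two vectors with `h = 1` lies in `H`, so for it membership in `X` and in `Y` agree. -/
lemma sub_mem_iff_of_isInfiniteImage (hW : Module.finrank F W = 7) (hH : Module.finrank F H = 6)
    (hS : IsSpread H S) (hσ : IsBruckBose σ) {h : W →ₗ[F] F} (hh : LinearMap.ker h = H)
    {L : (Fin 3 → K) →ₗ[K] K} {o : Fin 3 → K} (ho : L o = 1) {Θ : LinearMap.ker L → W}
    (hΘ : ∀ m, h (Θ m) = 1) (hΘσ : ∀ m : LinearMap.ker L, IsAffineImage σ (o + m) (Θ m))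
    {d : LinearMap.ker L} {Y : Submodule F W} (hd : IsInfiniteImage σ d Y)
    (a m : LinearMap.ker L) : m - a ∈ Submodule.span K {d} ↔ Θ m - Θ a ∈ Y := by
  obtain ⟨hd0, hYS, hdY⟩ := hd
  have hd0' : d ≠ 0 := fun h => hd0 (by rw [h]; rfl)
  have hli : LinearIndependent K ![o + a, (d : Fin 3 → K)] := by
    rw [LinearIndependent.pair_iff]
    intro s t hst
    have h1 := congrArg L hst
    rw [map_add, map_smul, map_smul, map_add, ho, LinearMap.mem_ker.mp a.2,
      LinearMap.mem_ker.mp d.2] at h1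
    have hs : s = 0 := by simpa using h1
    rw [hs, zero_smul, zero_add] at hst
    exact ⟨hs, (smul_eq_zero.mp hst).resolve_right hd0⟩
  have hline : IsLine (pts (Submodule.span K {o + (a : Fin 3 → K), (d : Fin 3 → K)})) :=
    ⟨_, finrank_span_pair hli, rfl⟩
  have hmemX : ∀ m : LinearMap.ker L,
      o + (m : Fin 3 → K) ∈ Submodule.span K {o + (a : Fin 3 → K), (d : Fin 3 → K)} ↔
        m - a ∈ Submodule.span K {d} := by
    intro m
    rw [Submodule.mem_span_pair, Submodule.mem_span_singleton]
    constructor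
    · rintro ⟨s, t, hst⟩
      have h1 := congrArg L hst
      rw [map_add, map_smul, map_smul, map_add, ho, LinearMap.mem_ker.mp a.2,
        LinearMap.mem_ker.mp d.2, map_add, ho, LinearMap.mem_ker.mp m.2] at h1
      have hs : s = 1 := by simpa using h1
      refine ⟨t, Subtype.ext ?_⟩
      rw [hs, one_smul] at hst
      rw [Submodule.coe_smul, Submodule.coe_sub, eq_sub_iff_add_eq]
      apply add_left_cancel (a := o)
      rw [← hst]; abel
    · rintro ⟨t, ht⟩
      refine ⟨1, t, ?_⟩
      have := congrArg Subtype.val ht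
      rw [Submodule.coe_smul, Submodule.coe_sub] at this
      rw [this]; module
  rcases (hσ _).mp hline with h1 | ⟨X, hX, hXH, -, h1⟩
  · exfalso
    obtain ⟨hv, hx, hP, hσv⟩ := hΘσ a
    have hm : Sum.inl ⟨_, hP⟩ ∈ σ '' pts (Submodule.span K {o + (a : Fin 3 → K), (d : Fin 3 → K)}) :=
      ⟨_, (mem_pts_mk hv).mpr (Submodule.subset_span (by simp)), hσv⟩
    rw [h1] at hm
    obtain ⟨Z, hZ⟩ := hm
    cases hZ
  · have hmem : ∀ p, p ∈ pts (Submodule.span K {o + (a : Fin 3 → K), (d : Fin 3 → K)}) ↔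
        σ p ∈ bbLine H S X := by
      intro p
      rw [← h1, Set.mem_image_equiv, Equiv.symm_apply_apply]
    have hYX : Y ≤ X := by
      have := (hmem (Projectivization.mk K _ hd0)).mp
        ((mem_pts_mk hd0).mpr (Submodule.subset_span (by simp)))
      rw [hdY] at this
      exact this
    have hΘX : ∀ m, Θ m ∈ X ↔ m - a ∈ Submodule.span K {d} := by
      intro m
      obtain ⟨hv, hx, hP, hσv⟩ := hΘσ m
      have := hmem (Projectivization.mk K _ hv)
      rw [hσv, mem_pts_mk, hmemX] at this
      rw [this]
      exact (mem_pts_mk hx).symm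
    have hinf := inf_eq_of_le_of_not_le hW hH hX hXH hYX (hS.1 Y hYS).1 (hS.1 Y hYS).2
    have ha : Θ a ∈ X := (hΘX a).mpr (by rw [sub_self]; exact Submodule.zero_mem _)
    rw [← hΘX, ← hinf, Submodule.mem_inf, ← hh, LinearMap.mem_ker, map_sub, hΘ, hΘ, sub_self,
      Submodule.sub_mem_iff_left _ ha]
    simp

/-- Linear coordinates of a Bruck-Bose representation. -/
theorem exists_semilinear_coordinates (hW : Module.finrank F W = 7)
    (hH : Module.finrank F H = 6) (hS : IsSpread H S) (hσ : IsBruckBose σ) {h : W →ₗ[F] F}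
    (hh : LinearMap.ker h = H) :
    ∃ (L : (Fin 3 → K) →ₗ[K] K) (o : Fin 3 → K) (Ψ : LinearMap.ker L →+ W) (w₀ : W)
      (ψ : F →+* K), L o = 1 ∧ h w₀ = 1 ∧ Function.Injective Ψ ∧ (∀ m, h (Ψ m) = 0) ∧
      (∀ c m, Ψ (ψ c • m) = c • Ψ m) ∧ 
      (∀ m : LinearMap.ker L, IsAffineImage σ (o + m) (w₀ + Ψ m)) ∧
      ∀ m : LinearMap.ker L, m ≠ 0 → ∃ Y, IsInfiniteImage σ m Y ∧
        ∀ m', Ψ m' ∈ Y ↔ m' ∈ Submodule.span K {m} := by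
  obtain ⟨L, o, Θ, ho, hinf, hΘ, hsurj, haff⟩ := exists_affine_bijection hσ hh
  have hex : ∀ m : LinearMap.ker L, ∃ Y, m ≠ 0 → IsInfiniteImage σ m Y := fun m => by
    by_cases hm : m = 0
    · exact ⟨⊥, fun h => absurd hm h⟩
    · obtain ⟨Y, hY⟩ := hinf m hm
      exact ⟨Y, fun _ => hY⟩
  choose Y hY using hex
  have hΘY : ∀ d, d ≠ 0 → ∀ a m, m - a ∈ Submodule.span K {d} ↔ Θ m - Θ a ∈ Y d :=
    fun d hd => sub_mem_iff_of_isInfiniteImage hW hH hS hσ hh ho hΘ haff (hY d hd)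
  have hL : Module.finrank K (LinearMap.ker L) = 2 := by
    have h1 := L.finrank_range_add_finrank_ker
    have h2 : LinearMap.range L = ⊤ := by
      rw [LinearMap.range_eq_top]
      intro c
      exact ⟨c • o, by rw [map_smul, ho, smul_eq_mul, mul_one]⟩
    rw [h2, finrank_top, Module.finrank_self, Module.finrank_fin_fun] at h1
    omega
  have hM : ∀ a : LinearMap.ker L, ∃ c, c ∉ Submodule.span K {a} := by
    intro a
    by_contra! hcon
    have : Submodule.span K {a} = ⊤ := eq_top_iff.mpr fun c _ => hcon c
    have h1 := finrank_span_le_card (R := K) ({a} : Set (LinearMap.ker L))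
    rw [this, finrank_top, hL] at h1
    simp at h1
  have hdisj : ∀ d d', d ≠ 0 → d' ∉ Submodule.span K {d} → Disjoint (Y d) (Y d') := by
    intro d d' hd hd'
    have hd0' : d' ≠ 0 := by rintro rfl; exact hd' (Submodule.zero_mem _)
    obtain ⟨hv, hYS, hσd⟩ := hY d hd
    obtain ⟨hv', hYS', hσd'⟩ := hY d' hd0'
    refine hS.disjoint hYS hYS' fun heq => ?_
    have : σ (Projectivization.mk K _ hv') = σ (Projectivization.mk K _ hv) := by
      rw [hσd, hσd']
      congr 2
      exact heq.symm
    obtain ⟨c, hc⟩ := (Projectivization.mk_eq_mk_iff' K _ _ hv' hv).mp (σ.injective this)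
    exact hd' (Submodule.mem_span_singleton.mpr ⟨c, Subtype.ext hc⟩)
  let Ψ : LinearMap.ker L →+ W :=
    { toFun := fun m => Θ m - Θ 0
      map_zero' := sub_self _
      map_add' := additive_of_parallel Θ Y (fun d hd a m => (hΘY d hd a m).mp) hdisj hM }
  have hΨ : ∀ m, Ψ m = Θ m - Θ 0 := fun _ => rfl
  have hΨY : ∀ d, d ≠ 0 → ∀ m, Ψ m ∈ Y d ↔ m ∈ Submodule.span K {d} := by
    intro d hd m
    rw [hΨ, ← hΘY d hd, sub_zero]
  have hinj : Function.Injective Ψ := by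
    rw [injective_iff_map_eq_zero]
    intro m hm
    have hm1 : Θ m = Θ 0 := sub_eq_zero.mp hm
    obtain ⟨c, hc⟩ := (haff 0).eq_smul_left (hm1 ▸ haff m)
    have h1 := congrArg L hc
    rw [map_smul, map_add, map_add, ho, LinearMap.mem_ker.mp m.2, ZeroMemClass.coe_zero, map_zero,
      add_zero, smul_eq_mul, mul_one] at h1
    rw [h1, one_smul, ZeroMemClass.coe_zero] at hc
    exact Subtype.ext (add_left_cancel hc).symm
  have hrange : ∀ (c : F) m, ∃ m', Ψ m' = c • Ψ m := by
    intro c m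
    obtain ⟨m', hm'⟩ := hsurj (Θ 0 + c • Ψ m) (by
      rw [map_add, map_smul, hΨ, map_sub, hΘ, hΘ, sub_self, smul_zero, add_zero])
    exact ⟨m', by rw [hΨ, hm', add_sub_cancel_left]⟩
  obtain ⟨ψ, hψ⟩ := exists_ringHom_of_lines Ψ hinj hrange Y hΨY hM
  refine ⟨L, o, Ψ, Θ 0, ψ, ho, hΘ 0, hinj, fun m => ?_, hψ, fun m => ?_, fun m hm =>
    ⟨Y m, hY m hm, hΨY m hm⟩⟩
  · rw [hΨ, map_sub, hΘ, hΘ, sub_self]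
  · rw [hΨ, add_sub_cancel]
    exact haff m

end Coordinates

/-! ### Norm and adjoint form in a cubic extension. -/

section CubicExtension

variable {F K : Type*} [Field F] [Field K] [Algebra F K]

/-- The degree of `θ` divides the prime `3` and is not `1`. -/
lemma linearIndependent_one_pow_two (hK : Module.finrank F K = 3) {θ : K}
    (hθ : θ ∉ Set.range (algebraMap F K)) : LinearIndependent F ![1, θ, θ ^ 2] := by
  have hfd : FiniteDimensional F K := FiniteDimensional.of_finrank_pos (by omega)
  have hint : IsIntegral F θ := IsIntegral.of_finite F θ
  have hdvd : (minpoly F θ).natDegree ∣ 3 := hK ▸ minpoly.degree_dvd hint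
  have h3 : (minpoly F θ).natDegree = 3 := by
    rcases (Nat.dvd_prime Nat.prime_three).mp hdvd with h | h
    · exact absurd (minpoly.natDegree_eq_one_iff.mp h) hθ
    · exact h
  have hli := (linearIndependent_pow (K := F) θ).comp (Fin.cast h3.symm) (Fin.cast_injective _)
  convert hli using 1
  ext i
  fin_cases i <;> simp

lemma exists_cubic_relation (hK : Module.finrank F K = 3) {θ : K}
    (hli : LinearIndependent F ![1, θ, θ ^ 2]) :
    ∃ p q r : F, θ ^ 3 = p • θ ^ 2 + q • θ + r • (1 : K) := by
  have hspan := hli.span_eq_top_of_card_eq_finrank (by rw [hK, Fintype.card_fin])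
  have hm : θ ^ 3 ∈ Submodule.span F (Set.range ![1, θ, θ ^ 2]) := by rw [hspan]; trivial
  obtain ⟨c, hc⟩ := (Submodule.mem_span_range_iff_exists_fun F).mp hm
  refine ⟨c 2, c 1, c 0, ?_⟩
  rw [← hc, Fin.sum_univ_three]
  simp
  ring

lemma eq_zero_of_pow_relation {θ : K} (hli : LinearIndependent F ![1, θ, θ ^ 2]) {x y z : F}
    (h : x • (1 : K) + y • θ + z • θ ^ 2 = 0) : x = 0 ∧ y = 0 ∧ z = 0 := by
  have := Fintype.linearIndependent_iff.mp hli ![x, y, z] (by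
    rw [Fin.sum_univ_three]; exact h)
  exact ⟨this 0, this 1, this 2⟩

/-- The coefficients of the binary quadratic form `(s + t θ') (s + t θ'')`, where `θ'` and `θ''`
are the conjugates of a root `θ` of `X ^ 3 - p X ^ 2 - q X - r`. -/
def adjCoeff (θ : K) (p q : F) : Fin 3 → K :=
  ![1, p • (1 : K) - θ, θ ^ 2 - p • θ - q • (1 : K)]

/-- The value of the form `(s + t θ') (s + t θ'')`. -/
def adjForm (θ : K) (p q : F) (u : Fin 2 → F) : K :=
  u 0 ^ 2 • (1 : K) + (u 0 * u 1) • (p • (1 : K) - θ) + u 1 ^ 2 • (θ ^ 2 - p • θ - q • (1 : K))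

/-- The norm of `s + t θ`. -/
def normForm (p q r : F) (u : Fin 2 → F) : F :=
  u 0 ^ 3 + p * u 0 ^ 2 * u 1 - q * u 0 * u 1 ^ 2 + r * u 1 ^ 3

variable {θ : K} {p q r : F}

lemma mul_adjForm (hθ : θ ^ 3 = p • θ ^ 2 + q • θ + r • (1 : K)) (u : Fin 2 → F) :
    (u 0 • (1 : K) + u 1 • θ) * adjForm θ p q u = normForm p q r u • (1 : K) := by
  simp only [adjForm, normForm, Algebra.smul_def, mul_one, map_add, map_sub, map_mul,
    map_pow] at hθ ⊢
  linear_combination (algebraMap F K (u 1)) ^ 3 * hθ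

lemma linearIndependent_adjCoeff (hli : LinearIndependent F ![1, θ, θ ^ 2]) :
    LinearIndependent F (adjCoeff θ p q) := by
  rw [Fintype.linearIndependent_iff]
  intro c hc
  rw [Fin.sum_univ_three] at hc
  obtain ⟨h0, h1, h2⟩ := eq_zero_of_pow_relation (x := c 0 + c 1 * p - c 2 * q)
    (y := -c 1 - c 2 * p) (z := c 2) hli (by
      rw [← hc]
      show _ = c 0 • (1 : K) + c 1 • (p • (1 : K) - θ) + c 2 • (θ ^ 2 - p • θ - q • (1 : K))
      module)
  rw [h2, zero_mul, sub_zero, neg_eq_zero] at h1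
  rw [h1, h2, zero_mul, zero_mul, add_zero, sub_zero] at h0
  exact Fin.forall_fin_succ.mpr ⟨h0, Fin.forall_fin_two.mpr ⟨h1, h2⟩⟩

lemma add_smul_ne_zero (hli : LinearIndependent F ![1, θ, θ ^ 2]) {u : Fin 2 → F} (hu : u ≠ 0) :
    u 0 • (1 : K) + u 1 • θ ≠ 0 := by
  intro h
  obtain ⟨h0, h1, -⟩ := eq_zero_of_pow_relation (x := u 0) (y := u 1) (z := 0) hli (by
    rw [zero_smul, add_zero, h])
  exact hu (by ext i; fin_cases i <;> simp [h0, h1])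

lemma normForm_ne_zero (hli : LinearIndependent F ![1, θ, θ ^ 2])
    (hθ : θ ^ 3 = p • θ ^ 2 + q • θ + r • (1 : K)) {u : Fin 2 → F} (hu : u ≠ 0) :
    normForm p q r u ≠ 0 := by
  intro h
  have h1 := mul_adjForm hθ u
  rw [h, zero_smul] at h1
  have h2 : adjForm θ p q u = nrcVec (adjCoeff θ p q) u := by
    simp [adjForm, nrcVec, adjCoeff, Fin.sum_univ_three]
  rcases mul_eq_zero.mp h1 with h3 | h3
  · exact add_smul_ne_zero hli hu h3
  · have hadj := linearIndependent_adjCoeff (p := p) (q := q) hli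
    exact nrcVec_ne_zero hadj hu (h2.symm.trans h3)

/-- The three coefficients form a basis of `K`, so `A` vanishes on `δ K`, which is all of `K` unless
`δ = 0`. -/
lemma eq_zero_of_apply_mul_adjCoeff (hK : Module.finrank F K = 3)
    (hli : LinearIndependent F ![1, θ, θ ^ 2]) {A : K →ₗ[F] F} {δ : K}
    (h : ∀ j, A (δ * adjCoeff θ p q j) = 0) (hA : A ≠ 0) : δ = 0 := by
  have hspan := (linearIndependent_adjCoeff (p := p) (q := q) hli).span_eq_top_of_card_eq_finrank
    (by rw [hK, Fintype.card_fin])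
  have h1 : A ∘ₗ LinearMap.mulLeft F δ = 0 := by
    rw [← LinearMap.ker_eq_top, eq_top_iff, ← hspan, Submodule.span_le]
    rintro _ ⟨j, rfl⟩
    exact h j
  by_contra hδ
  apply hA
  ext x
  have := LinearMap.congr_fun h1 (δ⁻¹ * x)
  simpa [mul_inv_cancel_left₀ hδ] using this

end CubicExtension

/-! ### The explicit scroll of a tangent subplane. -/

section Model

variable {F K W : Type*} [Field F] [Field K] [Algebra F K] [AddCommGroup W] [Module F W]
  (D : (K × K × F) ≃ₗ[F] W) {θ : K} {p q r : F}

/-- The coefficients of the twisted cubic `(t (s + t θ') (s + t θ''), N(s + t θ))`. -/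
def cubicCoeff (θ : K) (p q r : F) : Fin 4 → K × K × F :=
  ![(0, 0, 1), (0, 1, p), (0, p • (1 : K) - θ, -q), (0, θ ^ 2 - p • θ - q • (1 : K), r)]

lemma linearIndependent_cubicCoeff (hli : LinearIndependent F ![1, θ, θ ^ 2]) :
    LinearIndependent F (cubicCoeff θ p q r) := by
  rw [Fintype.linearIndependent_iff]
  intro c hc
  rw [Fin.sum_univ_four] at hc
  have h1 := congrArg (fun x => x.2.1) hc
  have h2 := congrArg (fun x => x.2.2) hc
  simp [cubicCoeff] at h1 h2
  have hadj := linearIndependent_adjCoeff (p := p) (q := q) hli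
  rw [Fintype.linearIndependent_iff] at hadj
  have h3 := hadj ![c 1, c 2, c 3] (by
      rw [Fin.sum_univ_three]
      simp [adjCoeff]
      exact h1)
  have e1 : c 1 = 0 := h3 0
  have e2 : c 2 = 0 := h3 1
  have e3 : c 3 = 0 := h3 2
  have e0 : c 0 = 0 := by simpa [e1, e2, e3] using h2
  exact Fin.forall_fin_succ.mpr ⟨e0, Fin.forall_fin_succ.mpr ⟨e1, Fin.forall_fin_two.mpr ⟨e2, e3⟩⟩⟩

/-- The scroll given by a tangent subplane in suitable coordinates. -/
def modelScroll (hli : LinearIndependent F ![1, θ, θ ^ 2]) (p q r : F) : Scroll F W where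
  a j := D (adjCoeff θ p q j, 0, 0)
  b j := D (cubicCoeff θ p q r j)
  φ := LinearEquiv.refl F _
  indep_a := (linearIndependent_adjCoeff hli).map' (D.toLinearMap ∘ₗ LinearMap.inl F K (K × F))
    (by
      rw [LinearEquiv.ker_comp, LinearMap.ker_eq_bot]
      exact LinearMap.inl_injective)
  indep_b := (linearIndependent_cubicCoeff hli).map' D.toLinearMap D.ker
  disjoint_span := by
    have h1 : Submodule.span F (Set.range fun j => D (adjCoeff θ p q j, 0, 0)) ≤
        LinearMap.ker (LinearMap.snd F K (K × F) ∘ₗ D.symm.toLinearMap) := by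
      rw [Submodule.span_le]
      rintro _ ⟨j, rfl⟩
      simp
    have h2 : Submodule.span F (Set.range fun j => D (cubicCoeff θ p q r j)) ≤
        LinearMap.ker (LinearMap.fst F K (K × F) ∘ₗ D.symm.toLinearMap) := by
      rw [Submodule.span_le]
      rintro _ ⟨j, rfl⟩
      fin_cases j <;> simp [cubicCoeff]
    rw [Submodule.disjoint_def]
    intro x hx hx'
    have e1 : (D.symm x).2 = 0 := h1 hx
    have e2 : (D.symm x).1 = 0 := h2 hx'
    exact D.symm.map_eq_zero_iff.mp (Prod.ext e2 e1)

variable (hli : LinearIndependent F ![1, θ, θ ^ 2])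

lemma nrcVec_modelScroll_a (u : Fin 2 → F) :
    nrcVec (modelScroll D hli p q r).a u = D (adjForm θ p q u, 0, 0) := by
  simp only [nrcVec, modelScroll, ← map_smul, ← map_sum]
  congr 1
  simp [Fin.sum_univ_three, adjCoeff, adjForm]

lemma nrcVec_modelScroll_b (u : Fin 2 → F) :
    nrcVec (modelScroll D hli p q r).b u = D (0, u 1 • adjForm θ p q u, normForm p q r u) := by
  simp only [nrcVec, modelScroll, ← map_smul, ← map_sum]
  congr 1
  simp [Fin.sum_univ_four, cubicCoeff, adjForm, normForm]
  constructor
  · module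
  · ring

lemma mem_modelScroll_plane (hK : Module.finrank F K = 3) (w : W) :
    w ∈ (modelScroll D hli p q r).plane ↔ ∃ x, w = D (x, 0, 0) := by
  have hspan := (linearIndependent_adjCoeff (p := p) (q := q) hli).span_eq_top_of_card_eq_finrank
    (by rw [hK, Fintype.card_fin])
  have h : (modelScroll D hli p q r).plane =
      LinearMap.range (D.toLinearMap ∘ₗ LinearMap.inl F K (K × F)) := by
    rw [LinearMap.range_eq_map, ← hspan, Submodule.map_span, ← Set.range_comp]
    rfl
  rw [h, LinearMap.mem_range]
  exact ⟨fun ⟨x, hx⟩ => ⟨x, hx.symm⟩, fun ⟨x, hx⟩ => ⟨x, hx.symm⟩⟩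

/-- The linear form `A (x - m y) + c z`. -/
def hyperplaneForm (A : K →ₗ[F] F) (m : K) (c : F) : W →ₗ[F] F :=
  (A ∘ₗ LinearMap.fst F K (K × F) -
    A ∘ₗ LinearMap.mulLeft F m ∘ₗ LinearMap.fst F K F ∘ₗ LinearMap.snd F K (K × F) +
    c • (LinearMap.snd F K F ∘ₗ LinearMap.snd F K (K × F))) ∘ₗ D.symm.toLinearMap

lemma hyperplaneForm_apply (A : K →ₗ[F] F) (m : K) (c : F) (x y : K) (z : F) :
    hyperplaneForm D A m c (D (x, y, z)) = A x - A (m * y) + c * z := by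
  simp [hyperplaneForm]

variable {D} {hli} {A : K →ₗ[F] F} {m : K} {c : F}

lemma ofCoeffs_hyperplaneForm_a :
    ofCoeffs (hyperplaneForm D A m c ∘ (modelScroll D hli p q r).a) =
      ofCoeffs (A ∘ adjCoeff θ p q) := by
  congr 1
  ext j
  simp [modelScroll, hyperplaneForm_apply]

lemma ofCoeffs_adjCoeff_ne_zero (hK : Module.finrank F K = 3)
    (hli : LinearIndependent F ![1, θ, θ ^ 2]) (hA : A ≠ 0) :
    ofCoeffs (A ∘ adjCoeff θ p q) ≠ 0 := by
  intro h
  refine one_ne_zero (eq_zero_of_apply_mul_adjCoeff (p := p) (q := q) hK hli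
    (A := A) (δ := 1) (fun j => ?_) hA)
  have := coeff_ofCoeffs (A ∘ adjCoeff θ p q) j
  rw [h] at this
  simpa using this.symm

open Polynomial in
-- With `l = l₀ + l₁ X`, the lowest coefficient says `c = l₀ A(1)`. Modulo this, the other three say
-- that `A` kills `δ` times each coefficient of the adjoint form, where `δ = m - (-l₁ + l₀ θ)`;
-- hence `δ = 0`. So `α = -l₁` and `β = l₀`.
lemma hyperplaneForm_dvd_iff (hK : Module.finrank F K = 3)
    (hθ : θ ^ 3 = p • θ ^ 2 + q • θ + r • (1 : K)) (hA : A ≠ 0) :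
    (∃ l : F[X], l.natDegree ≤ 1 ∧
      ofCoeffs (hyperplaneForm D A m c ∘ (modelScroll D hli p q r).b) =
        ofCoeffs (hyperplaneForm D A m c ∘ (modelScroll D hli p q r).a) * l) ↔
    ∃ α β : F, m = α • (1 : K) + β • θ ∧ c = β * A 1 := by
  set Q := ofCoeffs (hyperplaneForm D A m c ∘ (modelScroll D hli p q r).a) with hQ
  set B := ofCoeffs (hyperplaneForm D A m c ∘ (modelScroll D hli p q r).b) with hB
  have hQd : Q.natDegree ≤ 2 := natDegree_ofCoeffs_le _
  have hBd : B.natDegree ≤ 3 := natDegree_ofCoeffs_le _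
  have Q0 : Q.coeff 0 = A 1 :=
    (coeff_ofCoeffs (hyperplaneForm D A m c ∘ (modelScroll D hli p q r).a) 0).trans (by
      show hyperplaneForm D A m c (D (1, 0, 0)) = _
      rw [hyperplaneForm_apply]; simp)
  have Q1 : Q.coeff 1 = p * A 1 - A θ :=
    (coeff_ofCoeffs (hyperplaneForm D A m c ∘ (modelScroll D hli p q r).a) 1).trans (by
      show hyperplaneForm D A m c (D (p • (1 : K) - θ, 0, 0)) = _
      rw [hyperplaneForm_apply]; simp)
  have Q2 : Q.coeff 2 = A (θ ^ 2) - p * A θ - q * A 1 :=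
    (coeff_ofCoeffs (hyperplaneForm D A m c ∘ (modelScroll D hli p q r).a) 2).trans (by
      show hyperplaneForm D A m c (D (θ ^ 2 - p • θ - q • (1 : K), 0, 0)) = _
      rw [hyperplaneForm_apply]; simp)
  have Q3 : Q.coeff 3 = 0 := coeff_eq_zero_of_natDegree_lt (by omega)
  have B0 : B.coeff 0 = c :=
    (coeff_ofCoeffs (hyperplaneForm D A m c ∘ (modelScroll D hli p q r).b) 0).trans (by
      show hyperplaneForm D A m c (D (0, 0, 1)) = _
      rw [hyperplaneForm_apply]; simp)
  have B1 : B.coeff 1 = -A m + c * p :=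
    (coeff_ofCoeffs (hyperplaneForm D A m c ∘ (modelScroll D hli p q r).b) 1).trans (by
      show hyperplaneForm D A m c (D (0, 1, p)) = _
      rw [hyperplaneForm_apply]; simp)
  have B2 : B.coeff 2 = A (m * θ) - p * A m - c * q :=
    (coeff_ofCoeffs (hyperplaneForm D A m c ∘ (modelScroll D hli p q r).b) 2).trans (by
      show hyperplaneForm D A m c (D (0, p • (1 : K) - θ, -q)) = _
      rw [hyperplaneForm_apply]; simp [mul_sub]; ring)
  have B3 : B.coeff 3 = -(A (m * θ ^ 2) - p * A (m * θ) - q * A m) + c * r :=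
    (coeff_ofCoeffs (hyperplaneForm D A m c ∘ (modelScroll D hli p q r).b) 3).trans (by
      show hyperplaneForm D A m c (D (0, θ ^ 2 - p • θ - q • (1 : K), r)) = _
      rw [hyperplaneForm_apply]; simp [mul_sub])
  have hl : ∀ l₀ l₁ : F, B = Q * (C l₀ + C l₁ * X) ↔
      B.coeff 0 = Q.coeff 0 * l₀ ∧ B.coeff 1 = Q.coeff 1 * l₀ + Q.coeff 0 * l₁ ∧
      B.coeff 2 = Q.coeff 2 * l₀ + Q.coeff 1 * l₁ ∧ B.coeff 3 = Q.coeff 2 * l₁ := by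
    intro l₀ l₁
    have e : Q * (C l₀ + C l₁ * X) = Q * C l₀ + Q * C l₁ * X := by ring
    constructor
    · intro h
      rw [h, e]
      simp [coeff_mul_C, coeff_mul_X, Q3]
    · rintro ⟨h0, h1, h2, h3⟩
      ext j
      rw [e, coeff_add, coeff_mul_C]
      match j with
      | 0 => simp [h0]
      | 1 => simp [h1, coeff_mul_X]
      | 2 => simp [h2, coeff_mul_X, coeff_mul_C]
      | 3 => simp [h3, coeff_mul_X, coeff_mul_C, Q3]
      | j + 4 =>
        rw [coeff_mul_X, coeff_mul_C, coeff_eq_zero_of_natDegree_lt (p := B) (by omega),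
          coeff_eq_zero_of_natDegree_lt (p := Q) (by omega),
          coeff_eq_zero_of_natDegree_lt (p := Q) (by omega)]
        ring
  rw [Q0, Q1, Q2, B0, B1, B2, B3] at hl
  have hA3 : A (θ ^ 3) = p * A (θ ^ 2) + q * A θ + r * A 1 := by simp [hθ]
  constructor
  · rintro ⟨l, hld, h⟩
    obtain ⟨l₁, l₀, rfl⟩ := exists_eq_X_add_C_of_natDegree_le_one hld
    rw [add_comm, hl] at h
    obtain ⟨h0, h1, h2, h3⟩ := h
    refine ⟨-l₁, l₀, ?_, by rw [h0, mul_comm]⟩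
    rw [← sub_eq_zero]
    refine eq_zero_of_apply_mul_adjCoeff (p := p) (q := q) hK hli (A := A) (fun j => ?_) hA
    have e1 : A ((m - (-l₁ • (1 : K) + l₀ • θ)) * 1) = A m + l₁ * A 1 - l₀ * A θ := by
      simp; ring
    have e2 : A ((m - (-l₁ • (1 : K) + l₀ • θ)) * θ) = A (m * θ) + l₁ * A θ - l₀ * A (θ ^ 2) := by
      simp [sub_mul, add_mul, ← pow_two]; ring
    have e3 : A ((m - (-l₁ • (1 : K) + l₀ • θ)) * θ ^ 2) =
        A (m * θ ^ 2) + l₁ * A (θ ^ 2) - l₀ * A (θ ^ 3) := by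
      simp [sub_mul, add_mul, ← pow_succ']; ring
    fin_cases j
    · show A ((m - (-l₁ • (1 : K) + l₀ • θ)) * 1) = 0
      rw [e1]
      linear_combination -h1 + p * h0
    · show A ((m - (-l₁ • (1 : K) + l₀ • θ)) * (p • (1 : K) - θ)) = 0
      rw [mul_sub, mul_smul_comm, map_sub, map_smul, e1, e2, smul_eq_mul]
      linear_combination -h2 - q * h0
    · show A ((m - (-l₁ • (1 : K) + l₀ • θ)) * (θ ^ 2 - p • θ - q • (1 : K))) = 0
      rw [mul_sub, mul_sub, mul_smul_comm, mul_smul_comm, map_sub, map_sub, map_smul, map_smul,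
        e1, e2, e3, smul_eq_mul, smul_eq_mul, hA3]
      linear_combination -h3 + r * h0
  · rintro ⟨α, β, rfl, rfl⟩
    refine ⟨C β + C (-α) * X, by compute_degree, (hl _ _).mpr ⟨by ring, ?_, ?_, ?_⟩⟩
    · simp; ring
    · simp [add_mul, ← pow_two]; ring
    · simp [add_mul, ← pow_two, ← pow_succ', hA3]; ring

lemma hyperplaneForm_nrcVec_a (u : Fin 2 → F) :
    hyperplaneForm D A m c (nrcVec (modelScroll D hli p q r).a u) = A (adjForm θ p q u) := by
  rw [nrcVec_modelScroll_a, hyperplaneForm_apply]; simp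

lemma hyperplaneForm_nrcVec_b (u : Fin 2 → F) :
    hyperplaneForm D A m c (nrcVec (modelScroll D hli p q r).b u) =
      c * normForm p q r u - u 1 * A (m * adjForm θ p q u) := by
  rw [nrcVec_modelScroll_b, hyperplaneForm_apply]
  simp
  ring

/-- Substituting `t θ adj = N - s adj` turns the cubic form into `(c - β A(1)) N + (β s - α t)
A(adj)`, and the second term vanishes here. -/
lemma hyperplaneForm_nrcVec_b_of_mem (hθ : θ ^ 3 = p • θ ^ 2 + q • θ + r • (1 : K)) {α β : F}
    {u : Fin 2 → F} (hu : A (adjForm θ p q u) = 0) :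
    hyperplaneForm D A (α • (1 : K) + β • θ) c (nrcVec (modelScroll D hli p q r).b u) =
      (c - β * A 1) * normForm p q r u := by
  rw [hyperplaneForm_nrcVec_b]
  have h1 := congrArg A (mul_adjForm hθ u)
  simp only [add_mul, smul_mul_assoc, one_mul, map_add, map_smul, smul_eq_mul, hu] at h1 ⊢
  linear_combination -β * h1

end Model

/-! ### Counting the sections of the model. -/

section Counting

variable {F K W : Type*} [Field F] [Field K] [Algebra F K] [AddCommGroup W] [Module F W]
  {D : (K × K × F) ≃ₗ[F] W} {θ : K} {p q r : F} {hli : LinearIndependent F ![1, θ, θ ^ 2]}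
  {A : K →ₗ[F] F} {m x₁ : K} {H π ℓ : Submodule F W}

lemma finrank_ker_add_one {V : Type*} [AddCommGroup V] [Module F V] [FiniteDimensional F V]
    {f : V →ₗ[F] F} {v : V} (hv : f v = 1) :
    Module.finrank F (LinearMap.ker f) + 1 = Module.finrank F V := by
  have h1 := f.finrank_range_add_finrank_ker
  have h2 : LinearMap.range f = ⊤ := by
    rw [LinearMap.range_eq_top]
    intro c
    exact ⟨c • v, by rw [map_smul, hv, smul_eq_mul, mul_one]⟩
  rw [h2, finrank_top, Module.finrank_self] at h1
  omega

lemma ker_hyperplaneForm_injective (hA : A x₁ = 1) :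
    Function.Injective fun c => LinearMap.ker (hyperplaneForm D A m c) := by
  intro c c' h
  -- This vector is killed by the form with parameter `c` and by no other.
  have h1 : D (c • x₁, 0, -1) ∈ LinearMap.ker (hyperplaneForm D A m c) := by
    rw [LinearMap.mem_ker, hyperplaneForm_apply]; simp [hA]
  have h2 : D (c • x₁, 0, -1) ∈ LinearMap.ker (hyperplaneForm D A m c') :=
    (show LinearMap.ker (hyperplaneForm D A m c) = LinearMap.ker (hyperplaneForm D A m c')
      from h) ▸ h1
  rw [LinearMap.mem_ker, hyperplaneForm_apply] at h2
  simp only [map_smul, hA, mul_zero, map_zero, smul_eq_mul, mul_one, sub_zero, mul_neg] at h2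
  exact sub_eq_zero.mp (by rw [sub_eq_add_neg, h2])

lemma exists_eq_smul_of_ker_le {V : Type*} [AddCommGroup V] [Module F V] {f g : V →ₗ[F] F}
    {v : V} (hv : f v = 1) (h : LinearMap.ker f ≤ LinearMap.ker g) (x : V) : g x = g v * f x := by
  have h1 : x - f x • v ∈ LinearMap.ker g := h (by simp [hv])
  rw [LinearMap.mem_ker, map_sub, map_smul, smul_eq_mul, sub_eq_zero] at h1
  rw [h1, mul_comm]

/-- A linear form vanishing on `π` and `ℓ` is `κ A (x - m y) + κ' z`. The case `κ = 0` gives `H`,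
and otherwise `c = κ' / κ` determines the kernel. -/
lemma fiveSpaces_eq_range (hK : Module.finrank F K = 3) (hA : A x₁ = 1)
    (hH : ∀ x y z, D (x, y, z) ∈ H ↔ z = 0)
    (hπ : ∀ x y z, D (x, y, z) ∈ π ↔ x = m * y ∧ z = 0)
    (hℓ : ∀ x y z, D (x, y, z) ∈ ℓ ↔ A x = 0 ∧ y = 0 ∧ z = 0) :
    fiveSpaces H π ℓ = Set.range fun c => LinearMap.ker (hyperplaneForm D A m c) := by
  have hKf : FiniteDimensional F K := FiniteDimensional.of_finrank_pos (by omega)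
  have hfd : FiniteDimensional F W := D.finiteDimensional
  have hW : Module.finrank F W = 7 := by
    rw [← D.finrank_eq, Module.finrank_prod, Module.finrank_prod, hK, Module.finrank_self]
  have hind : ∀ {P : W → Prop}, (∀ x y z, P (D (x, y, z))) → ∀ w, P w := fun h w => by
    have := h (D.symm w).1 (D.symm w).2.1 (D.symm w).2.2
    simpa using this
  ext X
  constructor
  · rintro ⟨hX, hπX, hℓX, hXH⟩
    obtain ⟨f, rfl, v, hv⟩ := exists_ker_eq X (by rw [hX, hW])
    have h1 : ∀ x, f (D (x, 0, 0)) = f (D (x₁, 0, 0)) * A x :=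
      exists_eq_smul_of_ker_le (g := f ∘ₗ D.toLinearMap ∘ₗ LinearMap.inl F K (K × F)) hA
        fun x hx => hℓX ((hℓ x 0 0).mpr ⟨hx, rfl, rfl⟩)
    have h2 : ∀ y, f (D (m * y, y, 0)) = 0 := fun y => hπX ((hπ _ _ _).mpr ⟨rfl, rfl⟩)
    have h3 : ∀ x y z, f (D (x, y, z)) =
        f (D (x₁, 0, 0)) * (A x - A (m * y)) + z * f (D (0, 0, 1)) := by
      intro x y z
      have e : (x, y, z) = (x - m * y, (0 : K), (0 : F)) + (m * y, y, 0) + z • (0, 0, 1) := by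
        simp
      rw [e, map_add, map_add, map_add, map_add, h2, h1, map_smul, map_smul, map_sub, add_zero,
        smul_eq_mul]
    have hκ : f (D (x₁, 0, 0)) ≠ 0 := by
      intro h0
      refine hXH (Submodule.eq_of_le_of_finrank_eq ?_ ?_).symm
      · exact hind (P := fun w => w ∈ H → w ∈ LinearMap.ker f) fun x y z hz => by
          rw [LinearMap.mem_ker, h3, h0, (hH _ _ _).mp hz]; ring
      · have e : H = LinearMap.ker (LinearMap.snd F K F ∘ₗ LinearMap.snd F K (K × F) ∘ₗ
            D.symm.toLinearMap) := by
          ext w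
          revert w
          exact hind fun x y z => by rw [hH]; simp
        have := finrank_ker_add_one (f := LinearMap.snd F K F ∘ₗ LinearMap.snd F K (K × F) ∘ₗ
            D.symm.toLinearMap) (v := D (0, 0, 1)) (by simp)
        rw [← e] at this
        omega
    refine ⟨f (D (0, 0, 1)) / f (D (x₁, 0, 0)), ?_⟩
    ext w
    revert w
    refine hind fun x y z => ?_
    rw [LinearMap.mem_ker, LinearMap.mem_ker, h3 x y z, hyperplaneForm_apply, ← mul_right_inj' hκ,
      mul_zero]
    have : f (D (x₁, 0, 0)) * (A x - A (m * y) + f (D (0, 0, 1)) / f (D (x₁, 0, 0)) * z) =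
        f (D (x₁, 0, 0)) * (A x - A (m * y)) + z * f (D (0, 0, 1)) := by field_simp
    rw [this]
  · rintro ⟨c, rfl⟩
    have hv : hyperplaneForm D A m c (D (x₁, 0, 0)) = 1 := by
      rw [hyperplaneForm_apply]; simp [hA]
    refine ⟨?_, ?_, ?_, fun h => ?_⟩
    · have := finrank_ker_add_one hv
      show Module.finrank F (LinearMap.ker _) = 6
      omega
    · refine hind (P := fun w => w ∈ π → w ∈ LinearMap.ker (hyperplaneForm D A m c))
        fun x y z hw => ?_
      obtain ⟨rfl, rfl⟩ := (hπ _ _ _).mp hw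
      rw [LinearMap.mem_ker, hyperplaneForm_apply]; simp
    · refine hind (P := fun w => w ∈ ℓ → w ∈ LinearMap.ker (hyperplaneForm D A m c))
        fun x y z hw => ?_
      obtain ⟨hx, rfl, rfl⟩ := (hℓ _ _ _).mp hw
      rw [LinearMap.mem_ker, hyperplaneForm_apply]; simp [hx]
    · have h' : LinearMap.ker (hyperplaneForm D A m c) = H := h
      have := (hH x₁ 0 0).mpr rfl
      rw [← h', LinearMap.mem_ker, hv] at this
      exact one_ne_zero this

lemma ncard_pts_inter_conic (V : Scroll F W) (ℓ : Submodule F W) :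
    (pts ℓ ∩ V.conic).ncard = {t : ℙ F (Fin 2 → F) | nrcVec V.a t.rep ∈ ℓ}.ncard := by
  let ν : ℙ F (Fin 2 → F) → ℙ F W := fun t =>
    Projectivization.mk F _ (nrcVec_ne_zero V.indep_a t.rep_nonzero)
  have hν : Function.Injective ν := by
    intro t t' h
    by_contra hne
    have hli := linearIndependent_nrcVec_rep V.indep_a (p := ![t, t']) (by simp) (by
      intro i j; fin_cases i <;> fin_cases j <;> simp [hne, Ne.symm hne])
    obtain ⟨c, hc⟩ := (Projectivization.mk_eq_mk_iff' F _ _ _ _).mp h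
    have h2 := Fintype.linearIndependent_iff.mp hli ![1, -c] (by
      rw [Fin.sum_univ_two]
      show (1 : F) • nrcVec V.a t.rep + (-c) • nrcVec V.a t'.rep = 0
      rw [← hc]; module) 0
    exact one_ne_zero h2
  rw [← Set.ncard_image_of_injective _ hν]
  congr 1
  ext P
  constructor
  · rintro ⟨hP, hc⟩
    obtain ⟨t, ht⟩ := (mem_nrcCurve_iff _ _).mp hc
    refine ⟨t, ?_, ?_⟩
    · have hP' : P.submodule ≤ ℓ := hP
      rw [ht, Submodule.span_singleton_le_iff_mem] at hP'
      exact hP'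
    · apply Projectivization.submodule_injective
      rw [ht]
      exact Projectivization.submodule_mk _ _
  · rintro ⟨t, ht, rfl⟩
    exact ⟨(mem_pts_mk _).mpr ht, (mem_nrcCurve_iff _ _).mpr
      ⟨t, Projectivization.submodule_mk _ _⟩⟩

/-- At a zero `t` of the quadratic form the cubic one vanishes for the single value `c = κ t`,
because the norm is nonzero. If two zeros had the same value, the quadratic form would divide the
cubic one, forcing `m = α + βθ`. -/
lemma ncard_common_zeros (hK : Module.finrank F K = 3)
    (hθ : θ ^ 3 = p • θ ^ 2 + q • θ + r • (1 : K)) (hA : A ≠ 0)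
    (hm : ¬ ∃ α β : F, m = α • (1 : K) + β • θ) :
    {c | ∃ u : Fin 2 → F, u ≠ 0 ∧
      hyperplaneForm D A m c (nrcVec (modelScroll D hli p q r).a u) = 0 ∧
      hyperplaneForm D A m c (nrcVec (modelScroll D hli p q r).b u) = 0}.ncard =
    {t : ℙ F (Fin 2 → F) | A (adjForm θ p q t.rep) = 0}.ncard := by
  let κ : ℙ F (Fin 2 → F) → F := fun t =>
    t.rep 1 * A (m * adjForm θ p q t.rep) / normForm p q r t.rep
  have hκ : ∀ t : ℙ F (Fin 2 → F),
      hyperplaneForm D A m (κ t) (nrcVec (modelScroll D hli p q r).b t.rep) = 0 := by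
    intro t
    rw [hyperplaneForm_nrcVec_b, div_mul_cancel₀ _ (normForm_ne_zero hli hθ t.rep_nonzero),
      sub_self]
  rw [← Set.InjOn.ncard_image (f := κ)]
  · congr 1
    ext c
    constructor
    · rintro ⟨u, hu, ha, hb⟩
      obtain ⟨k, hk, hku⟩ := exists_rep_smul hu
      set t := Projectivization.mk F u hu
      have ha' : hyperplaneForm D A m c (nrcVec (modelScroll D hli p q r).a t.rep) = 0 := by
        rw [hku, nrcVec_smul, map_smul, ha, smul_zero]
      have hb' : hyperplaneForm D A m c (nrcVec (modelScroll D hli p q r).b t.rep) = 0 := by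
        rw [hku, nrcVec_smul, map_smul, hb, smul_zero]
      rw [hyperplaneForm_nrcVec_a] at ha'
      rw [hyperplaneForm_nrcVec_b, sub_eq_zero] at hb'
      exact ⟨t, ha', by
        show _ / _ = c
        rw [← hb', mul_div_cancel_right₀ _ (normForm_ne_zero hli hθ t.rep_nonzero)]⟩
    · rintro ⟨t, ht, rfl⟩
      exact ⟨t.rep, t.rep_nonzero, by rw [hyperplaneForm_nrcVec_a]; exact ht, hκ t⟩
  · intro t ht t' ht' heq
    by_contra hne
    have hd := det₂_rep_ne_zero hne
    set f := hyperplaneForm D A m (κ t) with hf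
    have za : formEval 2 (ofCoeffs (f ∘ (modelScroll D hli p q r).a)) t.rep = 0 := by
      rw [← apply_nrcVec, hyperplaneForm_nrcVec_a]; exact ht
    have za' : formEval 2 (ofCoeffs (f ∘ (modelScroll D hli p q r).a)) t'.rep = 0 := by
      rw [← apply_nrcVec, hyperplaneForm_nrcVec_a]; exact ht'
    have zb : formEval 3 (ofCoeffs (f ∘ (modelScroll D hli p q r).b)) t.rep = 0 := by
      rw [← apply_nrcVec]; exact hκ t
    have zb' : formEval 3 (ofCoeffs (f ∘ (modelScroll D hli p q r).b)) t'.rep = 0 := by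
      rw [← apply_nrcVec, hf, heq]; exact hκ t'
    obtain ⟨Q₁, hQ₁, eQ₁⟩ := exists_eq_linForm_mul (n := 1) (natDegree_ofCoeffs_le _)
      t.rep_nonzero za
    obtain ⟨B₁, hB₁, eB₁⟩ := exists_eq_linForm_mul (n := 2) (natDegree_ofCoeffs_le _)
      t.rep_nonzero zb
    rw [eQ₁] at za'
    rw [eB₁] at zb'
    replace za' := (formEval_mul (natDegree_linForm_le t.rep) hQ₁ t'.rep).symm.trans za'
    replace zb' := (formEval_mul (natDegree_linForm_le t.rep) hB₁ t'.rep).symm.trans zb'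
    rw [formEval_linForm] at za' zb'
    obtain ⟨Q₂, hQ₂, eQ₂⟩ := exists_eq_linForm_mul (n := 0) hQ₁ t'.rep_nonzero
      ((mul_eq_zero.mp za').resolve_left hd)
    obtain ⟨B₂, hB₂, eB₂⟩ := exists_eq_linForm_mul (n := 1) hB₁ t'.rep_nonzero
      ((mul_eq_zero.mp zb').resolve_left hd)
    -- Both linear factors are now split off, and only a constant remains of the quadratic form.
    obtain ⟨k, rfl⟩ := Polynomial.natDegree_eq_zero.mp (Nat.le_zero.mp hQ₂)
    have hk : k ≠ 0 := by
      rintro rfl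
      rw [eQ₂, Polynomial.C_0, mul_zero, mul_zero, hf, ofCoeffs_hyperplaneForm_a] at eQ₁
      exact ofCoeffs_adjCoeff_ne_zero hK hli hA eQ₁
    obtain ⟨α, β, h, -⟩ := (hyperplaneForm_dvd_iff (D := D) (hli := hli) (m := m) (c := κ t)
      hK hθ hA).mp
      ⟨Polynomial.C k⁻¹ * B₂, (Polynomial.natDegree_C_mul_le _ _).trans hB₂, by
        rw [← hf, eB₁, eB₂, eQ₁, eQ₂, mul_assoc, mul_assoc, ← mul_assoc (Polynomial.C k),
          ← Polynomial.C_mul, mul_inv_cancel₀ hk, Polynomial.C_1, one_mul]⟩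
    exact hm ⟨α, β, h⟩

lemma ncard_sep_range {α β : Type*} {f : α → β} (hf : Function.Injective f) (P : β → Prop) :
    {x ∈ Set.range f | P x}.ncard = {a | P (f a)}.ncard := by
  rw [← Set.ncard_image_of_injective _ hf]
  congr 1
  ext x
  constructor
  · rintro ⟨⟨a, rfl⟩, h⟩; exact ⟨a, h, rfl⟩
  · rintro ⟨a, h, rfl⟩; exact ⟨⟨a, rfl⟩, h⟩

/-- The sections of the model scroll by the 5-spaces through `π` and `ℓ`. -/
theorem ncard_sections [Finite F] (hq : 5 ≤ Nat.card F) (hK : Module.finrank F K = 3)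
    (hθ : θ ^ 3 = p • θ ^ 2 + q • θ + r • (1 : K))
    (hH : ∀ x y z, D (x, y, z) ∈ H ↔ z = 0)
    (hπ : ∀ x y z, D (x, y, z) ∈ π ↔ x = m * y ∧ z = 0)
    (hℓ : Module.finrank F ℓ = 2) (hℓα : ℓ ≤ (modelScroll D hli p q r).plane) {i : ℕ}
    (hi : (pts ℓ ∩ (modelScroll D hli p q r).conic).ncard = i) :
    (fiveSpaces H π ℓ).ncard = Nat.card F ∧
    ((∃ α β : F, m = α • (1 : K) + β • θ) →
      {X ∈ fiveSpaces H π ℓ | (modelScroll D hli p q r).MeetsIn X 5 0}.ncard = Nat.card F - 1 ∧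
      {X ∈ fiveSpaces H π ℓ | (modelScroll D hli p q r).MeetsIn X 3 i}.ncard = 1) ∧
    ((¬ ∃ α β : F, m = α • (1 : K) + β • θ) →
      {X ∈ fiveSpaces H π ℓ | (modelScroll D hli p q r).MeetsIn X 5 0}.ncard = Nat.card F - i ∧
      {X ∈ fiveSpaces H π ℓ | (modelScroll D hli p q r).MeetsIn X 4 1}.ncard = i) := by
  have hKf : FiniteDimensional F K := FiniteDimensional.of_finrank_pos (by omega)
  have hfd : FiniteDimensional F W := D.finiteDimensional
  have hW : Module.finrank F W = 7 := by
    rw [← D.finrank_eq, Module.finrank_prod, Module.finrank_prod, hK, Module.finrank_self]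
  set V := modelScroll D hli p q r with hV
  have hφ : V.φ = LinearEquiv.refl F _ := rfl
  let ι : K →ₗ[F] W := D.toLinearMap ∘ₗ LinearMap.inl F K (K × F)
  have hι : Function.Injective ι := D.injective.comp LinearMap.inl_injective
  have hcomap : (ℓ.comap ι).map ι = ℓ := by
    rw [Submodule.map_comap_eq, inf_eq_right]
    intro w hw
    obtain ⟨x, rfl⟩ := (mem_modelScroll_plane D hli hK w).mp (hℓα hw)
    exact ⟨x, rfl⟩
  -- The conic plane is a copy of `K`, in which `ℓ` is the kernel of a linear form.
  obtain ⟨A, hAℓ, x₁, hA⟩ := exists_ker_eq (ℓ.comap ι) (by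
    rw [hK, (Submodule.equivMapOfInjective ι hι _).finrank_eq, hcomap, hℓ])
  have hA0 : A ≠ 0 := by rintro rfl; simp at hA
  have hℓ' : ∀ x y z, D (x, y, z) ∈ ℓ ↔ A x = 0 ∧ y = 0 ∧ z = 0 := by
    intro x y z
    rw [← LinearMap.mem_ker, hAℓ]
    constructor
    · intro h
      obtain ⟨x', hx'⟩ := (mem_modelScroll_plane D hli hK _).mp (hℓα h)
      have := D.injective hx'
      simp only [Prod.mk.injEq] at this
      obtain ⟨rfl, rfl, rfl⟩ := this
      exact ⟨h, rfl, rfl⟩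
    · rintro ⟨h, rfl, rfl⟩
      exact h
  have hi' : {t : ℙ F (Fin 2 → F) | A (adjForm θ p q t.rep) = 0}.ncard = i := by
    rw [← hi, ncard_pts_inter_conic]
    congr 1
    ext t
    rw [Set.mem_ofPred_eq, Set.mem_ofPred_eq, hV, nrcVec_modelScroll_a, hℓ']
    simp
  have hinj := ker_hyperplaneForm_injective (D := D) (m := m) hA
  have hQ : ∀ c, ofCoeffs (hyperplaneForm D A m c ∘ V.a) ≠ 0 := fun c => by
    rw [hV, ofCoeffs_hyperplaneForm_a]
    exact ofCoeffs_adjCoeff_ne_zero hK hli hA0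
  rw [fiveSpaces_eq_range hK hA hH hπ hℓ']
  refine ⟨by rw [← Set.image_univ, Set.ncard_image_of_injective _ hinj, Set.ncard_univ],
    fun hm => ?_, fun hm => ?_⟩
  · obtain ⟨α, β, rfl⟩ := hm
    -- Since `β` is determined by `m`, there is just one exceptional value of `c`.
    have huniq : ∀ α' β' : F, α • (1 : K) + β • θ = α' • (1 : K) + β' • θ → β = β' := by
      intro α' β' h
      have := eq_zero_of_pow_relation (x := α - α') (y := β - β') (z := 0) hli (by
        rw [sub_smul, sub_smul, zero_smul, add_zero, sub_add_sub_comm, h, sub_self])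
      exact sub_eq_zero.mp this.2.1
    have h3 : V.MeetsIn (LinearMap.ker (hyperplaneForm D A (α • (1 : K) + β • θ) (β * A 1))) 3 i := by
      obtain ⟨l, hl, hdvd⟩ := (hyperplaneForm_dvd_iff (D := D) (hli := hli) hK hθ hA0).mpr
        ⟨α, β, rfl, rfl⟩
      have := V.meetsIn_three hW hφ hl hdvd
      rw [← hi']
      convert this using 4
      rw [← apply_nrcVec, hyperplaneForm_nrcVec_a]
    have h5 : ∀ c, c ≠ β * A 1 →
        V.MeetsIn (LinearMap.ker (hyperplaneForm D A (α • (1 : K) + β • θ) c)) 5 0 := by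
      intro c hc
      refine V.meetsIn_five hW hφ (hQ c) (fun u hu hu0 => ?_) fun l hl h => ?_
      · rw [hyperplaneForm_nrcVec_a] at hu0
        rw [hyperplaneForm_nrcVec_b_of_mem hθ hu0]
        exact mul_ne_zero (sub_ne_zero.mpr hc) (normForm_ne_zero hli hθ hu)
      · obtain ⟨α', β', h1, h2⟩ := (hyperplaneForm_dvd_iff (D := D) (hli := hli) hK hθ hA0).mp
          ⟨l, hl, h⟩
        exact hc (by rw [h2, huniq _ _ h1])
    rw [ncard_sep_range hinj, ncard_sep_range hinj]
    constructor
    · have : {c | V.MeetsIn (LinearMap.ker (hyperplaneForm D A (α • (1 : K) + β • θ) c)) 5 0} =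
          {β * A 1}ᶜ := by
        ext c
        refine ⟨fun h hc => ?_, fun hc => h5 c hc⟩
        rw [Set.mem_singleton_iff] at hc
        subst hc
        exact Scroll.MeetsIn.not_of_five hq h (by norm_num) h3
      rw [this, Set.ncard_compl, Set.ncard_singleton]
    · have : {c | V.MeetsIn (LinearMap.ker (hyperplaneForm D A (α • (1 : K) + β • θ) c)) 3 i} =
          {β * A 1} := by
        ext c
        refine ⟨fun h => ?_, fun hc => ?_⟩
        · by_contra hc
          exact Scroll.MeetsIn.not_of_five hq (h5 c hc) (by norm_num) h
        · rw [Set.mem_singleton_iff] at hc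
          subst hc
          exact h3
      rw [this, Set.ncard_singleton]
  · have hdvd : ∀ c (l : Polynomial F), l.natDegree ≤ 1 →
        ofCoeffs (hyperplaneForm D A m c ∘ V.b) ≠
          ofCoeffs (hyperplaneForm D A m c ∘ V.a) * l := by
      intro c l hl h
      obtain ⟨α, β, h1, -⟩ := (hyperplaneForm_dvd_iff (D := D) (hli := hli) hK hθ hA0).mp
        ⟨l, hl, h⟩
      exact hm ⟨α, β, h1⟩
    have hC := ncard_common_zeros (D := D) (hli := hli) hK hθ hA0 hm
    rw [hi'] at hC
    set Z := {c | ∃ u : Fin 2 → F, u ≠ 0 ∧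
      hyperplaneForm D A m c (nrcVec (modelScroll D hli p q r).a u) = 0 ∧
      hyperplaneForm D A m c (nrcVec (modelScroll D hli p q r).b u) = 0} with hZ
    have h4 : ∀ c ∈ Z, V.MeetsIn (LinearMap.ker (hyperplaneForm D A m c)) 4 1 := by
      rintro c ⟨u, hu, ha, hb⟩
      exact V.meetsIn_four hW hφ (hQ c) hu ha hb (hdvd c)
    have h5 : ∀ c ∉ Z, V.MeetsIn (LinearMap.ker (hyperplaneForm D A m c)) 5 0 := by
      intro c hc
      exact V.meetsIn_five hW hφ (hQ c) (fun u hu ha hb => hc ⟨u, hu, ha, hb⟩) (hdvd c)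
    rw [ncard_sep_range hinj, ncard_sep_range hinj]
    constructor
    · have : {c | V.MeetsIn (LinearMap.ker (hyperplaneForm D A m c)) 5 0} = Zᶜ := by
        ext c
        exact ⟨fun h hc => Scroll.MeetsIn.not_of_five hq h (by norm_num) (h4 c hc), h5 c⟩
      rw [this, Set.ncard_compl, hC]
    · have : {c | V.MeetsIn (LinearMap.ker (hyperplaneForm D A m c)) 4 1} = Z := by
        ext c
        refine ⟨fun h => ?_, h4 c⟩
        by_contra hc
        exact Scroll.MeetsIn.not_of_five hq (h5 c hc) (by norm_num) h
      rw [this, hC]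

end Counting

/-! ### Tangent subplanes and their extended lines. -/

section Subplane

variable {F K : Type*} [Field F] [Field K]

/-- The image of any embedding is the set of roots of `X ^ q - X` in `K`: it is contained in this
set and has `q` elements. -/
lemma range_ringHom_eq [Finite F] (ψ ψ' : F →+* K) : Set.range ψ = Set.range ψ' := by
  classical
  have key : ∀ ψ : F →+* K, Set.range ψ = {x | x ^ Nat.card F = x} := by
    intro ψ
    have hq : 1 < Nat.card F := Finite.one_lt_card
    have hp : (Polynomial.X ^ Nat.card F - Polynomial.X : Polynomial K) ≠ 0 :=
      FiniteField.X_pow_card_sub_X_ne_zero K hq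
    have hset : {x : K | x ^ Nat.card F = x} =
        ((Polynomial.X ^ Nat.card F - Polynomial.X : Polynomial K).roots.toFinset : Set K) := by
      ext x
      simp [hp, sub_eq_zero]
    have hfin : {x : K | x ^ Nat.card F = x}.Finite := hset ▸ Finset.finite_toSet _
    refine Set.eq_of_subset_of_ncard_le ?_ ?_ hfin
    · rintro _ ⟨x, rfl⟩
      have : Fintype F := Fintype.ofFinite F
      rw [Set.mem_ofPred_eq, ← map_pow, Nat.card_eq_fintype_card, FiniteField.pow_card]
    · rw [← Set.image_univ, Set.ncard_image_of_injective _ ψ.injective, Set.ncard_univ, hset,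
        Set.ncard_coe_finset]
      refine (Multiset.toFinset_card_le _).trans ((Polynomial.card_roots' _).trans ?_)
      rw [FiniteField.X_pow_card_sub_X_natDegree_eq K hq]
  rw [key, key]

/-- A subplane depends only on the image of `F` in `K`, so it remains one when the algebra structure
is replaced by `ψ`. -/
lemma IsSubplane.of_ringHom [Algebra F K] {B : Set (ℙ K (Fin 3 → K))} (hB : IsSubplane F B)
    {ψ : F →+* K} (hψ : Set.range ψ = Set.range (algebraMap F K)) :
    ∃ e : Module.Basis (Fin 3) K (Fin 3 → K), B = {p | ∃ w : Fin 3 → F, w ≠ 0 ∧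
      p.submodule = Submodule.span K {∑ j, ψ (w j) • e j}} := by
  obtain ⟨e, rfl⟩ := hB
  have key : ∀ ψ ψ' : F →+* K, Set.range ψ = Set.range ψ' → ∀ p : ℙ K (Fin 3 → K),
      (∃ w : Fin 3 → F, w ≠ 0 ∧ p.submodule = Submodule.span K {∑ j, ψ (w j) • e j}) →
      ∃ w : Fin 3 → F, w ≠ 0 ∧ p.submodule = Submodule.span K {∑ j, ψ' (w j) • e j} := by
    rintro ψ ψ' h p ⟨w, hw, hp⟩
    have hex : ∀ x, ∃ y, ψ' y = ψ x := fun x => by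
      have : ψ x ∈ Set.range ψ' := h ▸ ⟨x, rfl⟩
      exact this
    choose τ hτ using hex
    refine ⟨fun j => τ (w j), fun h0 => hw ?_, by simpa only [hτ] using hp⟩
    ext j
    have h1 := hτ (w j)
    rw [show τ (w j) = 0 from congrFun h0 j, map_zero] at h1
    exact (map_eq_zero ψ).mp h1.symm
  exact ⟨e, Set.ext fun p => ⟨key _ _ hψ.symm p, key _ _ hψ p⟩⟩

variable [Algebra F K]

/-- The vector with coordinates `w` in `F` with respect to the basis `e`. -/
def subplaneVec (e : Fin 3 → Fin 3 → K) : (Fin 3 → F) →ₗ[F] (Fin 3 → K) where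
  toFun w := ∑ j, algebraMap F K (w j) • e j
  map_add' w w' := by simp [add_smul, Finset.sum_add_distrib]
  map_smul' c w := by
    simp only [Pi.smul_apply, smul_eq_mul, map_mul, mul_smul, Finset.smul_sum, algebraMap_smul,
      RingHom.id_apply]

lemma subplaneVec_apply (e : Fin 3 → Fin 3 → K) (w : Fin 3 → F) :
    subplaneVec e w = ∑ j, algebraMap F K (w j) • e j := rfl

lemma equivFun_subplaneVec (e : Module.Basis (Fin 3) K (Fin 3 → K)) (w : Fin 3 → F) (j : Fin 3) :
    e.equivFun (subplaneVec e w) j = algebraMap F K (w j) := by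
  rw [subplaneVec_apply, ← e.equivFun_symm_apply (fun j => algebraMap F K (w j)),
    LinearEquiv.apply_symm_apply]

lemma subplaneVec_injective (e : Module.Basis (Fin 3) K (Fin 3 → K)) :
    Function.Injective (subplaneVec (F := F) e) := by
  intro w w' h
  ext j
  apply (algebraMap F K).injective
  rw [← equivFun_subplaneVec e w, ← equivFun_subplaneVec e w', h]

lemma exists_eq_smul_of_subplaneVec (e : Module.Basis (Fin 3) K (Fin 3 → K)) {w w' : Fin 3 → F}
    (hw : w ≠ 0) {k : K} (h : k • subplaneVec e w = subplaneVec e w') : ∃ c : F, w' = c • w := by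
  obtain ⟨j, hj⟩ := Function.ne_iff.mp hw
  have h1 : ∀ i, k * algebraMap F K (w i) = algebraMap F K (w' i) := fun i => by
    rw [← equivFun_subplaneVec e w, ← equivFun_subplaneVec e w', ← h, map_smul]
    rfl
  have hj' : algebraMap F K (w j) ≠ 0 := by
    rw [Ne, map_eq_zero]; exact hj
  have hk : k = algebraMap F K (w' j / w j) := by
    rw [map_div₀, eq_div_iff hj', h1]
  refine ⟨w' j / w j, ?_⟩
  ext i
  apply (algebraMap F K).injective
  rw [← h1, hk, Pi.smul_apply, smul_eq_mul, map_mul]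

lemma linearIndependent_subplaneVec (e : Module.Basis (Fin 3) K (Fin 3 → K))
    {g : Fin 3 → Fin 3 → F} (hg : LinearIndependent F g) :
    LinearIndependent K fun i => subplaneVec e (g i) := by
  have h1 : IsUnit (Matrix.of g) := Matrix.linearIndependent_rows_iff_isUnit.mp hg
  have h2 : IsUnit ((algebraMap F K).mapMatrix (Matrix.of g)) := h1.map _
  have h3 := Matrix.linearIndependent_rows_iff_isUnit.mpr h2
  have h4 := h3.map' e.equivFun.symm.toLinearMap e.equivFun.symm.ker
  have h5 : (fun i => subplaneVec e (g i)) =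
      fun i => e.equivFun.symm (fun j => algebraMap F K (g i j)) := by
    ext1 i
    rw [subplaneVec_apply, e.equivFun_symm_apply]
  rw [h5]
  exact h4

/-- Coordinates in which a tangent subplane has its centre at the first coordinate point. -/
lemma exists_adapted_basis {B : Set (ℙ K (Fin 3 → K))} (hB : IsSubplane F B)
    {L : (Fin 3 → K) →ₗ[K] K} (hT : ∃! p, p ∈ B ∧ p ∈ pts (LinearMap.ker L)) :
    ∃ e : Module.Basis (Fin 3) K (Fin 3 → K), L (e 0) = 0 ∧ L (e 1) = 1 ∧
      L (e 2) ∉ Set.range (algebraMap F K) ∧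
      B = {p | ∃ w : Fin 3 → F, w ≠ 0 ∧ p.submodule = Submodule.span K {subplaneVec e w}} := by
  obtain ⟨e, rfl⟩ := hB
  obtain ⟨p, ⟨⟨w₀, hw₀, hp⟩, hpL⟩, huniq⟩ := hT
  let lam : (Fin 3 → F) →ₗ[F] K := (L.restrictScalars F) ∘ₗ subplaneVec e
  have hlam : ∀ w, lam w = L (subplaneVec e w) := fun _ => rfl
  have hw₀L : lam w₀ = 0 := by
    have : p.submodule ≤ LinearMap.ker L := hpL
    rw [hp, Submodule.span_singleton_le_iff_mem] at this
    exact this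
  -- Tangency means that only multiples of `w₀` are mapped to zero. Hence the values of `L` on the
  -- subplane form an `F`-space of rank two; scaling by `(lam g₁)⁻¹` makes it the span of `1` and
  -- `θ`.
  have hker : LinearMap.ker lam = Submodule.span F {w₀} := by
    refine le_antisymm (fun w hw => ?_) ((Submodule.span_singleton_le_iff_mem _ _).mpr hw₀L)
    rw [LinearMap.mem_ker] at hw
    by_cases hw0 : w = 0
    · rw [hw0]; exact Submodule.zero_mem _
    have hne : subplaneVec e w ≠ 0 := fun h => hw0 ((map_eq_zero_iff _
      (subplaneVec_injective e)).mp h)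
    have := huniq (Projectivization.mk K _ hne) ⟨⟨w, hw0, Projectivization.submodule_mk _ _⟩,
      (mem_pts_mk hne).mpr hw⟩
    have h1 : subplaneVec e w ∈ Submodule.span K {subplaneVec e w₀} := by
      have h2 : (Projectivization.mk K _ hne).submodule = Submodule.span K {subplaneVec e w₀} := by
        rw [this]; exact hp
      rw [← h2, Projectivization.submodule_mk]
      exact Submodule.mem_span_singleton_self _
    obtain ⟨k, hk⟩ := Submodule.mem_span_singleton.mp h1
    obtain ⟨c, rfl⟩ := exists_eq_smul_of_subplaneVec e hw₀ hk
    exact Submodule.smul_mem _ _ (Submodule.mem_span_singleton_self _)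
  have hrange : Module.finrank F (LinearMap.range lam) = 2 := by
    have := lam.finrank_range_add_finrank_ker
    rw [hker, finrank_span_singleton hw₀, Module.finrank_fin_fun] at this
    omega
  let b := Module.finBasisOfFinrankEq F (LinearMap.range lam) hrange
  obtain ⟨g₁, hg₁⟩ := (b 0).2
  obtain ⟨g₂, hg₂⟩ := (b 1).2
  have hli : ∀ s t : F, s • lam g₁ + t • lam g₂ = 0 → s = 0 ∧ t = 0 := by
    intro s t h
    have h2 := Fintype.linearIndependent_iff.mp b.linearIndependent ![s, t] (by
      rw [Fin.sum_univ_two]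
      apply Subtype.ext
      rw [hg₁, hg₂] at h
      exact h)
    exact ⟨h2 0, h2 1⟩
  have hg : LinearIndependent F ![w₀, g₁, g₂] := by
    rw [Fintype.linearIndependent_iff]
    intro c hc
    rw [Fin.sum_univ_three] at hc
    have hc' : c 0 • w₀ + c 1 • g₁ + c 2 • g₂ = 0 := hc
    have h1 := congrArg lam hc'
    rw [map_add, map_add, map_smul, map_smul, map_smul, hw₀L, smul_zero, zero_add, map_zero] at h1
    obtain ⟨e1, e2⟩ := hli _ _ h1
    rw [e1, e2, zero_smul, zero_smul, add_zero, add_zero] at hc'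
    exact Fin.forall_fin_succ.mpr ⟨(smul_eq_zero.mp hc').resolve_right hw₀,
      Fin.forall_fin_two.mpr ⟨e1, e2⟩⟩
  have hg₁0 : lam g₁ ≠ 0 := fun h => one_ne_zero (hli 1 0 (by rw [h]; simp)).1
  let g : Module.Basis (Fin 3) F (Fin 3 → F) :=
    basisOfLinearIndependentOfCardEqFinrank hg (by simp)
  have hgc : ⇑g = ![w₀, g₁, g₂] := coe_basisOfLinearIndependentOfCardEqFinrank _ _
  have hK := linearIndependent_subplaneVec e hg
  let e₁ : Module.Basis (Fin 3) K (Fin 3 → K) :=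
    basisOfLinearIndependentOfCardEqFinrank hK (by simp)
  let k : Kˣ := Units.mk0 (lam g₁)⁻¹ (inv_ne_zero hg₁0)
  let e' : Module.Basis (Fin 3) K (Fin 3 → K) := e₁.unitsSMul fun _ => k
  have he' : ∀ i, e' i = (lam g₁)⁻¹ • subplaneVec e (g i) := by
    intro i
    rw [Module.Basis.unitsSMul_apply, coe_basisOfLinearIndependentOfCardEqFinrank, hgc]
    rfl
  have hvec : ∀ w : Fin 3 → F, subplaneVec e' w =
      (lam g₁)⁻¹ • subplaneVec e (∑ i, w i • g i) := by
    intro w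
    rw [subplaneVec_apply, map_sum, Finset.smul_sum]
    refine Finset.sum_congr rfl fun i _ => ?_
    rw [he', map_smul, algebraMap_smul, smul_comm]
  refine ⟨e', ?_, ?_, ?_, ?_⟩
  · rw [he', map_smul, ← hlam, hgc]
    show _ • lam w₀ = 0
    rw [hw₀L, smul_zero]
  · rw [he', map_smul, ← hlam, hgc]
    exact inv_mul_cancel₀ hg₁0
  · rw [he', map_smul, ← hlam, hgc]
    rintro ⟨c, hc⟩
    have hc' : algebraMap F K c = (lam g₁)⁻¹ * lam g₂ := hc
    refine one_ne_zero (neg_eq_zero.mp (hli c (-1) ?_).2)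
    rw [Algebra.smul_def, hc', mul_right_comm, inv_mul_cancel₀ hg₁0]
    simp
  · ext p
    constructor
    · rintro ⟨w, hw, hp⟩
      refine ⟨g.equivFun w, fun h => hw (g.equivFun.map_eq_zero_iff.mp h), ?_⟩
      rw [hvec, g.sum_equivFun, span_smul_singleton (inv_ne_zero hg₁0)]
      exact hp
    · rintro ⟨w, hw, hp⟩
      refine ⟨∑ i, w i • g i, fun h => hw ?_, ?_⟩
      · rw [← g.equivFun_symm_apply] at h
        exact g.equivFun.symm.map_eq_zero_iff.mp h
      · rw [hvec, span_smul_singleton (inv_ne_zero hg₁0)] at hp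
        exact hp

/-- A line through two points of `B` has coefficients in `F`, given by the cross product of their
coordinates. Incidence with `(m, -θ, 1)` reads `y₀ m - y₁ θ + y₂ = 0`, which expresses `m` through
`1` and `θ` once `y₀ ≠ 0`. -/
lemma mem_extended_line_iff (e : Module.Basis (Fin 3) K (Fin 3 → K)) {θ m : K}
    (hθ : θ ∉ Set.range (algebraMap F K)) {p : ℙ K (Fin 3 → K)}
    (hp : p.submodule = Submodule.span K {m • e 0 - θ • e 1 + e 2}) {B : Set (ℙ K (Fin 3 → K))}
    (hB : B = {p | ∃ w : Fin 3 → F, w ≠ 0 ∧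
      p.submodule = Submodule.span K {subplaneVec e w}}) :
    (∃ L, IsLine L ∧ (∃ p ∈ B ∩ L, ∃ p' ∈ B ∩ L, p ≠ p') ∧ p ∈ L) ↔
      ∃ α β : F, m = α • (1 : K) + β • θ := by
  subst hB
  have hcoord : ∀ x : Fin 3 → K, ∀ w w' : Fin 3 → F, ∀ k k' : K,
      k • subplaneVec e w + k' • subplaneVec e w' = ∑ j, x j • e j →
      ∀ j, k * algebraMap F K (w j) + k' * algebraMap F K (w' j) = x j := by
    intro x w w' k k' h j
    have := congrArg (fun v => e.equivFun v j) h
    simp only [map_add, map_smul, Pi.add_apply, Pi.smul_apply, equivFun_subplaneVec,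
      smul_eq_mul] at this
    rw [this, ← e.equivFun_symm_apply, LinearEquiv.apply_symm_apply]
  have hd : m • e 0 - θ • e 1 + e 2 = ∑ j, (![m, -θ, 1] : Fin 3 → K) j • e j := by
    rw [Fin.sum_univ_three]
    show _ = m • e 0 + (-θ) • e 1 + (1 : K) • e 2
    module
  constructor
  · rintro ⟨_, ⟨X, hX, rfl⟩, ⟨p₁, ⟨⟨w, hw, hp₁⟩, hp₁X⟩, p₂, ⟨⟨w', hw', hp₂⟩, hp₂X⟩, hne⟩, hpX⟩
    have h1 : subplaneVec e w ∈ X := by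
      have : p₁.submodule ≤ X := hp₁X
      rwa [hp₁, Submodule.span_singleton_le_iff_mem] at this
    have h2 : subplaneVec e w' ∈ X := by
      have : p₂.submodule ≤ X := hp₂X
      rwa [hp₂, Submodule.span_singleton_le_iff_mem] at this
    have h3 : m • e 0 - θ • e 1 + e 2 ∈ X := by
      have : p.submodule ≤ X := hpX
      rwa [hp, Submodule.span_singleton_le_iff_mem] at this
    have hne0 : subplaneVec e w ≠ 0 := fun h => hw ((map_eq_zero_iff _
      (subplaneVec_injective e)).mp h)
    have hw'0 : subplaneVec e w' ≠ 0 := fun h => hw' ((map_eq_zero_iff _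
      (subplaneVec_injective e)).mp h)
    have hnk : ∀ k : K, k • subplaneVec e w ≠ subplaneVec e w' := by
      intro k hk
      have hk0 : k ≠ 0 := by rintro rfl; exact hw'0 (by rw [← hk, zero_smul])
      apply hne
      apply Projectivization.submodule_injective
      rw [hp₁, hp₂, ← hk, span_smul_singleton hk0]
    have hli := (LinearIndependent.pair_iff' hne0).mpr hnk
    have hXfd : FiniteDimensional K X := FiniteDimensional.of_finrank_pos (by omega)
    have hXe : Submodule.span K {subplaneVec e w, subplaneVec e w'} = X :=
      Submodule.eq_of_le_of_finrank_eq
        (by rw [Submodule.span_le, Set.pair_subset_iff]; exact ⟨h1, h2⟩)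
        (by rw [finrank_span_pair hli, hX])
    rw [← hXe, hd] at h3
    obtain ⟨k, k', hk⟩ := Submodule.mem_span_pair.mp h3
    have hc := hcoord _ _ _ _ _ hk
    have c0 : k * algebraMap F K (w 0) + k' * algebraMap F K (w' 0) = m := hc 0
    have c1 : k * algebraMap F K (w 1) + k' * algebraMap F K (w' 1) = -θ := hc 1
    have c2 : k * algebraMap F K (w 2) + k' * algebraMap F K (w' 2) = 1 := hc 2
    set y₀ := w 1 * w' 2 - w 2 * w' 1 with hy₀
    set y₁ := w 2 * w' 0 - w 0 * w' 2 with hy₁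
    set y₂ := w 0 * w' 1 - w 1 * w' 0 with hy₂
    have hrel : algebraMap F K y₀ * m - algebraMap F K y₁ * θ + algebraMap F K y₂ = 0 := by
      simp only [hy₀, hy₁, hy₂, map_sub, map_mul]
      rw [← c0]
      linear_combination
        (algebraMap F K (w 2) * algebraMap F K (w' 0) -
          algebraMap F K (w 0) * algebraMap F K (w' 2)) * (-c1) -
        (algebraMap F K (w 0) * algebraMap F K (w' 1) -
          algebraMap F K (w 1) * algebraMap F K (w' 0)) * c2
    -- If `y₀ = 0`, then `θ ∉ F` forces the whole cross product to vanish, and the two points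
    -- coincide.
    have hy : y₀ ≠ 0 := by
      intro h0
      rw [h0, map_zero, zero_mul, zero_sub, neg_add_eq_zero] at hrel
      have hy1 : y₁ = 0 := by
        by_contra h1
        have h1' : algebraMap F K y₁ ≠ 0 := by rwa [Ne, map_eq_zero]
        exact hθ ⟨y₂ / y₁, by rw [map_div₀, div_eq_iff h1', ← hrel, mul_comm]⟩
      have hy2 : y₂ = 0 := by
        rw [hy1, map_zero, zero_mul] at hrel
        exact (map_eq_zero _).mp hrel.symm
      have hcr : crossProduct w w' = 0 := by
        rw [cross_apply]
        ext j
        fin_cases j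
        · exact h0
        · exact hy1
        · exact hy2
      have hdep : ¬ LinearIndependent F ![w, w'] := fun h =>
        (crossProduct_ne_zero_iff_linearIndependent.mpr h) hcr
      rw [LinearIndependent.pair_iff' hw] at hdep
      push Not at hdep
      obtain ⟨a, rfl⟩ := hdep
      exact hnk (algebraMap F K a) (by rw [map_smul, algebraMap_smul])
    have hy' : algebraMap F K y₀ ≠ 0 := by rwa [Ne, map_eq_zero]
    refine ⟨-y₂ / y₀, y₁ / y₀, ?_⟩
    rw [Algebra.smul_def, Algebra.smul_def, map_div₀, map_div₀, map_neg]
    field_simp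
    linear_combination hrel
  · rintro ⟨α, β, rfl⟩
    -- Chosen so that `(m, -θ, 1) = w + θ w'`.
    let w : Fin 3 → F := ![α, 0, 1]
    let w' : Fin 3 → F := ![β, -1, 0]
    have hw : w ≠ 0 := fun h => one_ne_zero (congrFun h 2)
    have hw' : w' ≠ 0 := fun h => one_ne_zero (neg_eq_zero.mp (congrFun h 1))
    have hv : subplaneVec e w = algebraMap F K α • e 0 + e 2 := by
      rw [subplaneVec_apply, Fin.sum_univ_three]
      show algebraMap F K α • e 0 + algebraMap F K 0 • e 1 + algebraMap F K 1 • e 2 = _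
      rw [(algebraMap F K).map_zero, (algebraMap F K).map_one]; module
    have hv' : subplaneVec e w' = algebraMap F K β • e 0 - e 1 := by
      rw [subplaneVec_apply, Fin.sum_univ_three]
      show algebraMap F K β • e 0 + algebraMap F K (-1) • e 1 + algebraMap F K 0 • e 2 = _
      rw [(algebraMap F K).map_zero, (algebraMap F K).map_neg, (algebraMap F K).map_one]; module
    have hne0 : subplaneVec e w ≠ 0 := fun h => hw ((map_eq_zero_iff _
      (subplaneVec_injective e)).mp h)
    have hne0' : subplaneVec e w' ≠ 0 := fun h => hw' ((map_eq_zero_iff _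
      (subplaneVec_injective e)).mp h)
    have hnk : ∀ k : K, k • subplaneVec e w ≠ subplaneVec e w' := by
      intro k hk
      obtain ⟨c, hc⟩ := exists_eq_smul_of_subplaneVec e hw hk
      have h1 : (-1 : F) = c * 0 := congrFun hc 1
      rw [mul_zero] at h1
      exact one_ne_zero (neg_eq_zero.mp h1)
    have hli := (LinearIndependent.pair_iff' hne0).mpr hnk
    refine ⟨_, ⟨Submodule.span K {subplaneVec e w, subplaneVec e w'}, finrank_span_pair hli, rfl⟩,
      ⟨Projectivization.mk K _ hne0, ⟨⟨w, hw, Projectivization.submodule_mk _ _⟩,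
        (mem_pts_mk _).mpr (Submodule.subset_span (by simp))⟩,
      Projectivization.mk K _ hne0', ⟨⟨w', hw', Projectivization.submodule_mk _ _⟩,
        (mem_pts_mk _).mpr (Submodule.subset_span (by simp))⟩, fun h => ?_⟩, ?_⟩
    · obtain ⟨k, hk⟩ := (Projectivization.mk_eq_mk_iff' K _ _ hne0' hne0).mp h.symm
      exact hnk k hk
    · show p.submodule ≤ _
      rw [hp, Submodule.span_singleton_le_iff_mem, Submodule.mem_span_pair]
      refine ⟨1, θ, ?_⟩
      have hm : α • (1 : K) + β • θ = algebraMap F K α + algebraMap F K β * θ := by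
        rw [Algebra.smul_def, Algebra.smul_def, mul_one]
      rw [hv, hv', hm]
      module

end Subplane

/-! ### Matching the given surface with the model. -/

section TangentSubplane

variable {F K W : Type*} [Field F] [Field K] [Algebra F K] [AddCommGroup W] [Module F W]
  {H : Submodule F W} {S : Set (Submodule F W)} {σ : ℙ K (Fin 3 → K) ≃ BBPoint H S}

lemma exists_coordinate_equiv {M : Type*} [AddCommGroup M] [Module K M]
    (hK : Module.finrank F K = 3) (hW : Module.finrank F W = 7) {h : W →ₗ[F] F} {Ψ : M →+ W}
    (hinj : Function.Injective Ψ) (hΨ : ∀ m, h (Ψ m) = 0)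
    (hlin : ∀ (c : F) m, Ψ (algebraMap F K c • m) = c • Ψ m) {E₀ E₁ : M}
    (hE : LinearIndependent K ![E₀, E₁]) {w₁ : W} (hw₁ : h w₁ = 1) :
    ∃ D : (K × K × F) ≃ₗ[F] W, ∀ x y z, D (x, y, z) = Ψ (x • E₀ + y • E₁) + z • w₁ := by
  have hKf : FiniteDimensional F K := FiniteDimensional.of_finrank_pos (by omega)
  have hfd : FiniteDimensional F W := FiniteDimensional.of_finrank_pos (by omega)
  let D : (K × K × F) →ₗ[F] W :=
    { toFun := fun t => Ψ (t.1 • E₀ + t.2.1 • E₁) + t.2.2 • w₁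
      map_add' := fun s t => by
        simp only [Prod.fst_add, Prod.snd_add, add_smul, map_add]
        abel
      map_smul' := fun c t => by
        show Ψ ((c • t.1) • E₀ + (c • t.2.1) • E₁) + (c * t.2.2) • w₁ =
          c • (Ψ (t.1 • E₀ + t.2.1 • E₁) + t.2.2 • w₁)
        rw [smul_add, ← hlin, smul_add, smul_smul, smul_smul, Algebra.smul_def c t.1,
          Algebra.smul_def c t.2.1, mul_smul c t.2.2] }
  have hD : Function.Injective D := by
    rw [injective_iff_map_eq_zero]
    intro t ht
    have ht' : Ψ (t.1 • E₀ + t.2.1 • E₁) + t.2.2 • w₁ = 0 := ht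
    have h1 := congrArg h ht'
    rw [map_add, hΨ, map_smul, hw₁, zero_add, map_zero, smul_eq_mul, mul_one] at h1
    rw [h1, zero_smul, add_zero] at ht'
    obtain ⟨h2, h3⟩ := LinearIndependent.pair_iff.mp hE _ _ ((map_eq_zero_iff Ψ hinj).mp ht')
    exact Prod.ext h2 (Prod.ext h3 h1)
  refine ⟨D.linearEquivOfInjective hD ?_, fun x y z => rfl⟩
  rw [Module.finrank_prod, Module.finrank_prod, hK, Module.finrank_self, hW]

variable {D : (K × K × F) ≃ₗ[F] W} {L : (Fin 3 → K) →ₗ[K] K} {o : Fin 3 → K}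
  {Ψ : LinearMap.ker L →+ W} {w₀ : W} {e : Module.Basis (Fin 3) K (Fin 3 → K)}
  {E₀ E₁ m₁ : LinearMap.ker L} {θ : K} {p q r : F} {hli : LinearIndependent F ![1, θ, θ ^ 2]}

/-- The affine points of a tangent subplane lie on the generators of the model scroll. -/
lemma isAffineImage_subplaneVec (haff : ∀ m : LinearMap.ker L, IsAffineImage σ (o + m) (w₀ + Ψ m))
    (hE₀ : (E₀ : Fin 3 → K) = e 0) (hE₁ : (E₁ : Fin 3 → K) = e 2 - θ • e 1)
    (hm₁ : (m₁ : Fin 3 → K) = e 1 - o)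
    (hD : ∀ x y z, D (x, y, z) = Ψ (x • E₀ + y • E₁) + z • (w₀ + Ψ m₁))
    (hθ : θ ^ 3 = p • θ ^ 2 + q • θ + r • (1 : K)) (k : F) {u : Fin 2 → F} (hu : u ≠ 0) :
    IsAffineImage σ (subplaneVec e ![k, u 0, u 1])
      (k • nrcVec (modelScroll D hli p q r).a u + nrcVec (modelScroll D hli p q r).b u) := by
  set lam : K := u 0 • (1 : K) + u 1 • θ with hlam
  have hlam0 : lam ≠ 0 := add_smul_ne_zero hli hu
  have hN := normForm_ne_zero hli hθ hu
  have hadj : adjForm θ p q u = lam⁻¹ * algebraMap F K (normForm p q r u) := by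
    rw [eq_inv_mul_iff_mul_eq₀ hlam0, mul_adjForm hθ, Algebra.smul_def, mul_one]
  -- The subplane vector is `lam` times a vector with `L = 1`. Scaling the image of the latter by
  -- the norm clears the denominator `lam`.
  have h1 := ((haff (m₁ + ((lam⁻¹ * algebraMap F K k) • E₀ +
    (lam⁻¹ * algebraMap F K (u 1)) • E₁))).smul_right hN).smul_left hlam0
  convert h1 using 1
  · have e1 : o + ((m₁ + ((lam⁻¹ * algebraMap F K k) • E₀ +
        (lam⁻¹ * algebraMap F K (u 1)) • E₁) : LinearMap.ker L) : Fin 3 → K) =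
        e 1 + ((lam⁻¹ * algebraMap F K k) • e 0 +
          (lam⁻¹ * algebraMap F K (u 1)) • (e 2 - θ • e 1)) := by
      simp only [Submodule.coe_add, Submodule.coe_smul, hE₀, hE₁, hm₁]
      abel
    rw [e1, smul_add, smul_add, smul_smul, smul_smul, mul_inv_cancel_left₀ hlam0,
      mul_inv_cancel_left₀ hlam0, subplaneVec_apply, Fin.sum_univ_three]
    show algebraMap F K k • e 0 + algebraMap F K (u 0) • e 1 + algebraMap F K (u 1) • e 2 = _
    have e2 : lam = algebraMap F K (u 0) + algebraMap F K (u 1) * θ := by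
      rw [hlam, Algebra.smul_def, Algebra.smul_def, mul_one]
    rw [e2]
    module
  · have e3 : w₀ + Ψ (m₁ + ((lam⁻¹ * algebraMap F K k) • E₀ +
        (lam⁻¹ * algebraMap F K (u 1)) • E₁)) =
        D (lam⁻¹ * algebraMap F K k, lam⁻¹ * algebraMap F K (u 1), 1) := by
      rw [hD, map_add, one_smul]
      abel
    rw [e3, nrcVec_modelScroll_a, nrcVec_modelScroll_b, ← map_smul, ← map_smul, ← map_add, hadj]
    congr 1
    simp only [Prod.smul_mk, Prod.mk_add_mk, smul_zero, zero_add, add_zero, smul_eq_mul, mul_one,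
      mul_zero]
    refine Prod.ext ?_ (Prod.ext ?_ rfl) <;> simp only [Algebra.smul_def] <;> ring

variable [Finite F]

/-- A ruled quintic surface corresponding to a tangent subplane has the generators of the model
scroll. -/
lemma generators_modelScroll_eq (hF : 3 ≤ Nat.card F) {B : Set (ℙ K (Fin 3 → K))}
    {V : Scroll F W} (hV : Corresponds σ B V)
    (hB : B = {p | ∃ w : Fin 3 → F, w ≠ 0 ∧ p.submodule = Submodule.span K {subplaneVec e w}})
    (haff : ∀ (k : F) (u : Fin 2 → F), u ≠ 0 → IsAffineImage σ (subplaneVec e ![k, u 0, u 1])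
      (k • nrcVec (modelScroll D hli p q r).a u + nrcVec (modelScroll D hli p q r).b u)) :
    (modelScroll D hli p q r).generators = V.generators := by
  classical
  refine Scroll.generators_eq_of_subset ?_
  rintro _ ⟨u, hu, rfl⟩
  have hvec : ∀ k : F, k • nrcVec (modelScroll D hli p q r).a u +
      nrcVec (modelScroll D hli p q r).b u ∈ (modelScroll D hli p q r).generator u := fun k =>
    Submodule.add_mem _ (Submodule.smul_mem _ _ (Submodule.subset_span (Set.mem_insert _ _)))
      (Submodule.subset_span (Set.mem_insert_of_mem _ rfl))
  choose hv hx hP hσ using fun k => haff k u hu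
  have : Fintype F := Fintype.ofFinite F
  -- Three values of `k` give three affine points of `B` on the model generator. They lie on `V`, so
  -- this line is a generator of `V`.
  obtain ⟨κ⟩ : Nonempty (Fin 3 ↪ F) := Function.Embedding.nonempty_of_card_le (by
    rw [Fintype.card_fin, ← Nat.card_eq_fintype_card]; exact hF)
  refine V.mem_generators_of_collinear ((modelScroll D hli p q r).finrank_generator hu)
    (P := fun i => Projectivization.mk F _ (hx (κ i))) ?_ (fun i => (mem_pts_mk _).mpr (hvec _))
    fun i => ?_
  · intro i j hij
    apply κ.injective
    obtain ⟨c, hc⟩ := (Projectivization.mk_eq_mk_iff' F _ _ _ _).mp hij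
    have hind := LinearIndependent.pair_iff.mp
      ((modelScroll D hli p q r).linearIndependent_generator hu)
      (c * κ j - κ i) (c - 1) (by
        have hc' := sub_eq_zero.mpr hc
        rw [← hc']
        show (c * κ j - κ i) • _ + (c - 1) • nrcVec (modelScroll D hli p q r).b u = _
        module)
    have hc1 : c = 1 := sub_eq_zero.mp hind.2
    rw [hc1, one_mul] at hind
    exact (sub_eq_zero.mp hind.1).symm
  · refine (hV ⟨_, hP (κ i)⟩).mpr ?_
    rw [← hσ, Equiv.symm_apply_apply, hB]
    refine ⟨_, fun h0 => hu ?_, Projectivization.submodule_mk _ _⟩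
    ext j
    fin_cases j
    · exact congrFun h0 1
    · exact congrFun h0 2

theorem ncard_sections_of_coordinates (hq : 6 ≤ Nat.card F)
    (hK : Module.finrank F K = 3) (hW : Module.finrank F W = 7) (hS : IsSpread H S)
    {B : Set (ℙ K (Fin 3 → K))} (hB : IsSubplane F B) (hT : IsTangent σ B)
    {V : Scroll F W} (hV : Corresponds σ B V)
    {ℓ : Submodule F W} (hℓ : Module.finrank F ℓ = 2) (hℓα : ℓ ≤ V.plane)
    {i : ℕ} (hi : (pts ℓ ∩ V.conic).ncard = i)
    {π : Submodule F W} (hπ : π ∈ S) (hπα : π ≠ V.plane)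
    {h : W →ₗ[F] F} (hh : LinearMap.ker h = H) (ho : L o = 1) (hw₀ : h w₀ = 1)
    (hinj : Function.Injective Ψ) (hΨ : ∀ m, h (Ψ m) = 0)
    (hlin : ∀ (c : F) m, Ψ (algebraMap F K c • m) = c • Ψ m)
    (haff : ∀ m : LinearMap.ker L, IsAffineImage σ (o + m) (w₀ + Ψ m))
    (hinf : ∀ m : LinearMap.ker L, m ≠ 0 → ∃ Y, IsInfiniteImage σ m Y ∧
      ∀ m', Ψ m' ∈ Y ↔ m' ∈ Submodule.span K {m}) :
    (fiveSpaces H π ℓ).ncard = Nat.card F ∧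
    (π ∈ splash σ B →
      {X ∈ fiveSpaces H π ℓ | V.MeetsIn X 5 0}.ncard = Nat.card F - 1 ∧
      {X ∈ fiveSpaces H π ℓ | V.MeetsIn X 3 i}.ncard = 1) ∧
    (π ∉ splash σ B →
      {X ∈ fiveSpaces H π ℓ | V.MeetsIn X 5 0}.ncard = Nat.card F - i ∧
      {X ∈ fiveSpaces H π ℓ | V.MeetsIn X 4 1}.ncard = i) := by
  have hLσ : ∀ v (hv : v ≠ 0), σ (Projectivization.mk K v hv) ∈ Set.range Sum.inr → L v = 0 := by
    rintro v hv ⟨Y, hY⟩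
    by_contra hLv
    let m : LinearMap.ker L := ⟨(L v)⁻¹ • v - o, by simp [ho, hLv]⟩
    have hm : L v • (o + (m : Fin 3 → K)) = v := by simp [m, smul_smul, hLv]
    obtain ⟨hv', hx, hP, hσv⟩ := (haff m).smul_left hLv
    simp only [hm] at hσv
    rw [hσv] at hY
    cases hY
  have hLσ' : ∀ v (hv : v ≠ 0), L v = 0 → σ (Projectivization.mk K v hv) ∈ Set.range Sum.inr := by
    intro v hv hLv
    obtain ⟨Y, ⟨hv', hY, hσv⟩, -⟩ := hinf ⟨v, hLv⟩ fun h0 => hv (congrArg Subtype.val h0)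
    exact ⟨_, hσv.symm⟩
  have hTL : ∃! p, p ∈ B ∧ p ∈ pts (LinearMap.ker L) := by
    have hiff : ∀ t : ℙ K (Fin 3 → K), t ∈ pts (LinearMap.ker L) ↔ σ t ∈ Set.range Sum.inr := by
      intro t
      induction t using Projectivization.ind with
      | h v hv =>
        rw [mem_pts_mk, LinearMap.mem_ker]
        exact ⟨hLσ' v hv, hLσ v hv⟩
    simp only [hiff]
    exact hT
  obtain ⟨e, he0, he1, hθF, hBe⟩ := exists_adapted_basis hB hTL
  set θ := L (e 2) with hθdef
  have hli := linearIndependent_one_pow_two hK hθF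
  obtain ⟨p, q, r, hθ⟩ := exists_cubic_relation hK hli
  let E₀ : LinearMap.ker L := ⟨e 0, he0⟩
  let E₁ : LinearMap.ker L := ⟨e 2 - θ • e 1, by simp [he1, ← hθdef]⟩
  let m₁ : LinearMap.ker L := ⟨e 1 - o, by simp [he1, ho]⟩
  have hcoord : ∀ x y : K, x • (E₀ : Fin 3 → K) + y • (E₁ : Fin 3 → K) =
      e.equivFun.symm ![x, -(y * θ), y] := by
    intro x y
    rw [e.equivFun_symm_apply, Fin.sum_univ_three]
    show x • e 0 + y • (e 2 - θ • e 1) = x • e 0 + (-(y * θ)) • e 1 + y • e 2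
    module
  have hE : LinearIndependent K ![E₀, E₁] := by
    rw [LinearIndependent.pair_iff]
    intro s t hst
    have h1 := congrArg Subtype.val hst
    have h2 : e.equivFun.symm ![s, -(t * θ), t] = 0 := (hcoord s t).symm.trans h1
    rw [LinearEquiv.map_eq_zero_iff] at h2
    exact ⟨congrFun h2 0, congrFun h2 2⟩
  have hspan : ∀ d : LinearMap.ker L, ∃ x y : K, d = x • E₀ + y • E₁ := by
    intro d
    have h1 := e.sum_equivFun (d : Fin 3 → K)
    rw [Fin.sum_univ_three] at h1
    have h2 := LinearMap.mem_ker.mp d.2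
    rw [← h1, map_add, map_add, map_smul, map_smul, map_smul, he0, he1, ← hθdef, smul_zero,
      zero_add, smul_eq_mul, mul_one, smul_eq_mul] at h2
    refine ⟨e.equivFun d 0, e.equivFun d 2, Subtype.ext ?_⟩
    refine h1.symm.trans ?_
    rw [eq_neg_of_add_eq_zero_left h2]
    show _ = e.equivFun d 0 • e 0 + e.equivFun d 2 • (e 2 - θ • e 1)
    module
  have hw₁ : h (w₀ + Ψ m₁) = 1 := by rw [map_add, hw₀, hΨ, add_zero]
  obtain ⟨D, hD⟩ := exists_coordinate_equiv hK hW hinj hΨ hlin hE hw₁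
  have hH : ∀ x y z, D (x, y, z) ∈ H ↔ z = 0 := by
    intro x y z
    rw [← hh, LinearMap.mem_ker, hD, map_add, hΨ, map_smul, hw₁, zero_add, smul_eq_mul, mul_one]
  -- From here on `V` can be replaced by the model, because plane, conic and sections depend only on
  -- the generators.
  have hgen : (modelScroll D hli p q r).generators = V.generators :=
    generators_modelScroll_eq (by omega) hV hBe fun k u hu =>
      isAffineImage_subplaneVec haff rfl rfl rfl hD hθ k hu
  have hpts := Scroll.points_eq_of_generators_eq hgen
  have hplane := Scroll.plane_eq_of_generators_eq (by omega) hgen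
  have hconic := Scroll.conic_eq_of_generators_eq (by omega) hgen
  have hmeets : ∀ X r' k, V.MeetsIn X r' k ↔ (modelScroll D hli p q r).MeetsIn X r' k := by
    intro X r' k
    simp only [Scroll.MeetsIn, hgen, hpts]
  obtain ⟨d, hd, hσd⟩ : ∃ d : Fin 3 → K, ∃ hd : d ≠ 0,
      σ (Projectivization.mk K d hd) = Sum.inr ⟨π, hπ⟩ :=
    ⟨_, (σ.symm (Sum.inr ⟨π, hπ⟩)).rep_nonzero, by
      rw [Projectivization.mk_rep, Equiv.apply_symm_apply]⟩
  have hLd : L d = 0 := hLσ d hd ⟨_, hσd.symm⟩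
  obtain ⟨x, y, hxy⟩ := hspan ⟨d, hLd⟩
  have hπΨ : ∀ m', Ψ m' ∈ π ↔ m' ∈ Submodule.span K {x • E₀ + y • E₁} := by
    obtain ⟨Y, ⟨hd', hY, hσY⟩, hYm⟩ := hinf ⟨d, hLd⟩ fun h0 => hd (congrArg Subtype.val h0)
    have : Y = π := congrArg Subtype.val (Sum.inr_injective (hσY.symm.trans hσd))
    rw [← hxy, ← this]
    exact hYm
  have hπD : ∀ x' y' z, D (x', y', z) ∈ π ↔ (∃ k : K, k * x = x' ∧ k * y = y') ∧ z = 0 := by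
    intro x' y' z
    have key : Ψ (x' • E₀ + y' • E₁) ∈ π ↔ ∃ k : K, k * x = x' ∧ k * y = y' := by
      rw [hπΨ, Submodule.mem_span_singleton]
      refine exists_congr fun k => ⟨fun hk => ?_, fun ⟨h1, h2⟩ => ?_⟩
      · have h0 : (k * x - x') • E₀ + (k * y - y') • E₁ = 0 := by
          rw [← sub_eq_zero] at hk
          rw [← hk]; module
        obtain ⟨h1, h2⟩ := LinearIndependent.pair_iff.mp hE _ _ h0
        exact ⟨sub_eq_zero.mp h1, sub_eq_zero.mp h2⟩
      · rw [← h1, ← h2]; module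
    constructor
    · intro hm
      have hz : z = 0 := (hH x' y' z).mp ((hS.1 π hπ).1 hm)
      rw [hz, hD, zero_smul, add_zero, key] at hm
      exact ⟨hm, hz⟩
    · rintro ⟨hk, rfl⟩
      rwa [hD, zero_smul, add_zero, key]
  -- A direction with `y = 0` is a multiple of `E₀`, whose spread plane is the plane of the conic.
  have hy : y ≠ 0 := by
    rintro rfl
    apply hπα
    have hx : x ≠ 0 := by
      rintro rfl
      apply hd
      rw [zero_smul, zero_smul, add_zero] at hxy
      exact congrArg Subtype.val hxy
    rw [← hplane]
    ext w
    rw [mem_modelScroll_plane D hli hK]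
    obtain ⟨⟨x', y', z⟩, rfl⟩ := D.surjective w
    rw [hπD]
    constructor
    · rintro ⟨⟨k, rfl, rfl⟩, rfl⟩
      exact ⟨k * x, by rw [mul_zero]⟩
    · rintro ⟨x'', hx''⟩
      have := D.injective hx''
      simp only [Prod.mk.injEq] at this
      exact ⟨⟨x' / x, by field_simp, by rw [mul_zero, this.2.1]⟩, this.2.2⟩
  have hπm : ∀ x' y' z, D (x', y', z) ∈ π ↔ x' = x / y * y' ∧ z = 0 := by
    intro x' y' z
    rw [hπD, and_congr_left_iff]
    intro _
    constructor
    · rintro ⟨k, rfl, rfl⟩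
      field_simp
    · rintro rfl
      exact ⟨y' / y, by field_simp, by field_simp⟩
  have hsplash : π ∈ splash σ B ↔ ∃ α β : F, x / y = α • (1 : K) + β • θ := by
    rw [← mem_extended_line_iff e hθF (p := Projectivization.mk K d hd) ?_ hBe]
    · have hsymm : σ.symm (Sum.inr ⟨π, hπ⟩) = Projectivization.mk K d hd := by
        rw [Equiv.symm_apply_eq, hσd]
      constructor
      · rintro ⟨_, hL⟩
        rwa [hsymm] at hL
      · intro hL
        exact ⟨hπ, by rwa [hsymm]⟩
    · rw [Projectivization.submodule_mk]
      have hd' : d = y • ((x / y) • e 0 - θ • e 1 + e 2) := by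
        have h1 : d = x • e 0 + y • (e 2 - θ • e 1) := congrArg Subtype.val hxy
        have h2 : x • e 0 = y • ((x / y) • e 0) := by rw [smul_smul, mul_div_cancel₀ _ hy]
        rw [h1, h2]
        module
      rw [hd', span_smul_singleton hy]
  have main := ncard_sections (D := D) (hli := hli) (by omega) hK hθ hH hπm hℓ
    (by rw [hplane]; exact hℓα) (i := i) (by rw [hconic]; exact hi)
  simp only [hmeets, hsplash]
  exact main

end TangentSubplane

end RuledQuintic

theorem mainTheorem5 {F K W : Type*} [Field F] [Finite F] [Field K] [Algebra F K]
    [AddCommGroup W] [Module F W]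
    (hq : 6 ≤ Nat.card F) (hK : Module.finrank F K = 3) (hW : Module.finrank F W = 7)
    (H : Submodule F W) (hH : Module.finrank F H = 6)
    (S : Set (Submodule F W)) (hS : RuledQuintic.IsRegularSpread H S)
    (σ : ℙ K (Fin 3 → K) ≃ RuledQuintic.BBPoint H S) (hσ : RuledQuintic.IsBruckBose σ)
    (B : Set (ℙ K (Fin 3 → K))) (hB : RuledQuintic.IsSubplane F B)
    (hT : RuledQuintic.IsTangent σ B)
    (V : RuledQuintic.Scroll F W) (hV : RuledQuintic.Corresponds σ B V)
    (ℓ : Submodule F W) (hℓ : Module.finrank F ℓ = 2) (hℓα : ℓ ≤ V.plane)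
    (i : ℕ) (hi : (RuledQuintic.pts ℓ ∩ V.conic).ncard = i)
    (π : Submodule F W) (hπ : π ∈ S) (hπα : π ≠ V.plane) :
    (RuledQuintic.fiveSpaces H π ℓ).ncard = Nat.card F ∧
    (π ∈ RuledQuintic.splash σ B →
      {X ∈ RuledQuintic.fiveSpaces H π ℓ | V.MeetsIn X 5 0}.ncard = Nat.card F - 1 ∧
      {X ∈ RuledQuintic.fiveSpaces H π ℓ | V.MeetsIn X 3 i}.ncard = 1) ∧
    (π ∉ RuledQuintic.splash σ B →
      {X ∈ RuledQuintic.fiveSpaces H π ℓ | V.MeetsIn X 5 0}.ncard = Nat.card F - i ∧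
      {X ∈ RuledQuintic.fiveSpaces H π ℓ | V.MeetsIn X 4 1}.ncard = i) := by
  have hfd : FiniteDimensional F W := FiniteDimensional.of_finrank_pos (by omega)
  have hKf : FiniteDimensional F K := FiniteDimensional.of_finrank_pos (by omega)
  obtain ⟨h, hh, -⟩ := RuledQuintic.exists_ker_eq H (by rw [hH, hW])
  obtain ⟨L, o, Ψ, w₀, ψ, ho, hw₀, hinj, hΨ, hlin, haff, hinf⟩ :=
    RuledQuintic.exists_semilinear_coordinates hW hH hS.1 hσ hh
  -- The coordinates are linear over `ψ`, which may differ from `algebraMap F K` by an automorphism.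
  -- So the algebra structure is changed to `ψ.toAlgebra`: `B` stays a subplane, and the degree `3`
  -- is recovered from the cardinality of `K`.
  have hB' := hB.of_ringHom (RuledQuintic.range_ringHom_eq ψ (algebraMap F K))
  have hcard : Nat.card K = Nat.card F ^ 3 := by
    rw [← hK, Module.natCard_eq_pow_finrank (K := F) (V := K)]
  have hfin : Finite K := Module.finite_of_finite F
  have hK' : @Module.finrank F K _ _ ψ.toAlgebra.toModule = 3 := by
    let := ψ.toAlgebra
    have : Module.Finite F K := Module.Finite.of_finite
    have h2 := Module.natCard_eq_pow_finrank (K := F) (V := K)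
    rw [hcard] at h2
    exact (Nat.pow_right_injective (by omega : 2 ≤ Nat.card F) h2).symm
  exact @RuledQuintic.ncard_sections_of_coordinates F K W _ _ ψ.toAlgebra _ _ H S σ L o Ψ w₀ _
    hq hK' hW hS.1 B hB' hT V hV ℓ hℓ hℓα i hi π hπ hπα h hh ho hw₀ hinj hΨ hlin haff hinf
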